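/- **Setting.** All manifolds, maps, metrics and functions are smooth, and manifolds are finite-dimensional, Hausdorff and without boundary. Let $(\bar M,g,F)$ be a locally product Riemannian manifold: $F$ is a $(1,1)$-tensor field with $F^2=I$, $F\neq\pm I$, $g(F\cdot,F\cdot)=g(\cdot,\cdot)$ and $\bar\nabla F=0$, where $\bar\nabla$ is the Levi-Civita connection of $g$. Let $M$ be a Riemannian manifold isometrically immersed in $\bar M$, with second fundamental form $h(u,v)=(\bar\nabla_u v)^\perp$ and shape operators $A_\xi$ given by $g(A_\xi u,v)=g(h(u,v),\xi)$. For $u$ tangent to $M$ write $Fu=Tu+Nu$ with $Tu$ tangent and $Nu$ normal to $M$. Let $\theta\in(0,\pi/2)$ be a constant and put $$\mathcal D^\perp=\ker T^2,\qquad \mathcal D^T=\ker(T^2-I),\qquad \mathcal D^\theta=\ker(T^2-\cos^2\theta\, I).$$ $M$ is a *proper skew semi-invariant submanifold of order $1$* (with slant angle $\theta$) if $T_pM=\mathcal D^\perp_p\oplus\mathcal D^T_p\oplus\mathcal D^\theta_p$ at every $p\in M$, the three summands are all non-zero at every point, and their dimensions do not depend on $p$. It is *$(\mathcal D^\theta,\mathcal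 D^T)$ mixed totally geodesic* if $h(Z,X)=0$ for $Z\in\mathcal D^\theta$, $X\in\mathcal D^T$. An open set $W\subseteq M$ *is a warped product $M_1\times_f M_T$* if there are Riemannian manifolds $(M_1,g_1)$, $(M_T,g_T)$, a positive function $f$ on $M_1$ and an isometry of $(M_1\times M_T,\ g_1+f^2g_T)$ onto $W$ that maps the leaves $M_1\times\{b\}$ to integral manifolds of $\mathcal D^\perp\oplus\mathcal D^\theta$ and the fibres $\{a\}\times M_T$ to integral manifolds of $\mathcal D^T$; $f$ is then also regarded as a function on $W$. $M$ *is locally a warped product* if every point of $M$ has an open neighbourhood that is a warped product in this sense. For an open set $U\subseteq M$ and a function $\sigma:U\to\mathbb R$ let $(\ast)$ be the conditions that on $U$, for all $X,Y\in\mathcal D^T$, $V\in\mathcal D^\perp$, $Z\in\mathcal D^\theta$, $$Y[\sigma]=0,\qquad A_{FV}FX=-V[\sigma]\,X,\qquad A_{NZ}FX+A_{NTZ}X=-Z[\sigma]\,\sin^2\theta\; X .$$ **Theorem.** Let $M$ be a $(\mathcal D^\theta,\mathcal D^T)$ mixed totally geodesic proper skew semi-invariant submanifold of order $1$ of a locally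 product Riemannian manifold $\bar M$, and suppose that $\mathcal D^T$ is integrable. Then: 1. $M$ is locally a warped product if and only if every point of $M$ has an open neighbourhood $U$ on which there is a function $\sigma$ satisfying $(\ast)$. 2. If $\sigma$ satisfies $(\ast)$ on an open set $U\subseteq M$ (for instance on $U=M$), then every point of $U$ has an open neighbourhood $W\subseteq U$ that is a warped product $M_1\times_f M_T$ with $\sigma=\ln f$ on $W$. 3. Conversely, if an open set $W\subseteq M$ (for instance $W=M$) is a warped product $M_1\times_f M_T$, then $\sigma=\ln f$ satisfies $(\ast)$ on $W$, and if $W$ is connected, every $\sigma$ satisfying $(\ast)$ on $W$ is equal to $\ln f$ up to an additive constant. -/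

import Mathlib

open Bundle VectorField FiberBundle Set
open scoped Manifold ContDiff Topology

noncomputable section

/-! ## Riemannian metrics and the Levi-Civita connection -/

/-- Smooth Riemannian metrics on the (finite-dimensional, boundaryless, smooth) manifold `M`. -/
abbrev RiemMetric (E : Type*) [NormedAddCommGroup E] [NormedSpace ℝ E]
    (M : Type*) [TopologicalSpace M] [ChartedSpace E M] [IsManifold 𝓘(ℝ, E) ∞ M] :=
  ContMDiffRiemannianMetric 𝓘(ℝ, E) ∞ E (fun x : M ↦ TangentSpace 𝓘(ℝ, E) x)

section Metric

variable {E : Type*} [NormedAddCommGroup E] [NormedSpace ℝ E]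
  {M : Type*} [TopologicalSpace M] [ChartedSpace E M]

instance tangentSpace_finiteDimensional [FiniteDimensional ℝ E] (x : M) :
    FiniteDimensional ℝ (TangentSpace 𝓘(ℝ, E) x) :=
  inferInstanceAs (FiniteDimensional ℝ E)

instance tangentSpace_t2Space (x : M) : T2Space (TangentSpace 𝓘(ℝ, E) x) :=
  inferInstanceAs (T2Space E)

variable [IsManifold 𝓘(ℝ, E) ∞ M]

namespace RiemMetric

/-- The metric at `x` as a bilinear form. -/
def bilin (g : RiemMetric E M) (x : M) : LinearMap.BilinForm ℝ (TangentSpace 𝓘(ℝ, E) x) :=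
  LinearMap.mk₂ ℝ (fun u v ↦ g.inner x u v) (by simp) (by simp) (by simp) (by simp)

theorem ext_inner (g : RiemMetric E M) (x : M) {u v : TangentSpace 𝓘(ℝ, E) x}
    (h : ∀ w, g.inner x u w = g.inner x v w) : u = v := by
  rw [← sub_eq_zero]
  by_contra hne
  have h1 := g.pos x _ hne
  have h2 := h (u - v)
  rw [map_sub (g.inner x)] at h1
  simp at h1 h2
  linarith

theorem bilin_nondegenerate (g : RiemMetric E M) (x : M) : (g.bilin x).Nondegenerate := by
  have h : ∀ u, (∀ v, g.bilin x u v = 0) → u = 0 := fun u hu ↦ by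
    by_contra h
    exact (g.pos x u h).ne' (hu u)
  refine ⟨h, fun u hu ↦ h u fun v ↦ ?_⟩
  simpa [RiemMetric.bilin, g.symm x u v] using hu v

/-- The expression on the right of the Koszul formula,
`X⟨Y,Z⟩ + Y⟨X,Z⟩ - Z⟨X,Y⟩ + ⟨[X,Y],Z⟩ - ⟨[X,Z],Y⟩ - ⟨[Y,Z],X⟩`. -/
def koszul (g : RiemMetric E M) (X Y Z : Π x : M, TangentSpace 𝓘(ℝ, E) x) (x : M) : ℝ :=
  mvfderiv 𝓘(ℝ, E) (fun y ↦ g.inner y (Y y) (Z y)) x (X x)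
    + mvfderiv 𝓘(ℝ, E) (fun y ↦ g.inner y (X y) (Z y)) x (Y x)
    - mvfderiv 𝓘(ℝ, E) (fun y ↦ g.inner y (X y) (Y y)) x (Z x)
    + g.inner x (mlieBracket 𝓘(ℝ, E) X Y x) (Z x)
    - g.inner x (mlieBracket 𝓘(ℝ, E) X Z x) (Y x)
    - g.inner x (mlieBracket 𝓘(ℝ, E) Y Z x) (X x)

theorem mdifferentiableAt_inner (g : RiemMetric E M) {X Y : Π x : M, TangentSpace 𝓘(ℝ, E) x}
    {x : M} (hX : MDiffAt (T% X) x) (hY : MDiffAt (T% Y) x) :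
    MDiffAt (fun y ↦ g.inner y (X y) (Y y)) x := by
  have : MDifferentiableAt 𝓘(ℝ, E) (𝓘(ℝ, E).prod 𝓘(ℝ))
      (fun m ↦ TotalSpace.mk' ℝ (E := Bundle.Trivial M ℝ) m (g.inner m (X m) (Y m))) x := by
    apply MDifferentiableAt.clm_bundle_apply₂ (F₁ := E) (F₂ := E)
    · exact g.contMDiff.mdifferentiableAt (by simp)
    · exact hX
    · exact hY
  simp only [mdifferentiableAt_totalSpace] at this
  exact this.2

variable [FiniteDimensional ℝ E] {X Y Z : Π x : M, TangentSpace 𝓘(ℝ, E) x} {x : M}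

/-- The tangent vector that represents a linear form with respect to the metric. -/
def sharp (g : RiemMetric E M) (x : M) :
    (TangentSpace 𝓘(ℝ, E) x →ₗ[ℝ] ℝ) ≃ₗ[ℝ] TangentSpace 𝓘(ℝ, E) x :=
  (LinearMap.BilinForm.toDual (g.bilin x) (g.bilin_nondegenerate x)).symm

theorem inner_sharp (g : RiemMetric E M) (x : M)
    (l : TangentSpace 𝓘(ℝ, E) x →ₗ[ℝ] ℝ) (v : TangentSpace 𝓘(ℝ, E) x) :
    g.inner x (g.sharp x l) v = l v :=
  LinearMap.BilinForm.apply_toDual_symm_apply (hB := g.bilin_nondegenerate x) l v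

theorem koszul_tensorial_right (g : RiemMetric E M)
    (hX : MDiffAt (T% X) x) (hY : MDiffAt (T% Y) x) :
    TensorialAt 𝓘(ℝ, E) E (fun Z ↦ g.koszul X Y Z x) x where
  smul {f Z} hf hZ := by
    have h1 := g.mdifferentiableAt_inner hY hZ
    have h2 := g.mdifferentiableAt_inner hX hZ
    simp [koszul, mlieBracket_smul_right hf hZ, mvfderiv_fun_mul hf h1, mvfderiv_fun_mul hf h2]
    rw [g.symm x (Z x) (X x), g.symm x (Z x) (Y x)]
    ring
  add {Z Z'} hZ hZ' := by
    have h1 := g.mdifferentiableAt_inner hY hZ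
    have h2 := g.mdifferentiableAt_inner hX hZ
    have h1' := g.mdifferentiableAt_inner hY hZ'
    have h2' := g.mdifferentiableAt_inner hX hZ'
    simp [koszul, mlieBracket_add_right hZ hZ', mvfderiv_fun_add h1 h1', mvfderiv_fun_add h2 h2']
    ring

theorem koszul_tensorial_left (g : RiemMetric E M)
    (hY : MDiffAt (T% Y) x) (hZ : MDiffAt (T% Z) x) :
    TensorialAt 𝓘(ℝ, E) E (fun X ↦ g.koszul X Y Z x) x where
  smul {f X} hf hX := by
    have h1 := g.mdifferentiableAt_inner hX hZ
    have h2 := g.mdifferentiableAt_inner hX hY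
    simp [koszul, mlieBracket_smul_left hf hX, mvfderiv_fun_mul hf h1, mvfderiv_fun_mul hf h2]
    ring
  add {X X'} hX hX' := by
    have h1 := g.mdifferentiableAt_inner hX hZ
    have h2 := g.mdifferentiableAt_inner hX hY
    have h1' := g.mdifferentiableAt_inner hX' hZ
    have h2' := g.mdifferentiableAt_inner hX' hY
    simp [koszul, mlieBracket_add_left hX hX', mvfderiv_fun_add h1 h1', mvfderiv_fun_add h2 h2']
    ring

theorem koszul_add_middle (g : RiemMetric E M) {Y' : Π x : M, TangentSpace 𝓘(ℝ, E) x}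
    (hX : MDiffAt (T% X) x) (hY : MDiffAt (T% Y) x) (hY' : MDiffAt (T% Y') x)
    (hZ : MDiffAt (T% Z) x) :
    g.koszul X (Y + Y') Z x = g.koszul X Y Z x + g.koszul X Y' Z x := by
  have h1 := g.mdifferentiableAt_inner hY hZ
  have h2 := g.mdifferentiableAt_inner hX hY
  have h1' := g.mdifferentiableAt_inner hY' hZ
  have h2' := g.mdifferentiableAt_inner hX hY'
  simp [koszul, mlieBracket_add_left hY hY', mlieBracket_add_right hY hY',
    mvfderiv_fun_add h1 h1', mvfderiv_fun_add h2 h2']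
  ring

theorem koszul_smul_middle (g : RiemMetric E M) {f : M → ℝ} (hf : MDiffAt f x)
    (hX : MDiffAt (T% X) x) (hY : MDiffAt (T% Y) x) (hZ : MDiffAt (T% Z) x) :
    g.koszul X (f • Y) Z x =
      f x * g.koszul X Y Z x + 2 * mvfderiv 𝓘(ℝ, E) f x (X x) * g.inner x (Y x) (Z x) := by
  have h1 := g.mdifferentiableAt_inner hY hZ
  have h2 := g.mdifferentiableAt_inner hX hY
  simp [koszul, mlieBracket_smul_left hf hY, mlieBracket_smul_right hf hY,
    mvfderiv_fun_mul hf h1, mvfderiv_fun_mul hf h2]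
  rw [g.symm x (Y x) (X x)]
  ring

open Classical in
/-- `(X₀, Z₀) ↦ koszul X Y Z x` for a vector field `Y` that is differentiable at `x`, where
`X`, `Z` extend the tangent vectors `X₀`, `Z₀` at `x` (and `0` if `Y` is not differentiable). -/
def koszulForm (g : RiemMetric E M) (Y : Π x : M, TangentSpace 𝓘(ℝ, E) x) (x : M) :
    TangentSpace 𝓘(ℝ, E) x →L[ℝ] TangentSpace 𝓘(ℝ, E) x →L[ℝ] ℝ :=
  if hY : MDiffAt (T% Y) x then
    TensorialAt.mkHom₂ (fun X Z ↦ g.koszul X Y Z x) x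
      (fun _ hZ ↦ g.koszul_tensorial_left hY hZ) (fun _ hX ↦ g.koszul_tensorial_right hX hY)
  else 0

theorem koszulForm_apply (g : RiemMetric E M)
    (hX : MDiffAt (T% X) x) (hY : MDiffAt (T% Y) x) (hZ : MDiffAt (T% Z) x) :
    g.koszulForm Y x (X x) (Z x) = g.koszul X Y Z x := by
  rw [koszulForm, dif_pos hY]
  exact TensorialAt.mkHom₂_apply _ _ hX hZ

/-- `∇Y` at `x`: the endomorphism `v ↦ ∇_v Y` of the tangent space with
`2 ⟨∇_X Y, Z⟩ = koszul X Y Z`. -/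
def nabla (g : RiemMetric E M) (Y : Π x : M, TangentSpace 𝓘(ℝ, E) x) (x : M) :
    TangentSpace 𝓘(ℝ, E) x →L[ℝ] TangentSpace 𝓘(ℝ, E) x :=
  LinearMap.toContinuousLinearMap
    { toFun := fun v ↦ g.sharp x ((2⁻¹ : ℝ) • (g.koszulForm Y x v).toLinearMap)
      map_add' := fun v w ↦ by simp
      map_smul' := fun c v ↦ by
        simp only [map_smul, ContinuousLinearMap.toLinearMap_smul, RingHom.id_apply]
        rw [smul_comm] }

theorem inner_nabla (g : RiemMetric E M)
    (hX : MDiffAt (T% X) x) (hY : MDiffAt (T% Y) x) (hZ : MDiffAt (T% Z) x) :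
    2 * g.inner x (g.nabla Y x (X x)) (Z x) = g.koszul X Y Z x := by
  rw [← g.koszulForm_apply hX hY hZ]
  simp [nabla, inner_sharp]

/-- The Levi-Civita connection of a Riemannian metric. -/
def leviCivita (g : RiemMetric E M) :
    CovariantDerivative 𝓘(ℝ, E) E (TangentSpace 𝓘(ℝ, E) : M → Type _) where
  toFun := g.nabla
  isCovariantDerivativeOnUniv :=
    { add := fun {Y Y' x} hY hY' _ ↦ by
        ext v
        refine g.ext_inner x fun w ↦ ?_
        have hv := mdifferentiableAt_extend 𝓘(ℝ, E) E v
        have hw := mdifferentiableAt_extend 𝓘(ℝ, E) E w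
        have h := g.koszul_add_middle hv hY hY' hw
        rw [← g.inner_nabla hv hY hw, ← g.inner_nabla hv hY' hw,
          ← g.inner_nabla hv (mdifferentiableAt_add_section hY hY') hw] at h
        simp only [extend_apply_self] at h
        simp
        linarith
      leibniz := fun {Y f x} hY hf _ ↦ by
        ext v
        refine g.ext_inner x fun w ↦ ?_
        have hv := mdifferentiableAt_extend 𝓘(ℝ, E) E v
        have hw := mdifferentiableAt_extend 𝓘(ℝ, E) E w
        have h := g.koszul_smul_middle hf hv hY hw
        rw [← g.inner_nabla hv hY hw, ← g.inner_nabla hv (hf.smul_section hY) hw] at h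
        simp only [extend_apply_self] at h
        simp
        linarith }

theorem leviCivita_torsion (g : RiemMetric E M) : g.leviCivita.torsion = 0 := by
  rw [CovariantDerivative.torsion_eq_zero_iff]
  intro X Y x hX hY
  refine g.ext_inner x fun w ↦ ?_
  have hw := mdifferentiableAt_extend 𝓘(ℝ, E) E w
  have h1 := g.inner_nabla hX hY hw
  have h2 := g.inner_nabla hY hX hw
  simp only [extend_apply_self, koszul] at h1 h2
  rw [mlieBracket_swap_apply (V := Y) (W := X)] at h2
  have h3 : (fun y ↦ g.inner y (Y y) (X y)) = fun y ↦ g.inner y (X y) (Y y) := by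
    funext y; exact g.symm y _ _
  rw [h3] at h2
  change g.inner x (g.nabla Y x (X x) - g.nabla X x (Y x)) w = _
  simp at h2 ⊢
  linarith

theorem leviCivita_metric (g : RiemMetric E M)
    (hX : MDiffAt (T% X) x) (hY : MDiffAt (T% Y) x) (hZ : MDiffAt (T% Z) x) :
    mvfderiv 𝓘(ℝ, E) (fun y ↦ g.inner y (Y y) (Z y)) x (X x) =
      g.inner x (g.leviCivita Y x (X x)) (Z x) + g.inner x (Y x) (g.leviCivita Z x (X x)) := by
  have h1 := g.inner_nabla hX hY hZ
  have h2 := g.inner_nabla hX hZ hY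
  simp only [koszul] at h1 h2
  rw [mlieBracket_swap_apply (V := Z) (W := Y)] at h2
  have h3 : (fun y ↦ g.inner y (Z y) (Y y)) = fun y ↦ g.inner y (Y y) (Z y) := by
    funext y; exact g.symm y _ _
  rw [h3] at h2
  change _ = g.inner x (g.nabla Y x (X x)) (Z x) + g.inner x (Y x) (g.nabla Z x (X x))
  rw [g.symm x (Y x)]
  simp at h2
  linarith

end RiemMetric

end Metric

/-! ## Distributions and warped products -/

section Warped

variable {E : Type*} [NormedAddCommGroup E] [NormedSpace ℝ E]
  {M : Type*} [TopologicalSpace M] [ChartedSpace E M] [IsManifold 𝓘(ℝ, E) ∞ M]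

/-- A distribution is integrable (involutive): the bracket of two smooth vector fields that are
defined on an open set and tangent to the distribution is tangent to the distribution. -/
def IsIntegrable (D : Π p : M, Submodule ℝ (TangentSpace 𝓘(ℝ, E) p)) : Prop :=
  ∀ (W : Set M) (X Y : Π p : M, TangentSpace 𝓘(ℝ, E) p), IsOpen W →
    CMDiff[W] ∞ (T% X) → CMDiff[W] ∞ (T% Y) →
    (∀ p ∈ W, X p ∈ D p) → (∀ p ∈ W, Y p ∈ D p) →
    ∀ p ∈ W, mlieBracket 𝓘(ℝ, E) X Y p ∈ D p

/-- `Φ` identifies the warped product `M₁ ×_f M₂`, that is `M₁ × M₂` with the metric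
`g₁ + f² g₂`, isometrically with an open subset of the Riemannian manifold `(M, g)`, in such a
way that the leaves `M₁ × {pt}` are integral manifolds of `D₁` and the fibres `{pt} × M₂` are
integral manifolds of `D₂`. -/
structure IsWarpedParametrization (g : RiemMetric E M)
    (D₁ D₂ : Π p : M, Submodule ℝ (TangentSpace 𝓘(ℝ, E) p))
    {E₁ : Type*} [NormedAddCommGroup E₁] [NormedSpace ℝ E₁]
    {M₁ : Type*} [TopologicalSpace M₁] [ChartedSpace E₁ M₁] [IsManifold 𝓘(ℝ, E₁) ∞ M₁]
    {E₂ : Type*} [NormedAddCommGroup E₂] [NormedSpace ℝ E₂]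
    {M₂ : Type*} [TopologicalSpace M₂] [ChartedSpace E₂ M₂] [IsManifold 𝓘(ℝ, E₂) ∞ M₂]
    (g₁ : RiemMetric E₁ M₁) (g₂ : RiemMetric E₂ M₂) (f : M₁ → ℝ) (Φ : M₁ × M₂ → M) : Prop where
  smooth : ContMDiff 𝓘(ℝ, E₁) 𝓘(ℝ) ∞ f
  pos : ∀ a, 0 < f a
  injective : Function.Injective Φ
  localDiffeomorph : IsLocalDiffeomorph (𝓘(ℝ, E₁).prod 𝓘(ℝ, E₂)) 𝓘(ℝ, E) ∞ Φ
  metric : ∀ (a : M₁ × M₂) (u u' : TangentSpace 𝓘(ℝ, E₁) a.1) (v v' : TangentSpace 𝓘(ℝ, E₂) a.2),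
    g.inner (Φ a) (mfderiv (𝓘(ℝ, E₁).prod 𝓘(ℝ, E₂)) 𝓘(ℝ, E) Φ a (u, v))
        (mfderiv (𝓘(ℝ, E₁).prod 𝓘(ℝ, E₂)) 𝓘(ℝ, E) Φ a (u', v')) =
      g₁.inner a.1 u u' + f a.1 ^ 2 * g₂.inner a.2 v v'
  leaf : ∀ (a : M₁ × M₂) (u : TangentSpace 𝓘(ℝ, E₁) a.1) (v : TangentSpace 𝓘(ℝ, E₂) a.2),
    mfderiv (𝓘(ℝ, E₁).prod 𝓘(ℝ, E₂)) 𝓘(ℝ, E) Φ a (u, v) ∈ D₁ (Φ a) ↔ v = 0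
  fibre : ∀ (a : M₁ × M₂) (u : TangentSpace 𝓘(ℝ, E₁) a.1) (v : TangentSpace 𝓘(ℝ, E₂) a.2),
    mfderiv (𝓘(ℝ, E₁).prod 𝓘(ℝ, E₂)) 𝓘(ℝ, E) Φ a (u, v) ∈ D₂ (Φ a) ↔ u = 0

/-- The subset `W` of `(M, g)` is a warped product `M₁ ×_f M₂` whose leaves and fibres are
integral manifolds of `D₁` and `D₂`, and its warping function, read on `W`, is `f`. -/
def IsWarpedProductOn (g : RiemMetric E M)
    (D₁ D₂ : Π p : M, Submodule ℝ (TangentSpace 𝓘(ℝ, E) p)) (W : Set M) (f : M → ℝ) : Prop :=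
  ∃ (m₁ m₂ : ℕ)
    (M₁ : Type) (_ : TopologicalSpace M₁) (_ : ChartedSpace (EuclideanSpace ℝ (Fin m₁)) M₁)
    (_ : IsManifold (𝓡 m₁) ∞ M₁)
    (M₂ : Type) (_ : TopologicalSpace M₂) (_ : ChartedSpace (EuclideanSpace ℝ (Fin m₂)) M₂)
    (_ : IsManifold (𝓡 m₂) ∞ M₂)
    (g₁ : RiemMetric (EuclideanSpace ℝ (Fin m₁)) M₁)
    (g₂ : RiemMetric (EuclideanSpace ℝ (Fin m₂)) M₂)
    (f₁ : M₁ → ℝ) (Φ : M₁ × M₂ → M),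
    IsWarpedParametrization g D₁ D₂ g₁ g₂ f₁ Φ ∧ range Φ = W ∧ ∀ a, f (Φ a) = f₁ a.1

/-- Every point of `M` has an open neighbourhood that is a warped product. -/
def IsLocallyWarpedProduct (g : RiemMetric E M)
    (D₁ D₂ : Π p : M, Submodule ℝ (TangentSpace 𝓘(ℝ, E) p)) : Prop :=
  ∀ p : M, ∃ (W : Set M) (f : M → ℝ), IsOpen W ∧ p ∈ W ∧ IsWarpedProductOn g D₁ D₂ W f

end Warped

/-! ## Submanifolds of locally product Riemannian manifolds -/

section Submanifold

set_option linter.unusedSectionVars false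

variable {E : Type*} [NormedAddCommGroup E] [NormedSpace ℝ E] [FiniteDimensional ℝ E]
  {M : Type*} [TopologicalSpace M] [ChartedSpace E M] [IsManifold 𝓘(ℝ, E) ∞ M]
  {E' : Type*} [NormedAddCommGroup E'] [NormedSpace ℝ E'] [FiniteDimensional ℝ E']
  {N : Type*} [TopologicalSpace N] [ChartedSpace E' N] [IsManifold 𝓘(ℝ, E') ∞ N]

/-- `(N, g, F)` is a locally product Riemannian manifold. -/
structure IsLocallyProduct (g : RiemMetric E' N)
    (F : Π x : N, TangentSpace 𝓘(ℝ, E') x →L[ℝ] TangentSpace 𝓘(ℝ, E') x) : Prop where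
  smooth : ContMDiff 𝓘(ℝ, E') (𝓘(ℝ, E').prod 𝓘(ℝ, E' →L[ℝ] E')) ∞
    (fun x ↦ TotalSpace.mk' (E' →L[ℝ] E')
      (E := fun x : N ↦ TangentSpace 𝓘(ℝ, E') x →L[ℝ] TangentSpace 𝓘(ℝ, E') x) x (F x))
  sq : ∀ x u, F x (F x u) = u
  ne_id : ¬ ∀ x u, F x u = u
  ne_neg_id : ¬ ∀ x u, F x u = -u
  isometry : ∀ x u v, g.inner x (F x u) (F x v) = g.inner x u v
  parallel : ∀ (x : N) (V : Π x : N, TangentSpace 𝓘(ℝ, E') x) (u : TangentSpace 𝓘(ℝ, E') x),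
    MDiffAt (T% V) x →
      g.leviCivita (fun y ↦ F y (V y)) x u = F x (g.leviCivita V x u)

theorem leviCivita_extend_add (g : RiemMetric E' N) {x : N} (v w : TangentSpace 𝓘(ℝ, E') x) :
    g.leviCivita (extend E' (v + w)) x =
      g.leviCivita (extend E' v) x + g.leviCivita (extend E' w) x := by
  have hv := mdifferentiableAt_extend 𝓘(ℝ, E') E' v
  have hw := mdifferentiableAt_extend 𝓘(ℝ, E') E' w
  rw [← g.leviCivita.isCovariantDerivativeOn.add (s := Set.univ) hv hw]
  refine g.leviCivita.isCovariantDerivativeOn.congr_of_eventuallyEq (s := Set.univ)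
    (mdifferentiableAt_extend 𝓘(ℝ, E') E' (v + w)) (mdifferentiableAt_add_section hv hw)
    Filter.univ_mem ?_
  have h := ((trivializationAt E' (TangentSpace 𝓘(ℝ, E') : N → Type _) x).linear ℝ
    (FiberBundle.mem_baseSet_trivializationAt' x)).map_add v w
  filter_upwards [(trivializationAt E' (TangentSpace 𝓘(ℝ, E') : N → Type _)
    x).open_baseSet.mem_nhds (FiberBundle.mem_baseSet_trivializationAt' x)] with y hy
  simp only [extend, Pi.add_apply, h]
  simp only [← Trivialization.symmₗ_apply (R := ℝ) _ hy, map_add]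

theorem leviCivita_extend_smul (g : RiemMetric E' N) {x : N} (c : ℝ)
    (v : TangentSpace 𝓘(ℝ, E') x) :
    g.leviCivita (extend E' (c • v)) x = c • g.leviCivita (extend E' v) x := by
  have hv := mdifferentiableAt_extend 𝓘(ℝ, E') E' v
  have hc : MDiffAt (fun _ : N ↦ c) x := mdifferentiableAt_const
  have h1 := g.leviCivita.isCovariantDerivativeOn.leibniz (s := Set.univ) hv hc
  have h2 : g.leviCivita (extend E' (c • v)) x =
      g.leviCivita ((fun _ : N ↦ c) • extend E' v) x := by
    refine g.leviCivita.isCovariantDerivativeOn.congr_of_eventuallyEq (s := Set.univ)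
      (mdifferentiableAt_extend 𝓘(ℝ, E') E' (c • v)) (hc.smul_section hv) Filter.univ_mem ?_
    have h := ((trivializationAt E' (TangentSpace 𝓘(ℝ, E') : N → Type _) x).linear ℝ
      (FiberBundle.mem_baseSet_trivializationAt' x)).map_smul c v
    filter_upwards [(trivializationAt E' (TangentSpace 𝓘(ℝ, E') : N → Type _)
      x).open_baseSet.mem_nhds (FiberBundle.mem_baseSet_trivializationAt' x)] with y hy
    simp only [extend, Pi.smul_apply', h]
    simp only [← Trivialization.symmₗ_apply (R := ℝ) _ hy, map_smul]
  rw [h2, h1, mvfderiv_const]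
  ext u
  simp

/-- Isometric immersions `(M, gM) → (N, gN)`, i.e. (immersed) Riemannian submanifolds. The
differential is injective because it preserves the metrics. -/
structure IsometricImmersion (gM : RiemMetric E M) (gN : RiemMetric E' N) where
  toFun : M → N
  contMDiff : ContMDiff 𝓘(ℝ, E) 𝓘(ℝ, E') ∞ toFun
  isometric : ∀ (p : M) (u v : TangentSpace 𝓘(ℝ, E) p),
    gN.inner (toFun p) (mfderiv 𝓘(ℝ, E) 𝓘(ℝ, E') toFun p u)
      (mfderiv 𝓘(ℝ, E) 𝓘(ℝ, E') toFun p v) = gM.inner p u v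

namespace IsometricImmersion

variable {gM : RiemMetric E M} {gN : RiemMetric E' N}

/-- The differential of the immersion at `p`. -/
def d (φ : IsometricImmersion gM gN) (p : M) :
    TangentSpace 𝓘(ℝ, E) p →L[ℝ] TangentSpace 𝓘(ℝ, E') (φ.toFun p) :=
  mfderiv 𝓘(ℝ, E) 𝓘(ℝ, E') φ.toFun p

/-- The tangential part of a vector of the ambient manifold, as the tangent vector of `M` with
`gM (tan w, v) = gN (w, dφ v)` for all `v`. -/
def tan (φ : IsometricImmersion gM gN) (p : M) :
    TangentSpace 𝓘(ℝ, E') (φ.toFun p) →ₗ[ℝ] TangentSpace 𝓘(ℝ, E) p :=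
  (gM.sharp p).toLinearMap ∘ₗ
    { toFun := fun w ↦ (gN.inner (φ.toFun p) w).toLinearMap ∘ₗ (φ.d p).toLinearMap
      map_add' := fun w w' ↦ by ext; simp
      map_smul' := fun c w ↦ by ext; simp }

/-- The normal part of a vector of the ambient manifold. -/
def nor (φ : IsometricImmersion gM gN) (p : M) :
    TangentSpace 𝓘(ℝ, E') (φ.toFun p) →ₗ[ℝ] TangentSpace 𝓘(ℝ, E') (φ.toFun p) :=
  LinearMap.id - (φ.d p).toLinearMap ∘ₗ φ.tan p

theorem tan_d (φ : IsometricImmersion gM gN) (p : M) (v : TangentSpace 𝓘(ℝ, E) p) :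
    φ.tan p (φ.d p v) = v := by
  refine gM.ext_inner p fun w ↦ ?_
  simp only [tan, LinearMap.comp_apply, LinearEquiv.coe_coe, RiemMetric.inner_sharp]
  exact φ.isometric p v w

theorem nor_d (φ : IsometricImmersion gM gN) (p : M) (v : TangentSpace 𝓘(ℝ, E) p) :
    φ.nor p (φ.d p v) = 0 := by
  simp [nor, tan_d]

/-- The components, in the trivialization of `TN` around `φ p`, of a section of `φ^* TN`. -/
def coord (φ : IsometricImmersion gM gN) (p : M)
    (s : Π q : M, TangentSpace 𝓘(ℝ, E') (φ.toFun q)) (q : M) : E' :=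
  (trivializationAt E' (TangentSpace 𝓘(ℝ, E') : N → Type _) (φ.toFun p) ⟨φ.toFun q, s q⟩).2

/-- The ambient Levi-Civita connection along the immersion: `∇̄_v s` at `p`, for a section `s` of
the pulled back tangent bundle `φ^* TN`. In a trivialization of `TN` around `φ p`, with frame
`e_i` and `s = ∑ sⁱ e_i`, this is `∑ v(sⁱ) e_i + ∑ sⁱ(p) ∇̄_{dφ v} e_i`; the field `∑ sⁱ(p) e_i`
with constant coefficients is `extend E' (s p)`. -/
def covAlong (φ : IsometricImmersion gM gN) (s : Π q : M, TangentSpace 𝓘(ℝ, E') (φ.toFun q))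
    (p : M) (v : TangentSpace 𝓘(ℝ, E) p) : TangentSpace 𝓘(ℝ, E') (φ.toFun p) :=
  (trivializationAt E' (TangentSpace 𝓘(ℝ, E') : N → Type _) (φ.toFun p)).symmₗ ℝ (φ.toFun p)
      (mvfderiv 𝓘(ℝ, E) (φ.coord p s) p v)
    + gN.leviCivita (extend E' (s p)) (φ.toFun p) (φ.d p v)

/-- The image under the differential of a vector field on `M`. -/
def push (φ : IsometricImmersion gM gN) (V : Π q : M, TangentSpace 𝓘(ℝ, E) q) (q : M) :
    TangentSpace 𝓘(ℝ, E') (φ.toFun q) := φ.d q (V q)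

theorem mdifferentiableAt_coord_push (φ : IsometricImmersion gM gN)
    {V : Π q : M, TangentSpace 𝓘(ℝ, E) q} {p : M} (hV : MDiffAt (T% V) p) :
    MDiffAt (φ.coord p (φ.push V)) p := by
  have h : ContMDiff 𝓘(ℝ, E).tangent 𝓘(ℝ, E').tangent 1
      (tangentMap 𝓘(ℝ, E) 𝓘(ℝ, E') φ.toFun) :=
    φ.contMDiff.contMDiff_tangentMap (by norm_cast)
  have h2 : MDifferentiableAt 𝓘(ℝ, E) 𝓘(ℝ, E').tangent
      (fun q ↦ (⟨φ.toFun q, φ.push V q⟩ : TangentBundle 𝓘(ℝ, E') N)) p :=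
    (h.mdifferentiableAt (by simp)).comp p hV
  rw [mdifferentiableAt_totalSpace] at h2
  exact h2.2

theorem coord_add (φ : IsometricImmersion gM gN) (p : M)
    (s s' : Π q : M, TangentSpace 𝓘(ℝ, E') (φ.toFun q)) :
    φ.coord p (s + s') =ᶠ[𝓝 p] fun q ↦ φ.coord p s q + φ.coord p s' q := by
  filter_upwards [φ.contMDiff.continuous.continuousAt.eventually
    ((trivializationAt E' (TangentSpace 𝓘(ℝ, E') : N → Type _)
      (φ.toFun p)).open_baseSet.mem_nhds (FiberBundle.mem_baseSet_trivializationAt' _))] with q hq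
  exact ((trivializationAt E' (TangentSpace 𝓘(ℝ, E') : N → Type _) (φ.toFun p)).linear
      ℝ hq).map_add _ _

theorem coord_smul (φ : IsometricImmersion gM gN) (p : M) (f : M → ℝ)
    (s : Π q : M, TangentSpace 𝓘(ℝ, E') (φ.toFun q)) :
    φ.coord p (f • s) =ᶠ[𝓝 p] fun q ↦ f q • φ.coord p s q := by
  filter_upwards [φ.contMDiff.continuous.continuousAt.eventually
    ((trivializationAt E' (TangentSpace 𝓘(ℝ, E') : N → Type _)
      (φ.toFun p)).open_baseSet.mem_nhds (FiberBundle.mem_baseSet_trivializationAt' _))] with q hq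
  exact ((trivializationAt E' (TangentSpace 𝓘(ℝ, E') : N → Type _) (φ.toFun p)).linear
      ℝ hq).map_smul _ _

theorem symm_coord (φ : IsometricImmersion gM gN) (p : M)
    (s : Π q : M, TangentSpace 𝓘(ℝ, E') (φ.toFun q)) :
    (trivializationAt E' (TangentSpace 𝓘(ℝ, E') : N → Type _) (φ.toFun p)).symmₗ ℝ (φ.toFun p)
      (φ.coord p s p) = s p := by
  exact ((trivializationAt E' (TangentSpace 𝓘(ℝ, E') : N → Type _) (φ.toFun p)).symmₗ_apply (R := ℝ)
    (FiberBundle.mem_baseSet_trivializationAt' _) _).trans (extend_apply_self E' (s p))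

theorem mvfderiv_congr {f f' : M → E'} {p : M} (h : f =ᶠ[𝓝 p] f') :
    mvfderiv 𝓘(ℝ, E) f p = mvfderiv 𝓘(ℝ, E) f' p := by
  ext v
  exact congrArg (fun L : E →L[ℝ] E' ↦ L v) h.mfderiv_eq

theorem covAlong_add (φ : IsometricImmersion gM gN)
    {s s' : Π q : M, TangentSpace 𝓘(ℝ, E') (φ.toFun q)} {p : M} (hs : MDiffAt (φ.coord p s) p)
    (hs' : MDiffAt (φ.coord p s') p) (u : TangentSpace 𝓘(ℝ, E) p) :
    φ.covAlong (s + s') p u = φ.covAlong s p u + φ.covAlong s' p u := by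
  have h2 : gN.leviCivita (extend E' ((s + s') p)) (φ.toFun p) =
      gN.leviCivita (extend E' (s p)) (φ.toFun p) +
        gN.leviCivita (extend E' (s' p)) (φ.toFun p) := leviCivita_extend_add gN (s p) (s' p)
  simp only [covAlong]
  rw [mvfderiv_congr (φ.coord_add p s s'), mvfderiv_fun_add hs hs', h2]
  simp only [add_apply, map_add]
  abel

theorem covAlong_smul (φ : IsometricImmersion gM gN) {f : M → ℝ}
    {s : Π q : M, TangentSpace 𝓘(ℝ, E') (φ.toFun q)} {p : M} (hf : MDiffAt f p)
    (hs : MDiffAt (φ.coord p s) p) (u : TangentSpace 𝓘(ℝ, E) p) :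
    φ.covAlong (f • s) p u = f p • φ.covAlong s p u + mvfderiv 𝓘(ℝ, E) f p u • s p := by
  have h2 : gN.leviCivita (extend E' ((f • s) p)) (φ.toFun p) =
      f p • gN.leviCivita (extend E' (s p)) (φ.toFun p) := leviCivita_extend_smul gN (f p) (s p)
  simp only [covAlong]
  rw [mvfderiv_congr (φ.coord_smul p f s), mvfderiv_fun_smul hf hs, h2]
  have h5 := φ.symm_coord p s
  simp only [add_apply, smul_apply, ContinuousLinearMap.smulRight_apply, map_add, map_smul,
    h5, smul_add]
  abel

/-- The connection along the immersion agrees with the ambient one on ambient vector fields. -/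
theorem covAlong_comp (φ : IsometricImmersion gM gN) {Y : Π x : N, TangentSpace 𝓘(ℝ, E') x}
    {p : M} (hY : MDiffAt (T% Y) (φ.toFun p)) (u : TangentSpace 𝓘(ℝ, E) p) :
    φ.covAlong (fun q ↦ Y (φ.toFun q)) p u = gN.leviCivita Y (φ.toFun p) (φ.d p u) := by
  have hφ : MDiffAt φ.toFun p := φ.contMDiff.mdifferentiableAt (by simp)
  have hc : ∀ {Y : Π x : N, TangentSpace 𝓘(ℝ, E') x}, MDiffAt (T% Y) (φ.toFun p) →
      MDiffAt (φ.coord p (fun q ↦ Y (φ.toFun q))) p := fun {Y} hY ↦ by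
    rw [mdifferentiableAt_totalSpace] at hY
    exact hY.2.comp p hφ
  have ht : TensorialAt 𝓘(ℝ, E') E' (fun Y ↦ φ.covAlong (fun q ↦ Y (φ.toFun q)) p u -
      gN.leviCivita Y (φ.toFun p) (φ.d p u)) (φ.toFun p) :=
    { smul := fun {f Y} hf hY ↦ by
        have h1 := φ.covAlong_smul (f := fun q ↦ f (φ.toFun q)) (hf.comp p hφ) (hc hY) u
        have h2 := gN.leviCivita.isCovariantDerivativeOn.leibniz (s := Set.univ) hY hf
        have h3 : mvfderiv 𝓘(ℝ, E) (fun q ↦ f (φ.toFun q)) p u =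
            mvfderiv 𝓘(ℝ, E') f (φ.toFun p) (φ.d p u) := mvfderiv_comp_apply p hf hφ u
        have h4 : φ.covAlong (fun q ↦ (f • Y) (φ.toFun q)) p u = _ := h1
        rw [h4, h2, h3]
        simp only [add_apply, smul_apply, ContinuousLinearMap.smulRight_apply, smul_sub]
        abel
      add := fun {Y Y'} hY hY' ↦ by
        have h1 := φ.covAlong_add (hc hY) (hc hY') u
        have h2 := gN.leviCivita.isCovariantDerivativeOn.add (s := Set.univ) hY hY'
        have h4 : φ.covAlong (fun q ↦ (Y + Y') (φ.toFun q)) p u = _ := h1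
        rw [h4, h2]
        simp only [add_apply]
        abel }
  have h0 := ht.pointwise hY (mdifferentiableAt_extend 𝓘(ℝ, E') E' (Y (φ.toFun p))) (by simp)
  rw [← sub_eq_zero]
  refine h0.trans (sub_eq_zero.2 ?_)
  have h5 : φ.coord p (fun q ↦ extend E' (Y (φ.toFun p)) (φ.toFun q)) =ᶠ[𝓝 p]
      fun _ ↦ φ.coord p (fun q ↦ Y (φ.toFun q)) p := by
    filter_upwards [φ.contMDiff.continuous.continuousAt.eventually
      ((trivializationAt E' (TangentSpace 𝓘(ℝ, E') : N → Type _)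
        (φ.toFun p)).open_baseSet.mem_nhds (FiberBundle.mem_baseSet_trivializationAt' _))] with q hq
    have hq' : φ.toFun q ∈ (trivializationAt E' (TangentSpace 𝓘(ℝ, E') : N → Type _)
      (φ.toFun p)).baseSet := hq
    simp [coord, extend, Trivialization.apply_mk_symm _ hq']
  simp [covAlong, mvfderiv_congr h5, mvfderiv_const]

theorem tensorial (φ : IsometricImmersion gM gN) (p : M) (u : TangentSpace 𝓘(ℝ, E) p) :
    TensorialAt 𝓘(ℝ, E) E (fun V ↦ φ.nor p (φ.covAlong (φ.push V) p u)) p where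
  smul {f V} hf hV := by
    have h : φ.push (f • V) = f • φ.push V := by
      funext q; exact map_smul (φ.d q) (f q) (V q)
    have h2 : φ.nor p (φ.push V p) = 0 := φ.nor_d p (V p)
    rw [h, φ.covAlong_smul hf (φ.mdifferentiableAt_coord_push hV), map_add, map_smul, map_smul, h2,
      smul_zero, add_zero]
  add {V V'} hV hV' := by
    have h : φ.push (V + V') = φ.push V + φ.push V' := by
      funext q; exact map_add (φ.d q) (V q) (V' q)
    rw [h, φ.covAlong_add (φ.mdifferentiableAt_coord_push hV)
      (φ.mdifferentiableAt_coord_push hV'), map_add]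

/-- The second fundamental form: `h(u, V p)` is the normal part of `∇̄_u V`. -/
def sff (φ : IsometricImmersion gM gN) (p : M) (u : TangentSpace 𝓘(ℝ, E) p) :
    TangentSpace 𝓘(ℝ, E) p →L[ℝ] TangentSpace 𝓘(ℝ, E') (φ.toFun p) :=
  TensorialAt.mkHom (fun V ↦ φ.nor p (φ.covAlong (φ.push V) p u)) p (φ.tensorial p u)

/-- The shape operator: `gM (A_ξ u, v) = gN (h(u, v), ξ)` for all `v`. -/
def shape (φ : IsometricImmersion gM gN) (p : M) (ξ : TangentSpace 𝓘(ℝ, E') (φ.toFun p))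
    (u : TangentSpace 𝓘(ℝ, E) p) : TangentSpace 𝓘(ℝ, E) p :=
  gM.sharp p ((gN.inner (φ.toFun p) ξ).toLinearMap ∘ₗ (φ.sff p u).toLinearMap)

/-- `T_p u` is the tangential part of `F u`. -/
def opT (φ : IsometricImmersion gM gN)
    (F : Π x : N, TangentSpace 𝓘(ℝ, E') x →L[ℝ] TangentSpace 𝓘(ℝ, E') x) (p : M) :
    TangentSpace 𝓘(ℝ, E) p →ₗ[ℝ] TangentSpace 𝓘(ℝ, E) p :=
  φ.tan p ∘ₗ (F (φ.toFun p)).toLinearMap ∘ₗ (φ.d p).toLinearMap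

/-- `N_p u` is the normal part of `F u`. -/
def opN (φ : IsometricImmersion gM gN)
    (F : Π x : N, TangentSpace 𝓘(ℝ, E') x →L[ℝ] TangentSpace 𝓘(ℝ, E') x) (p : M) :
    TangentSpace 𝓘(ℝ, E) p →ₗ[ℝ] TangentSpace 𝓘(ℝ, E') (φ.toFun p) :=
  φ.nor p ∘ₗ (F (φ.toFun p)).toLinearMap ∘ₗ (φ.d p).toLinearMap

/-- The distribution `D^c = Ker (T² - c² I)`. -/
def dist (φ : IsometricImmersion gM gN)
    (F : Π x : N, TangentSpace 𝓘(ℝ, E') x →L[ℝ] TangentSpace 𝓘(ℝ, E') x) (c : ℝ) (p : M) :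
    Submodule ℝ (TangentSpace 𝓘(ℝ, E) p) :=
  LinearMap.ker (φ.opT F p ∘ₗ φ.opT F p - c ^ 2 • LinearMap.id)

/-- The anti-invariant distribution `D^⊥ = D^0`. -/
abbrev distPerp (φ : IsometricImmersion gM gN)
    (F : Π x : N, TangentSpace 𝓘(ℝ, E') x →L[ℝ] TangentSpace 𝓘(ℝ, E') x) (p : M) :
    Submodule ℝ (TangentSpace 𝓘(ℝ, E) p) := φ.dist F 0 p

/-- The invariant distribution `D^T = D^1`. -/
abbrev distT (φ : IsometricImmersion gM gN)
    (F : Π x : N, TangentSpace 𝓘(ℝ, E') x →L[ℝ] TangentSpace 𝓘(ℝ, E') x) (p : M) :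
    Submodule ℝ (TangentSpace 𝓘(ℝ, E) p) := φ.dist F 1 p

/-- The slant distribution `D^θ`, with slant angle `θ`. -/
abbrev distSlant (φ : IsometricImmersion gM gN)
    (F : Π x : N, TangentSpace 𝓘(ℝ, E') x →L[ℝ] TangentSpace 𝓘(ℝ, E') x) (θ : ℝ) (p : M) :
    Submodule ℝ (TangentSpace 𝓘(ℝ, E) p) := φ.dist F (Real.cos θ) p

/-- Skew semi-invariant submanifolds: `T²` has, besides `0` and `1`, exactly the `k` distinct
constant eigenvalues `lam i ^ 2` with `lam i ∈ (0, 1)`; these are eigenvalues at every point, the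
tangent spaces are the sums of the eigenspaces (the sums are automatically direct, and the
eigenspaces orthogonal), and the dimensions of the eigenspaces do not depend on the point. -/
structure IsSkewSemiInvariant (φ : IsometricImmersion gM gN)
    (F : Π x : N, TangentSpace 𝓘(ℝ, E') x →L[ℝ] TangentSpace 𝓘(ℝ, E') x)
    (k : ℕ) (lam : Fin k → ℝ) : Prop where
  mem_Ioo : ∀ i, lam i ∈ Ioo (0 : ℝ) 1
  injective : Function.Injective lam
  eigenvalue : ∀ i p, φ.dist F (lam i) p ≠ ⊥
  decomposition : ∀ p, φ.distPerp F p ⊔ φ.distT F p ⊔ ⨆ i, φ.dist F (lam i) p = ⊤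
  finrank_perp : ∀ p q, Module.finrank ℝ (φ.distPerp F p) = Module.finrank ℝ (φ.distPerp F q)
  finrank_T : ∀ p q, Module.finrank ℝ (φ.distT F p) = Module.finrank ℝ (φ.distT F q)
  finrank_dist : ∀ i p q,
    Module.finrank ℝ (φ.dist F (lam i) p) = Module.finrank ℝ (φ.dist F (lam i) q)

/-- Proper skew semi-invariant submanifolds of order `1` with slant angle `θ`. -/
structure IsProperSkewSemiInvariantOrderOne (φ : IsometricImmersion gM gN)
    (F : Π x : N, TangentSpace 𝓘(ℝ, E') x →L[ℝ] TangentSpace 𝓘(ℝ, E') x) (θ : ℝ) : Prop where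
  angle : θ ∈ Ioo 0 (Real.pi / 2)
  skew : φ.IsSkewSemiInvariant F 1 (fun _ ↦ Real.cos θ)
  perp_ne_bot : ∀ p, φ.distPerp F p ≠ ⊥
  T_ne_bot : ∀ p, φ.distT F p ≠ ⊥

/-- `M` is `(D^θ, D^T)` mixed totally geodesic: `h(Z, X) = 0` for `Z ∈ D^θ`, `X ∈ D^T`. -/
def IsMixedTotallyGeodesic (φ : IsometricImmersion gM gN)
    (F : Π x : N, TangentSpace 𝓘(ℝ, E') x →L[ℝ] TangentSpace 𝓘(ℝ, E') x) (θ : ℝ) : Prop :=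
  ∀ p, ∀ Z ∈ φ.distSlant F θ p, ∀ X ∈ φ.distT F p, φ.sff p Z X = 0

/-- The smooth function `σ` on the open set `U` satisfies `Y[σ] = 0`, `A_{FV} FX = -V[σ] X` and
`A_{NZ} FX + A_{NTZ} X = -Z[σ] sin² θ X` on `U`, for `X, Y ∈ D^T`, `V ∈ D^⊥` and `Z ∈ D^θ`.
For `X ∈ D^T` the vector `FX` is tangent to `M` and it is written as `TX`. -/
structure SatisfiesShapeEquations (φ : IsometricImmersion gM gN)
    (F : Π x : N, TangentSpace 𝓘(ℝ, E') x →L[ℝ] TangentSpace 𝓘(ℝ, E') x) (θ : ℝ)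
    (U : Set M) (σ : M → ℝ) : Prop where
  smooth : ContMDiffOn 𝓘(ℝ, E) 𝓘(ℝ) ∞ σ U
  invariant : ∀ p ∈ U, ∀ Y ∈ φ.distT F p, mvfderiv 𝓘(ℝ, E) σ p Y = 0
  perp : ∀ p ∈ U, ∀ X ∈ φ.distT F p, ∀ V ∈ φ.distPerp F p,
    φ.shape p (F (φ.toFun p) (φ.d p V)) (φ.opT F p X) = -(mvfderiv 𝓘(ℝ, E) σ p V) • X
  slant : ∀ p ∈ U, ∀ X ∈ φ.distT F p, ∀ Z ∈ φ.distSlant F θ p,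
    φ.shape p (φ.opN F p Z) (φ.opT F p X) + φ.shape p (φ.opN F p (φ.opT F p Z)) X =
      -(mvfderiv 𝓘(ℝ, E) σ p Z * Real.sin θ ^ 2) • X

end IsometricImmersion

end Submanifold

end

/-! Write D₁ for D^⊥ ⊕ D^θ and D₂ for D^T, and let X be a section of D₂. Since F is parallel and FX
= TX is tangent to M, h(TX, u) is the normal part of F(∇̄_u X). F is a self-adjoint isometry, so
pairing with FV, or with NZ and NTZ, strips it off again: ⟨A_{FV} TX, u⟩ = ⟨∇_u X, V⟩ and ⟨A_{NZ} TX
+ A_{NTZ} X, u⟩ = sin²θ ⟨∇_u X, Z⟩ (`inner_shape_perp`, `inner_shape_slant`). The extrinsic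
conditions (∗) are therefore equivalent to intrinsic ones (`satisfiesShapeEquations_iff`): σ has
zero derivative along D₂, and ⟨∇_u X, v⟩ = -v[σ] ⟨X, u⟩ for all u and all v in D₁. What remains
concerns a single Riemannian manifold with two complementary orthogonal smooth distributions.

The connection identity forces ⟨∇_X Y, Z⟩ = 0 for X, Y in D₁ and Z in D₂, so D₁ is involutive; D₂ is
so by assumption. Frobenius, applied to both, yields coordinates in a product whose slices are
integral manifolds (`exists_adapted_coordinates`). There the mixed metric coefficients vanish, and
the Koszul formula translates the identity into two statements: the D₁-coefficients are constant
along D₂, and the derivative along w in D₁ of a D₂-coefficient is 2 w[σ] times that coefficient.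
Hence e^{-2σ} times the D₂-block depends on the D₂-coordinates alone, and the metric is g₁ + e^{2σ}
g₂ (`IsAdapted.isWarpedParametrization`). Conversely a warped product has coefficients of this kind
with σ = ln f, and the same Koszul computation gives the identity back
(`IsWarpedParametrization.connection`). For uniqueness, the choice u = X ≠ 0 shows that the identity
determines v[σ] for v in D₁; along D₂ the derivative is zero, so two solutions have the same
differential.

The Frobenius theorem rests on the inverse function theorem in Banach spaces. The solutions of η' =
L(η) z are fixed points of an integral operator on C([0,1], E), which is smooth because composition
operators are. The time-one map of these solutions straightens a commuting frame, and every
involutive distribution has such a frame locally. -/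

noncomputable section

/-! ## Smoothness of composition operators -/

section Nemytskii

universe u

variable {K : Type*} [TopologicalSpace K]

/-- Postcomposition with a globally defined continuous function. -/
def ContinuousMap.postcompose (K : Type*) [TopologicalSpace K] {E F : Type*}
    [TopologicalSpace E] [TopologicalSpace F] {g : E → F} (hg : Continuous g) (η : C(K, E)) :
    C(K, F) :=
  (⟨g, hg⟩ : C(E, F)).comp η

@[simp]
theorem ContinuousMap.postcompose_apply {E F : Type*}
    [TopologicalSpace E] [TopologicalSpace F] {g : E → F} (hg : Continuous g) (η : C(K, E))
    (k : K) : ContinuousMap.postcompose K hg η k = g (η k) := rfl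

theorem ContinuousMap.continuous_postcompose {E F : Type*}
    [TopologicalSpace E] [TopologicalSpace F] {g : E → F} (hg : Continuous g) :
    Continuous (ContinuousMap.postcompose K hg) :=
  ContinuousMap.continuous_postcomp _

variable [CompactSpace K]

instance (E F : Type*) [NormedAddCommGroup E] [NormedSpace ℝ E]
    [NormedAddCommGroup F] [NormedSpace ℝ F] : NormedAddCommGroup C(K, E →L[ℝ] F) :=
  ContinuousMap.instNormedAddCommGroup

instance (E F : Type*) [NormedAddCommGroup E] [NormedSpace ℝ E]
    [NormedAddCommGroup F] [NormedSpace ℝ F] : NormedSpace ℝ C(K, E →L[ℝ] F) :=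
  ContinuousMap.normedSpace

/-- Pointwise application of a continuous family of linear maps to a continuous function. -/
def ContinuousMap.pointwiseApply (K : Type*) [TopologicalSpace K] [CompactSpace K]
    (E F : Type*) [NormedAddCommGroup E] [NormedSpace ℝ E]
    [NormedAddCommGroup F] [NormedSpace ℝ F] :
    C(K, E →L[ℝ] F) →L[ℝ] C(K, E) →L[ℝ] C(K, F) :=
  LinearMap.mkContinuous₂
    (LinearMap.mk₂ ℝ (fun (A : C(K, E →L[ℝ] F)) (h : C(K, E)) ↦
        (⟨fun k ↦ A k (h k), by fun_prop⟩ : C(K, F)))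
      (fun A A' h ↦ by ext k; simp) (fun c A h ↦ by ext k; simp)
      (fun A h h' ↦ by ext k; simp) (fun c A h ↦ by ext k; simp)) 1
    (fun A h ↦ by
      rw [one_mul, ContinuousMap.norm_le _ (by positivity)]
      intro k
      exact ((A k).le_opNorm (h k)).trans
        (mul_le_mul (A.norm_coe_le_norm k) (h.norm_coe_le_norm k) (norm_nonneg _) (norm_nonneg _)))

@[simp]
theorem ContinuousMap.pointwiseApply_apply {E F : Type*} [NormedAddCommGroup E] [NormedSpace ℝ E]
    [NormedAddCommGroup F] [NormedSpace ℝ F] (A : C(K, E →L[ℝ] F)) (h : C(K, E)) (k : K) :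
    ContinuousMap.pointwiseApply K E F A h k = A k (h k) := rfl

variable {E F : Type u} [NormedAddCommGroup E] [NormedSpace ℝ E]
    [NormedAddCommGroup F] [NormedSpace ℝ F]

/-- The mean value inequality is applied at each k on the segment from η k to ζ k. The resulting
bound is uniform in k because η ↦ g' ∘ η is continuous for the sup norm. -/
theorem ContinuousMap.hasFDerivAt_postcompose {g : E → F} {g' : E → E →L[ℝ] F}
    (hg : Continuous g) (hg' : ∀ x, HasFDerivAt g (g' x) x) (hc : Continuous g') (η : C(K, E)) :
    HasFDerivAt (ContinuousMap.postcompose K hg)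
      (ContinuousMap.pointwiseApply K E F (ContinuousMap.postcompose K hc η)) η := by
  rw [hasFDerivAt_iff_isLittleO, Asymptotics.isLittleO_iff]
  intro ε hε
  have hcont := (ContinuousMap.continuous_postcompose (K := K) hc).continuousAt (x := η)
  rw [Metric.continuousAt_iff] at hcont
  obtain ⟨δ, hδ, h⟩ := hcont ε hε
  filter_upwards [Metric.ball_mem_nhds η hδ] with ζ hζ
  rw [ContinuousMap.norm_le _ (by positivity)]
  intro k
  have hseg : ∀ x ∈ segment ℝ (η k) (ζ k), ‖g' x - g' (η k)‖ ≤ ε := by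
    rintro x hx
    rw [segment_eq_image'] at hx
    obtain ⟨t, ⟨ht0, ht1⟩, rfl⟩ := hx
    have h1 : dist (η + t • (ζ - η)) η < δ := by
      rw [dist_eq_norm, add_sub_cancel_left, norm_smul, Real.norm_of_nonneg ht0]
      rw [Metric.mem_ball, dist_eq_norm] at hζ
      exact lt_of_le_of_lt (mul_le_of_le_one_left (norm_nonneg _) ht1) hζ
    have h2 := h h1
    have h3 := (ContinuousMap.dist_apply_le_dist (f := ContinuousMap.postcompose K hc (η + t • (ζ - η)))
      (g := ContinuousMap.postcompose K hc η) k).trans h2.le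
    rw [dist_eq_norm] at h3
    simpa using h3
  have h4 := (convex_segment (η k) (ζ k)).norm_image_sub_le_of_norm_hasFDerivWithin_le'
    (fun x _ ↦ (hg' x).hasFDerivWithinAt) hseg (left_mem_segment ℝ _ _) (right_mem_segment ℝ _ _)
  have h5 : ‖ζ k - η k‖ ≤ ‖ζ - η‖ := (ζ - η).norm_coe_le_norm k
  calc _ = ‖g (ζ k) - g (η k) - g' (η k) (ζ k - η k)‖ := by simp
    _ ≤ ε * ‖ζ k - η k‖ := h4
    _ ≤ _ := by gcongr

/-- The derivative is again a composition operator, now with values in E →L F. The induction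
therefore has to run over all targets F, and E and F share a universe so that E →L F is an
admissible target. -/
theorem ContinuousMap.contDiff_postcompose_nat (n : ℕ) :
    ∀ (F : Type u) [NormedAddCommGroup F] [NormedSpace ℝ F] {g : E → F} (hg : ContDiff ℝ n g),
      ContDiff ℝ n (ContinuousMap.postcompose K hg.continuous) := by
  induction n with
  | zero =>
    intro F _ _ g hg
    exact contDiff_zero.2 (ContinuousMap.continuous_postcompose _)
  | succ n ih =>
    intro F _ _ g hg
    have hg1 : ContDiff ℝ ((n : ℕ∞ω) + 1) g := by exact_mod_cast hg
    have hd : ContDiff ℝ n (fderiv ℝ g) := (contDiff_succ_iff_fderiv.1 hg1).2.2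
    have hdiff : ∀ x, HasFDerivAt g (fderiv ℝ g x) x := fun x ↦
      ((contDiff_succ_iff_fderiv.1 hg1).1 x).hasFDerivAt
    have key := ContinuousMap.hasFDerivAt_postcompose (K := K) hg.continuous hdiff hd.continuous
    push_cast
    rw [contDiff_succ_iff_hasFDerivAt]
    refine ⟨_, ?_, key⟩
    exact (ContinuousMap.pointwiseApply K E F).contDiff.comp (ih _ hd)

theorem ContinuousMap.contDiff_postcompose {g : E → F} (hg : ContDiff ℝ ∞ g) :
    ContDiff ℝ ∞ (ContinuousMap.postcompose K hg.continuous) :=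
  contDiff_infty.2 fun n ↦ ContinuousMap.contDiff_postcompose_nat n F (contDiff_infty.1 hg n)

end Nemytskii

/-! ### The inverse function theorem on open sets -/

section InverseFunction

variable {X Y : Type*} [NormedAddCommGroup X] [NormedSpace ℝ X] [CompleteSpace X]
  [NormedAddCommGroup Y] [NormedSpace ℝ Y]

/-- The inverse function theorem for maps that are smooth on an open set. -/
theorem ContDiffOn.exists_openPartialHomeomorph {f : X → Y} {O : Set X} (hO : IsOpen O)
    (hf : ContDiffOn ℝ ∞ f O) {x₀ : X} (hx₀ : x₀ ∈ O) {f' : X ≃L[ℝ] Y}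
    (hf' : HasFDerivAt f (f' : X →L[ℝ] Y) x₀) :
    ∃ e : OpenPartialHomeomorph X Y, x₀ ∈ e.source ∧ e.source ⊆ O ∧ (∀ x, e x = f x) ∧
      ContDiffOn ℝ ∞ e.symm e.target ∧ ∀ x ∈ e.source, (fderiv ℝ f x).IsInvertible := by
  have hfa : ∀ x ∈ O, ContDiffAt ℝ ∞ f x := fun x hx ↦ hf.contDiffAt (hO.mem_nhds hx)
  have hcont : ContinuousOn (fderiv ℝ f) O := hf.continuousOn_fderiv_of_isOpen hO (by simp)
  -- The source is cut down to the points where the derivative is invertible, so that the inverse is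
  -- smooth on the whole target and not only at the image of `x₀`.
  have hopen : IsOpen (O ∩ fderiv ℝ f ⁻¹' range ((↑) : (X ≃L[ℝ] Y) → X →L[ℝ] Y)) :=
    hcont.isOpen_inter_preimage hO ContinuousLinearEquiv.isOpen
  let e₀ := (hfa x₀ hx₀).toOpenPartialHomeomorph f hf' (by simp)
  refine ⟨e₀.restrOpen _ hopen, ?_, ?_, fun x ↦ rfl, ?_, ?_⟩
  · refine ⟨(hfa x₀ hx₀).mem_toOpenPartialHomeomorph_source hf' (by simp), hx₀, ?_⟩
    exact ⟨f', hf'.fderiv.symm⟩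
  · exact fun x hx ↦ hx.2.1
  · intro y hy
    have hx := (e₀.restrOpen _ hopen).map_target hy
    obtain ⟨A, hA⟩ := hx.2.2
    have hxO := hx.2.1
    refine ((e₀.restrOpen _ hopen).contDiffAt_symm hy (f₀' := A) ?_ ?_).contDiffWithinAt
    · rw [hA]
      exact ((hfa _ hxO).differentiableAt (by simp)).hasFDerivAt
    · exact hfa _ hxO
  · rintro x hx
    obtain ⟨A, hA⟩ := hx.2.2
    exact ⟨A, hA⟩

end InverseFunction

/-! ## Flows of commuting frames -/

section FixedPoint

variable {E X : Type*} [NormedAddCommGroup E] [NormedSpace ℝ E] [CompleteSpace E]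
  [NormedAddCommGroup X] [NormedSpace ℝ X] [CompleteSpace X]

/-- Smooth dependence on parameters of the solution of a fixed point equation `Q (z, η) = η`. -/
theorem exists_fixedPoint_family {Q : E × X → X} (hQ : ContDiff ℝ ∞ Q) {c : X} (hc : Q (0, c) = c)
    (hd : ∀ ζ, fderiv ℝ Q (0, c) (0, ζ) = 0) {O : Set (E × X)} (hO : IsOpen O) (hcO : (0, c) ∈ O) :
    ∃ (η : E → X) (U : Set E), IsOpen U ∧ 0 ∈ U ∧ ContDiffOn ℝ ∞ η U ∧ η 0 = c ∧
      ∀ z ∈ U, (z, η z) ∈ O ∧ Q (z, η z) = η z ∧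
        ∀ v ζ, fderiv ℝ Q (z, η z) (v, ζ) = ζ → fderiv ℝ η z v = ζ := by
  have hQd : ∀ p, HasFDerivAt Q (fderiv ℝ Q p) p := fun p ↦
    (hQ.differentiable (by simp) p).hasFDerivAt
  -- A fixed point of Q (z, ·) is a point that Θ sends to (z, 0), so the family is read off from the
  -- local inverse of Θ.
  let Θ : E × X → E × X := fun p ↦ (p.1, p.2 - Q p)
  have hΘ : ContDiff ℝ ∞ Θ := contDiff_fst.prodMk (contDiff_snd.sub hQ)
  let D : E × X → E × X →L[ℝ] E × X := fun p ↦
    (ContinuousLinearMap.fst ℝ E X).prod (ContinuousLinearMap.snd ℝ E X - fderiv ℝ Q p)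
  have hD : ∀ p, HasFDerivAt Θ (D p) p := fun p ↦
    hasFDerivAt_fst.prodMk (hasFDerivAt_snd.sub (hQd p))
  let R : E →L[ℝ] X := fderiv ℝ Q (0, c) ∘L ContinuousLinearMap.inl ℝ E X
  -- Since the derivative of Q in the second variable vanishes at (0, c), the derivative of Θ there
  -- is the shear (v, ζ) ↦ (v, ζ - R v), whose inverse is the opposite shear.
  let A₀ : (E × X) ≃L[ℝ] (E × X) := ContinuousLinearEquiv.equivOfInverse
    ((ContinuousLinearMap.fst ℝ E X).prod
      (ContinuousLinearMap.snd ℝ E X - R ∘L (ContinuousLinearMap.fst ℝ E X)))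
    ((ContinuousLinearMap.fst ℝ E X).prod
      (ContinuousLinearMap.snd ℝ E X + R ∘L (ContinuousLinearMap.fst ℝ E X)))
    (fun p ↦ by simp) (fun p ↦ by simp)
  have hA₀ : HasFDerivAt Θ (A₀ : E × X →L[ℝ] E × X) (0, c) := by
    have : D (0, c) = A₀ := by
      refine ContinuousLinearMap.ext fun p ↦ Prod.ext rfl ?_
      change p.2 - fderiv ℝ Q (0, c) p = p.2 - fderiv ℝ Q (0, c) (p.1, 0)
      have h : p = (p.1, 0) + (0, p.2) := by simp
      conv_lhs => rw [h]
      rw [map_add, hd, add_zero]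
      simp
    rw [← this]
    exact hD _
  obtain ⟨e, he0, heO, hee, hes, heinv⟩ :=
    ContDiffOn.exists_openPartialHomeomorph hO hΘ.contDiffOn hcO hA₀
  have hΘ0 : Θ (0, c) = (0, 0) := by simp [Θ, hc]
  let η : E → X := fun z ↦ (e.symm (z, 0)).2
  let U : Set E := (fun z ↦ ((z, 0) : E × X)) ⁻¹' e.target
  have hU : IsOpen U := e.open_target.preimage (by fun_prop)
  have hηs : ContDiffOn ℝ ∞ η U := by
    refine contDiff_snd.comp_contDiffOn (hes.comp (g := e.symm) ?_ fun z hz ↦ hz)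
    exact (contDiff_id.prodMk contDiff_const).contDiffOn
  have hmem : ∀ z ∈ U, (z, η z) ∈ e.source ∧ Θ (z, η z) = (z, 0) := by
    intro z hz
    have h1 := e.map_target hz
    have h2 := e.right_inv hz
    rw [hee] at h2
    have h3 : (e.symm (z, 0)).1 = z := congrArg Prod.fst h2
    have h4 : e.symm (z, 0) = (z, η z) := Prod.ext h3 rfl
    rw [h4] at h1 h2
    exact ⟨h1, h2⟩
  have hdη : ∀ z ∈ U, HasFDerivAt η (fderiv ℝ η z) z := fun z hz ↦
    ((hηs.contDiffAt (hU.mem_nhds hz)).differentiableAt (by simp)).hasFDerivAt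
  have hDη : ∀ z ∈ U, ∀ v, D (z, η z) (v, fderiv ℝ η z v) = (v, 0) := by
    intro z hz v
    have h1 : HasFDerivAt (fun z ↦ Θ (z, η z))
        ((D (z, η z)) ∘L ((ContinuousLinearMap.id ℝ E).prod (fderiv ℝ η z))) z :=
      (hD (z, η z)).comp z ((hasFDerivAt_id z).prodMk (hdη z hz))
    have h2 : HasFDerivAt (fun z ↦ ((z, 0) : E × X))
        ((ContinuousLinearMap.id ℝ E).prod 0) z := (hasFDerivAt_id z).prodMk (hasFDerivAt_const _ _)
    have h3 : (fun z ↦ Θ (z, η z)) =ᶠ[𝓝 z] fun z ↦ ((z, 0) : E × X) := by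
      filter_upwards [hU.mem_nhds hz] with y hy
      exact (hmem y hy).2
    have h4 := h1.unique (h2.congr_of_eventuallyEq h3)
    exact congrArg (fun T : E →L[ℝ] E × X ↦ T v) h4
  refine ⟨η, U, hU, ?_, hηs, ?_, fun z hz ↦ ?_⟩
  · have := e.map_source he0
    rw [hee, hΘ0] at this
    exact this
  · have h := e.left_inv he0
    rw [hee, hΘ0] at h
    exact congrArg Prod.snd h
  · obtain ⟨hz1, hz2⟩ := hmem z hz
    refine ⟨heO hz1, (sub_eq_zero.1 (congrArg Prod.snd hz2)).symm, fun v ζ hζ ↦ ?_⟩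
    -- The linearized equation has at most one solution ζ for a given v. This lets the derivative of
    -- η be identified by guessing a solution.
    have hinj : Function.Injective (D (z, η z)) := by
      obtain ⟨A, hA⟩ := heinv _ hz1
      rw [(hD (z, η z)).fderiv] at hA
      rw [← hA]
      exact A.injective
    have h : D (z, η z) (v, ζ) = (v, 0) := Prod.ext rfl (sub_eq_zero.2 hζ.symm)
    exact congrArg Prod.snd (hinj ((hDη z hz v).trans h.symm))

end FixedPoint

/-! ### Straightening a commuting frame by an integral equation -/

section Flow

open unitInterval

universe u

variable {E : Type u} [NormedAddCommGroup E] [NormedSpace ℝ E]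

variable [CompleteSpace E]

/-- The primitive, vanishing at `0`, of a continuous function on the unit interval. -/
def ContinuousMap.primitive (E : Type u) [NormedAddCommGroup E] [NormedSpace ℝ E]
    [CompleteSpace E] : C(I, E) →L[ℝ] C(I, E) :=
  LinearMap.mkContinuous
    { toFun := fun f ↦ ⟨fun t ↦ ∫ s in (0 : ℝ)..t, IccExtend zero_le_one f s, by
        have h : Continuous fun t : ℝ ↦ ∫ s in (0 : ℝ)..t, IccExtend zero_le_one f s :=
          intervalIntegral.continuous_primitive
            (fun a b ↦ (f.continuous.Icc_extend' (h := zero_le_one)).intervalIntegrable a b) 0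
        exact h.comp continuous_subtype_val⟩
      map_add' := fun f g ↦ by
        ext t
        simp only [ContinuousMap.coe_mk, ContinuousMap.add_apply]
        rw [← intervalIntegral.integral_add]
        · rfl
        · exact (f.continuous.Icc_extend' (h := zero_le_one)).intervalIntegrable _ _
        · exact (g.continuous.Icc_extend' (h := zero_le_one)).intervalIntegrable _ _
      map_smul' := fun c f ↦ by
        ext t
        simp only [ContinuousMap.coe_mk, ContinuousMap.smul_apply, RingHom.id_apply]
        rw [← intervalIntegral.integral_smul]
        rfl } 1
    (fun f ↦ by
      rw [one_mul, ContinuousMap.norm_le _ (norm_nonneg _)]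
      intro t
      have h : ∀ s ∈ uIoc (0 : ℝ) t, ‖IccExtend zero_le_one f s‖ ≤ ‖f‖ :=
        fun s _ ↦ f.norm_coe_le_norm _
      have h2 := intervalIntegral.norm_integral_le_of_norm_le_const h
      refine h2.trans ?_
      rw [sub_zero, abs_of_nonneg t.2.1]
      exact mul_le_of_le_one_right (norm_nonneg _) t.2.2)

theorem ContinuousMap.primitive_apply (f : C(I, E)) (t : I) :
    ContinuousMap.primitive E f t = ∫ s in (0 : ℝ)..t, IccExtend zero_le_one f s := rfl

theorem ContinuousMap.primitive_eq {f Y : C(I, E)} {y : ℝ → E} {y' : ℝ → E}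
    (hy : ∀ t, HasDerivAt y (y' t) t) (hc : Continuous y') (hf : ∀ t : I, f t = y' t)
    (hY : ∀ t : I, Y t = y t - y 0) :
    ContinuousMap.primitive E f = Y := by
  ext t
  rw [ContinuousMap.primitive_apply, hY,
    ← intervalIntegral.integral_eq_sub_of_hasDerivAt
    (fun s _ ↦ hy s) (hc.intervalIntegrable _ _)]
  refine intervalIntegral.integral_congr fun s hs ↦ ?_
  rw [uIcc_of_le t.2.1] at hs
  have hs' : s ∈ Icc (0 : ℝ) 1 := ⟨hs.1, hs.2.trans t.2.2⟩
  refine (IccExtend_of_mem zero_le_one f hs').trans ?_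
  exact hf ⟨s, hs'⟩

variable (E) in
/-- Constant functions on the unit interval. -/
def ContinuousMap.constCLM : E →L[ℝ] C(I, E) :=
  LinearMap.mkContinuous
    { toFun := fun v ↦ ContinuousMap.const I v
      map_add' := fun _ _ ↦ rfl
      map_smul' := fun _ _ ↦ rfl } 1
    (fun v ↦ by
      rw [one_mul, ContinuousMap.norm_le _ (norm_nonneg _)]
      exact fun _ ↦ le_rfl)

omit [CompleteSpace E] in
@[simp]
theorem ContinuousMap.constCLM_apply (v : E) (t : I) : ContinuousMap.constCLM E v t = v := rfl

instance (F : Type*) [NormedAddCommGroup F] [NormedSpace ℝ F] :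
    NormedAddCommGroup (F →L[ℝ] C(I, E)) :=
  ContinuousLinearMap.toNormedAddCommGroup

instance (F : Type*) [NormedAddCommGroup F] [NormedSpace ℝ F] :
    NormedSpace ℝ (F →L[ℝ] C(I, E)) :=
  ContinuousLinearMap.toNormedSpace

/-- If `η' = L(η) z`, the columns of `L` commuting, then `w = t L(η) v` solves the linearized
equation `w' = L(η) v + DL(η)(w) z`. -/
theorem ContinuousMap.primitive_column {L : E → E →L[ℝ] E} (hL : ContDiff ℝ ∞ L)
    {η g w f : C(I, E)} {z v c : E} (hg : ∀ t, g t = L (η t) z)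
    (hη : ∀ t : I, η t = c + ContinuousMap.primitive E g t)
    (hcomm : ∀ t, ∀ u v, fderiv ℝ L (η t) (L (η t) u) v = fderiv ℝ L (η t) (L (η t) v) u)
    (hw : ∀ t : I, w t = (t : ℝ) • L (η t) v)
    (hf : ∀ t, f t = L (η t) v + fderiv ℝ L (η t) (w t) z) :
    ContinuousMap.primitive E f = w := by
  have hL' : ContDiff ℝ ∞ (fderiv ℝ L) := hL.fderiv_right (by simp)
  have hLd : ∀ q, HasFDerivAt L (fderiv ℝ L q) q := fun q ↦
    (hL.differentiable (by simp) q).hasFDerivAt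
  let G : ℝ → E := IccExtend zero_le_one g
  have hcI : Continuous G := g.continuous.Icc_extend' (h := zero_le_one)
  let y : ℝ → E := fun t ↦ c + ∫ s in (0 : ℝ)..t, G s
  have hyη : ∀ t : I, η t = y t := hη
  have hyd : ∀ t, HasDerivAt y (G t) t := fun t ↦
    (intervalIntegral.integral_hasDerivAt_right (hcI.intervalIntegrable _ _)
      hcI.stronglyMeasurable.stronglyMeasurableAtFilter hcI.continuousAt).const_add _
  have hyc : Continuous y := continuous_iff_continuousAt.2 fun t ↦ (hyd t).continuousAt
  let y' : ℝ → E := fun t ↦ L (y t) v + t • fderiv ℝ L (y t) (G t) v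
  have hw' : ∀ t, HasDerivAt (fun t : ℝ ↦ t • L (y t) v) (y' t) t := fun t ↦ by
    have h0 : HasDerivAt (fun t ↦ L (y t)) (fderiv ℝ L (y t) (G t)) t :=
      (hLd (y t)).comp_hasDerivAt t (hyd t)
    have h1 := h0.clm_apply (hasDerivAt_const t v)
    rw [map_zero, add_zero] at h1
    have := (hasDerivAt_id t).smul h1
    rw [one_smul, add_comm] at this
    exact this
  have hy'c : Continuous y' := by
    refine ((hL.continuous.comp hyc).clm_apply continuous_const).add (continuous_id.smul ?_)
    exact ((hL'.continuous.comp hyc).clm_apply hcI).clm_apply continuous_const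
  refine ContinuousMap.primitive_eq hw' hy'c (fun t ↦ ?_) (fun t ↦ ?_)
  · have h1 : G t = L (η t) z := (IccExtend_of_mem zero_le_one g t.2).trans (hg t)
    rw [hf, hw, map_smul]
    change L (η t) v + (t : ℝ) • fderiv ℝ L (η t) (L (η t) v) z =
      L (y t) v + (t : ℝ) • fderiv ℝ L (y t) (G t) v
    -- The product rule gives t DL(η)(L(η) z) v, the linearized equation asks for t DL(η)(L(η) v) z;
    -- commutation of the columns exchanges u = v and u = z.
    rw [hcomm, h1, ← hyη]
  · rw [hw, hyη, zero_smul, sub_zero]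

/-- Let `L` be a smooth family of linear maps whose column fields `q ↦ L q v` commute near `x₀`,
and which agrees with the projection `P` at `x₀`. Then the column fields are simultaneously
straightened by a local diffeomorphism. -/
theorem exists_straightening_of_commute {L : E → E →L[ℝ] E} (hL : ContDiff ℝ ∞ L)
    {P : E →L[ℝ] E} (hP : ∀ v, P (P v) = P v) (hLP : ∀ q v, L q (P v) = L q v) {x₀ : E}
    (hx₀ : L x₀ = P) {O : Set E} (hO : IsOpen O) (hxO : x₀ ∈ O)
    (hcomm : ∀ q ∈ O, ∀ u v, fderiv ℝ L q (L q u) v = fderiv ℝ L q (L q v) u) :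
    ∃ (Ψ : E → E) (U : Set E), IsOpen U ∧ 0 ∈ U ∧ ContDiffOn ℝ ∞ Ψ U ∧ Ψ 0 = x₀ ∧
      HasFDerivAt Ψ (ContinuousLinearMap.id ℝ E) 0 ∧
      ∀ z ∈ U, ∀ v, fderiv ℝ Ψ z (P v) = L (Ψ z) v := by
  have hL' : ContDiff ℝ ∞ (fderiv ℝ L) := hL.fderiv_right (by simp)
  have hLd : ∀ q, HasFDerivAt L (fderiv ℝ L q) q := fun q ↦
    (hL.differentiable (by simp) q).hasFDerivAt
  let N : C(I, E) → C(I, E →L[ℝ] E) := ContinuousMap.postcompose I hL.continuous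
  have hN : ContDiff ℝ ∞ N := ContinuousMap.contDiff_postcompose hL
  let N' : C(I, E) → C(I, E) →L[ℝ] C(I, E →L[ℝ] E) := fun η ↦
    ContinuousMap.pointwiseApply I E (E →L[ℝ] E) (ContinuousMap.postcompose I hL'.continuous η)
  have hN' : ∀ η, HasFDerivAt N (N' η) η := fun η ↦
    ContinuousMap.hasFDerivAt_postcompose hL.continuous hLd hL'.continuous η
  let J := ContinuousMap.primitive E
  let C := ContinuousMap.constCLM E
  let B : C(I, E →L[ℝ] E) →L[ℝ] E →L[ℝ] C(I, E) :=
    ((ContinuousMap.pointwiseApply I E E).flip ∘L C).flip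
  have hB : ∀ A z t, B A z t = A t z := fun _ _ _ ↦ rfl
  -- The component of z transverse to the range of P fixes the starting point x₀ + (z - P z) of the
  -- path; the component P z fixes which column field is followed up to time 1. In `Q` the vector z
  -- multiplies the nonlinear term, so the derivative of `Q` in the path vanishes at z = 0.
  let S : E →L[ℝ] C(I, E) := C ∘L (ContinuousLinearMap.id ℝ E - P)
  let Q : E × C(I, E) → C(I, E) := fun p ↦ C x₀ + S p.1 + J (B (N p.2) p.1)
  have hQ : ContDiff ℝ ∞ Q :=
    (contDiff_const.add (S.contDiff.comp contDiff_fst)).add (J.contDiff.comp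
      ((B.contDiff.comp (hN.comp contDiff_snd)).clm_apply contDiff_fst))
  have hQd : ∀ z η v ζ, fderiv ℝ Q (z, η) (v, ζ) = S v + J (B (N η) v + B (N' η ζ) z) := by
    intro z η v ζ
    have h1 : HasFDerivAt (fun p : E × C(I, E) ↦ B (N p.2)) _ (z, η) :=
      B.hasFDerivAt.comp (z, η) ((hN' η).comp (z, η) hasFDerivAt_snd)
    have h2 := J.hasFDerivAt.comp (z, η) (h1.clm_apply hasFDerivAt_fst)
    have h3 : HasFDerivAt Q _ (z, η) :=
      ((S.hasFDerivAt.comp (z, η) hasFDerivAt_fst).const_add (C x₀)).add h2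
    rw [h3.fderiv]
    rfl
  have hNC : ∀ v, B (N (C x₀)) v = C (P v) := fun v ↦ by
    ext t
    change L x₀ v = P v
    rw [hx₀]
  -- The columns commute on O only, so the solution paths must stay inside O. By compactness of the
  -- interval this is an open condition on paths.
  have hO' : IsOpen {p : E × C(I, E) | ∀ t, p.2 t ∈ O} := by
    have h := (ContinuousMap.isOpen_setOfPred_mapsTo (X := I) (Y := E) isCompact_univ hO)
    have h2 : {p : E × C(I, E) | ∀ t, p.2 t ∈ O} = Prod.snd ⁻¹' {f : C(I, E) | MapsTo f univ O} := by
      ext p; simp [MapsTo]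
    rw [h2]
    exact h.preimage continuous_snd
  obtain ⟨η, U, hU, h0U, hηs, hη0, hη⟩ := exists_fixedPoint_family hQ (c := C x₀)
    (by change C x₀ + S 0 + J (B (N (C x₀)) 0) = C x₀; simp)
    (fun ζ ↦ by rw [hQd, map_zero, map_zero, map_zero, zero_add, add_zero, map_zero])
    hO' (fun _ ↦ hxO)
  let ev : C(I, E) →L[ℝ] E := ContinuousMap.evalCLM ℝ (1 : I)
  have hev : ∀ f, ev f = f 1 := fun _ ↦ rfl
  have hΨd : ∀ z ∈ U, HasFDerivAt (fun z ↦ η z 1) (ev ∘L fderiv ℝ η z) z := fun z hz ↦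
    ev.hasFDerivAt.comp z
      ((hηs.contDiffAt (hU.mem_nhds hz)).differentiableAt (by simp)).hasFDerivAt
  -- the candidate for the derivative of `η` in the directions of the range of `P`
  have hkey : ∀ z ∈ U, ∀ v, fderiv ℝ η z (P v) 1 = L (η z 1) v := by
    intro z hz v
    obtain ⟨hzO, hz2, hz3⟩ := hη z hz
    let w : C(I, E) := ⟨fun t ↦ (t : ℝ) • L (η z t) v,
      continuous_subtype_val.smul ((hL.continuous.comp (η z).continuous).clm_apply continuous_const)⟩
    have hJ : J (B (N (η z)) (P v) + B (N' (η z) w) z) = w := by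
      refine ContinuousMap.primitive_column hL (g := B (N (η z)) z) (z := z) (v := v)
        (c := x₀ + S z 0) (fun t ↦ rfl)
        (fun t ↦ (congrArg (fun f : C(I, E) ↦ f t) hz2).symm) (fun t ↦ hcomm _ (hzO t))
        (fun t ↦ rfl) (fun t ↦ ?_)
      change L (η z t) (P v) + fderiv ℝ L (η z t) (w t) z = _
      rw [hLP]
    have h2 : fderiv ℝ η z (P v) = w := hz3 _ _ (by
      rw [hQd, hJ]
      change C (P v - P (P v)) + w = w
      rw [hP, sub_self, map_zero, zero_add])
    rw [h2]
    change (1 : ℝ) • L (η z 1) v = _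
    rw [one_smul]
  refine ⟨fun z ↦ η z 1, U, hU, h0U, ev.contDiff.comp_contDiffOn hηs, ?_, ?_, ?_⟩
  · simp only [hη0]; rfl
  · have h := hΨd 0 h0U
    -- At z = 0 the path is constant and the variation in direction v is t ↦ (v - P v) + t P v,
    -- which equals v at time 1.
    have : ev ∘L fderiv ℝ η 0 = ContinuousLinearMap.id ℝ E := by
      ext v
      have h4 : J (C (P v)) 1 = P v := by
        change (∫ s in (0 : ℝ)..1, P v) = P v
        simp
      have h2 : fderiv ℝ η 0 v = S v + J (C (P v)) := (hη 0 h0U).2.2 _ _ (by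
        rw [hη0, hQd, hNC, map_zero, add_zero])
      change fderiv ℝ η 0 v 1 = v
      rw [h2, ContinuousMap.add_apply, h4]
      change v - P v + P v = v
      simp
    rw [← this]
    exact h
  · intro z hz v
    rw [(hΨd z hz).fderiv]
    exact hkey z hz v

end Flow

/-! ## The Frobenius theorem -/

section Frobenius

universe u

variable {E : Type u} [NormedAddCommGroup E] [NormedSpace ℝ E]

/-- A family of projections on the open set `O` is involutive if the bracket of two smooth vector
fields in its range lies in its range. -/
def IsInvolutiveOn (P : E → E →L[ℝ] E) (O : Set E) : Prop :=
  ∀ (W : Set E) (ξ η : E → E), IsOpen W → W ⊆ O → ContDiffOn ℝ ∞ ξ W → ContDiffOn ℝ ∞ η W →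
    (∀ x ∈ W, P x (ξ x) = ξ x) → (∀ x ∈ W, P x (η x) = η x) →
    ∀ x ∈ W, P x (fderiv ℝ η x (ξ x) - fderiv ℝ ξ x (η x)) = fderiv ℝ η x (ξ x) - fderiv ℝ ξ x (η x)

variable [FiniteDimensional ℝ E]

/-- A bump function supported in O replaces f by the constant c away from x₀. This makes a local
frame globally smooth, as composition operators on path space require. -/
theorem ContDiffOn.exists_contDiff_eqOn_ball {F : Type*} [NormedAddCommGroup F] [NormedSpace ℝ F]
    {f : E → F} {O : Set E} (hO : IsOpen O) (hf : ContDiffOn ℝ ∞ f O) {x₀ : E} (hx₀ : x₀ ∈ O) :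
    ∃ (χ : E → ℝ) (r : ℝ), 0 < r ∧ Metric.ball x₀ r ⊆ O ∧ (∀ x ∈ Metric.ball x₀ r, χ x = 1) ∧
      ∀ c : F, ContDiff ℝ ∞ fun x ↦ c + χ x • (f x - c) := by
  obtain ⟨R, hR, hRO⟩ := Metric.isOpen_iff.1 hO x₀ hx₀
  let χ : ContDiffBump x₀ := ⟨R / 4, R / 2, by positivity, by linarith⟩
  refine ⟨χ, R / 4, by positivity, (Metric.ball_subset_ball (by linarith)).trans hRO, ?_, ?_⟩
  · exact fun x hx ↦ χ.one_of_mem_closedBall (Metric.ball_subset_closedBall hx)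
  · intro c
    rw [contDiff_iff_contDiffAt]
    intro x
    by_cases hx : x ∈ tsupport χ
    · have hxO : x ∈ O := by
        apply hRO
        rw [χ.tsupport_eq] at hx
        exact Metric.closedBall_subset_ball (show R / 2 < R by linarith) hx
      exact contDiffAt_const.add (χ.contDiffAt.smul
        ((hf.contDiffAt (hO.mem_nhds hxO)).sub contDiffAt_const))
    · have h : (fun x ↦ c + χ x • (f x - c)) =ᶠ[𝓝 x] fun _ ↦ c := by
        filter_upwards [(isClosed_tsupport χ).isOpen_compl.mem_nhds hx] with y hy
        rw [image_eq_zero_of_notMem_tsupport hy, zero_smul, add_zero]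
      exact contDiffAt_const.congr_of_eventuallyEq h

/-- Frobenius theorem: an involutive distribution is locally the kernel of the differential of a
submersion. -/
theorem IsInvolutiveOn.exists_ker_fderiv {P : E → E →L[ℝ] E} {O : Set E} (hO : IsOpen O)
    (hP : ContDiffOn ℝ ∞ P O) (hPP : ∀ x ∈ O, ∀ v, P x (P x v) = P x v)
    (hinv : IsInvolutiveOn P O) {x₀ : E} (hx₀ : x₀ ∈ O) :
    ∃ (G : E → E) (U : Set E), IsOpen U ∧ x₀ ∈ U ∧ U ⊆ O ∧ ContDiffOn ℝ ∞ G U ∧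
      HasFDerivAt G (ContinuousLinearMap.id ℝ E - P x₀) x₀ ∧
      ∀ x ∈ U, ∀ v, P x₀ (fderiv ℝ G x v) = 0 ∧ (fderiv ℝ G x v = 0 ↔ P x v = v) := by
  let P₀ := P x₀
  have hP₀ : ∀ v, P₀ (P₀ v) = P₀ v := hPP x₀ hx₀
  let J := ContinuousLinearMap.id ℝ E
  -- S x intertwines the two projections, P₀ ∘ S x = S x ∘ P x, and S x₀ is the identity; near x₀ it
  -- is an isomorphism carrying the range of P x to that of P₀.
  let S : E → E →L[ℝ] E := fun x ↦ P₀ ∘L P x + (J - P₀) ∘L (J - P x)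
  have hSd : ∀ x v, S x v = P₀ (P x v) + ((v - P x v) - P₀ (v - P x v)) := fun x v ↦ rfl
  have hS : ContDiffOn ℝ ∞ S O :=
    (contDiffOn_const.clm_comp hP).add (contDiffOn_const.clm_comp (contDiffOn_const.sub hP))
  let O₁ : Set E := O ∩ S ⁻¹' range ((↑) : (E ≃L[ℝ] E) → E →L[ℝ] E)
  have hO₁ : IsOpen O₁ := hS.continuousOn.isOpen_inter_preimage hO ContinuousLinearEquiv.isOpen
  have hSx₀ : S x₀ = J := by
    ext v
    rw [hSd]
    change P₀ (P₀ v) + ((v - P₀ v) - P₀ (v - P₀ v)) = v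
    rw [map_sub, hP₀]; abel
  have hx₁ : x₀ ∈ O₁ := ⟨hx₀, ContinuousLinearEquiv.refl ℝ E, hSx₀.symm⟩
  -- The columns of L₁ span the range of P x and are normalized by P₀ (L₁ x v) = P₀ v. This
  -- normalization is what makes them commute.
  let L₁ : E → E →L[ℝ] E := fun x ↦ (S x).inverse ∘L P₀
  have hL₁ : ContDiffOn ℝ ∞ L₁ O₁ := by
    intro x hx
    obtain ⟨A, hA⟩ := hx.2
    have h1 : ContDiffAt ℝ ∞ S x := hS.contDiffAt (hO.mem_nhds hx.1)
    have h2 : ContDiffAt ℝ ∞ (fun x ↦ (S x).inverse) x := by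
      have h3 : ContDiffAt ℝ ∞ (ContinuousLinearMap.inverse : (E →L[ℝ] E) → E →L[ℝ] E) (S x) := by
        rw [← hA]
        exact contDiffAt_map_inverse A
      exact h3.comp x h1
    exact (h2.clm_comp contDiffAt_const).contDiffWithinAt
  obtain ⟨χ, r, hr, hrO, hχ, hglue⟩ := hL₁.exists_contDiff_eqOn_ball hO₁ hx₁
  let L : E → E →L[ℝ] E := fun x ↦ P₀ + χ x • (L₁ x - P₀)
  have hL : ContDiff ℝ ∞ L := hglue P₀
  have hLL₁ : ∀ x ∈ Metric.ball x₀ r, L x = L₁ x := fun x hx ↦ by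
    change P₀ + χ x • (L₁ x - P₀) = _
    rw [hχ x hx, one_smul, add_sub_cancel]
  have hinvS : ∀ x ∈ O₁, ∀ v, S x ((S x).inverse v) = v ∧ (S x).inverse (S x v) = v := by
    intro x hx v
    obtain ⟨A, hA⟩ := hx.2
    rw [← hA, ContinuousLinearMap.inverse_equiv]
    simp
  have hLP : ∀ q v, L q (P₀ v) = L q v := fun q v ↦ by
    change P₀ (P₀ v) + χ q • ((S q).inverse (P₀ (P₀ v)) - P₀ (P₀ v)) =
      P₀ v + χ q • ((S q).inverse (P₀ v) - P₀ v)
    rw [hP₀]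
  -- properties of `L` on the ball
  have hPS : ∀ x ∈ O₁, ∀ v, P₀ (S x v) = S x (P x v) := fun x hx v ↦ by
    rw [hSd, hSd, hPP x hx.1, map_add, map_sub P₀ (v - _), hP₀, hP₀]
    simp
  have hL1 : ∀ x ∈ Metric.ball x₀ r, ∀ v, P x (L x v) = L x v := fun x hx v ↦ by
    rw [hLL₁ x hx]
    change P x ((S x).inverse (P₀ v)) = (S x).inverse (P₀ v)
    have h := hPS x (hrO hx) ((S x).inverse (P₀ v))
    rw [(hinvS x (hrO hx) _).1, hP₀] at h
    have h' := congrArg (S x).inverse h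
    rw [(hinvS x (hrO hx) _).2] at h'
    exact h'.symm
  have hL2 : ∀ x ∈ Metric.ball x₀ r, ∀ v, P₀ (L x v) = P₀ v := fun x hx v ↦ by
    have h1 : S x (L x v) = P₀ v := by
      rw [hLL₁ x hx]
      exact (hinvS x (hrO hx) _).1
    rw [hSd, hL1 x hx, sub_self, map_zero, sub_zero, add_zero] at h1
    exact h1
  have hL3 : ∀ x ∈ Metric.ball x₀ r, ∀ v, P x v = v → L x v = v := fun x hx v hv ↦ by
    rw [hLL₁ x hx]
    change (S x).inverse (P₀ v) = v
    have h1 : S x v = P₀ v := by rw [hSd, hv]; simp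
    rw [← h1, (hinvS x (hrO hx) _).2]
  have hLd : ∀ x u, HasFDerivAt (fun y ↦ L y u) ((fderiv ℝ L x).flip u) x := fun x u ↦ by
    have := ((hL.differentiable (by simp) x).hasFDerivAt).clm_apply (hasFDerivAt_const u x)
    simpa using this
  -- P₀ annihilates the bracket because P₀ (L y u) does not depend on y. By involutivity the bracket
  -- also lies in the range of P q, where S q coincides with P₀. As S q is injective, the bracket is
  -- zero.
  have hcomm : ∀ q ∈ Metric.ball x₀ r, ∀ u v,
      fderiv ℝ L q (L q u) v = fderiv ℝ L q (L q v) u := by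
    intro q hq u v
    have hs : ∀ u, ContDiffOn ℝ ∞ (fun y ↦ L y u) (Metric.ball x₀ r) := fun u ↦
      (hL.clm_apply contDiff_const).contDiffOn
    have h1 := hinv _ (fun y ↦ L y u) (fun y ↦ L y v) Metric.isOpen_ball
      (hrO.trans inter_subset_left) (hs u) (hs v) (fun x hx ↦ hL1 x hx u) (fun x hx ↦ hL1 x hx v) q hq
    rw [(hLd q u).fderiv, (hLd q v).fderiv] at h1
    change P q (fderiv ℝ L q (L q u) v - fderiv ℝ L q (L q v) u) =
      fderiv ℝ L q (L q u) v - fderiv ℝ L q (L q v) u at h1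
    have hconst : ∀ w u, P₀ (fderiv ℝ L q w u) = 0 := fun w u ↦ by
      have h2 : HasFDerivAt (fun y ↦ P₀ (L y u)) (P₀ ∘L (fderiv ℝ L q).flip u) q :=
        P₀.hasFDerivAt.comp q (hLd q u)
      have h3 : (fun y ↦ P₀ (L y u)) =ᶠ[𝓝 q] fun _ ↦ P₀ u := by
        filter_upwards [Metric.isOpen_ball.mem_nhds hq] with y hy
        exact hL2 y hy u
      have h4 := h2.unique ((hasFDerivAt_const (P₀ u) q).congr_of_eventuallyEq h3)
      exact congrArg (fun T : E →L[ℝ] E ↦ T w) h4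
    rw [← sub_eq_zero]
    set b := fderiv ℝ L q (L q u) v - fderiv ℝ L q (L q v) u with hb
    have h5 : P₀ b = 0 := by rw [hb, map_sub, hconst, hconst, sub_zero]
    have h6 : S q b = 0 := by rw [hSd, h1, h5]; simp
    rw [← (hinvS q (hrO hq) b).2, h6, map_zero]
  have hLx₀ : L x₀ = P₀ := by
    rw [hLL₁ x₀ (Metric.mem_ball_self hr)]
    change (S x₀).inverse ∘L P₀ = P₀
    rw [hSx₀]
    simp [J]
  obtain ⟨Ψ, U, hU, h0U, hΨ, hΨ0, hΨd, hΨL⟩ := exists_straightening_of_commute hL hP₀ hLP hLx₀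
    Metric.isOpen_ball (Metric.mem_ball_self hr) hcomm
  have hU' : IsOpen (U ∩ Ψ ⁻¹' Metric.ball x₀ r) :=
    hΨ.continuousOn.isOpen_inter_preimage hU Metric.isOpen_ball
  have h0U' : (0 : E) ∈ U ∩ Ψ ⁻¹' Metric.ball x₀ r := ⟨h0U, by
    rw [mem_preimage, hΨ0]; exact Metric.mem_ball_self hr⟩
  obtain ⟨e, he0, heU, hee, hes, heinv⟩ := (hΨ.mono inter_subset_left).exists_openPartialHomeomorph
    hU' h0U' (f' := ContinuousLinearEquiv.refl ℝ E) hΨd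
  have hx₀t : x₀ ∈ e.target := by
    have := e.map_source he0
    rwa [hee, hΨ0] at this
  have hsx₀ : e.symm x₀ = 0 := by
    rw [← hΨ0, ← hee]; exact e.left_inv he0
  have hsd : ∀ x ∈ e.target, HasFDerivAt e.symm (fderiv ℝ e.symm x) x := fun x hx ↦
    ((hes.contDiffAt (e.open_target.mem_nhds hx)).differentiableAt (by simp)).hasFDerivAt
  have hcompd : ∀ x ∈ e.target, ∀ v, fderiv ℝ Ψ (e.symm x) (fderiv ℝ e.symm x v) = v := by
    intro x hx v
    have hz := e.map_target hx
    have h1 : HasFDerivAt Ψ (fderiv ℝ Ψ (e.symm x)) (e.symm x) :=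
      ((hΨ.contDiffAt (hU.mem_nhds (heU hz).1)).differentiableAt (by simp)).hasFDerivAt
    have h2 := h1.comp x (hsd x hx)
    have h3 : Ψ ∘ e.symm =ᶠ[𝓝 x] id := by
      filter_upwards [e.open_target.mem_nhds hx] with y hy
      rw [Function.comp_apply, ← hee, e.right_inv hy]; rfl
    have h4 := h2.unique ((hasFDerivAt_id x).congr_of_eventuallyEq h3)
    exact congrArg (fun T : E →L[ℝ] E ↦ T v) h4
  have hGd : ∀ x ∈ e.target, HasFDerivAt (fun x ↦ e.symm x - P₀ (e.symm x))
      (fderiv ℝ e.symm x - P₀ ∘L fderiv ℝ e.symm x) x := fun x hx ↦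
    (hsd x hx).sub (P₀.hasFDerivAt.comp x (hsd x hx))
  -- G is the component of the straightening coordinates transverse to the range of P₀. Its
  -- differential kills v exactly when the straightened vector lies in the range of P₀, that is,
  -- when v is a column of L x.
  refine ⟨fun x ↦ e.symm x - P₀ (e.symm x), e.target, e.open_target, hx₀t, ?_, ?_, ?_, ?_⟩
  · intro x hx
    have h := (heU (e.map_target hx)).2
    rw [mem_preimage, ← hee, e.right_inv hx] at h
    exact (hrO h).1
  · exact hes.sub (P₀.contDiff.comp_contDiffOn hes)
  · have h1 : fderiv ℝ e.symm x₀ = J := by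
      ext v
      have h := hcompd x₀ hx₀t v
      rw [hsx₀, hΨd.fderiv] at h
      exact h
    have h2 := hGd x₀ hx₀t
    rw [h1] at h2
    exact h2
  · intro x hx v
    rw [(hGd x hx).fderiv]
    change P₀ (fderiv ℝ e.symm x v - P₀ (fderiv ℝ e.symm x v)) = 0 ∧
      (fderiv ℝ e.symm x v - P₀ (fderiv ℝ e.symm x v) = 0 ↔ P x v = v)
    have hz := e.map_target hx
    have hxr : x ∈ Metric.ball x₀ r := by
      have h := (heU hz).2
      rwa [mem_preimage, ← hee, e.right_inv hx] at h
    have hΨz : Ψ (e.symm x) = x := by rw [← hee, e.right_inv hx]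
    have h1 := hΨL _ (heU hz).1
    rw [hΨz] at h1
    refine ⟨by rw [map_sub, hP₀, sub_self], fun h ↦ ?_, fun h ↦ ?_⟩
    · rw [sub_eq_zero] at h
      rw [← hcompd x hx v, h, h1, hL1 x hxr]
    · have h2 : fderiv ℝ Ψ (e.symm x) (fderiv ℝ e.symm x v) = fderiv ℝ Ψ (e.symm x) (P₀ v) := by
        rw [hcompd x hx, h1, hL3 x hxr v h]
      obtain ⟨A, hA⟩ := heinv _ hz
      rw [← hA] at h2
      have h3 : fderiv ℝ e.symm x v = P₀ v := A.injective h2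
      rw [h3, hP₀, sub_self]

/-- Two complementary involutive distributions are simultaneously straightened by a chart. -/
theorem IsInvolutiveOn.exists_product_chart {P : E → E →L[ℝ] E} {O : Set E} (hO : IsOpen O)
    (hP : ContDiffOn ℝ ∞ P O) (hPP : ∀ x ∈ O, ∀ v, P x (P x v) = P x v)
    (hinv : IsInvolutiveOn P O)
    (hinv' : IsInvolutiveOn (fun x ↦ ContinuousLinearMap.id ℝ E - P x) O) {x₀ : E} (hx₀ : x₀ ∈ O) :
    ∃ e : OpenPartialHomeomorph E E, x₀ ∈ e.source ∧ e.source ⊆ O ∧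
      ContDiffOn ℝ ∞ e e.source ∧ ContDiffOn ℝ ∞ e.symm e.target ∧
      ∀ x ∈ e.source, ∀ v, (P x₀ (fderiv ℝ e x v) = fderiv ℝ e x v ↔ P x v = v) ∧
        (P x₀ (fderiv ℝ e x v) = 0 ↔ P x v = 0) := by
  obtain ⟨G₁, U₁, hU₁, hx₁, hUO₁, hG₁, hd₁, hk₁⟩ := hinv.exists_ker_fderiv hO hP hPP hx₀
  obtain ⟨G₂, U₂, hU₂, hx₂, hUO₂, hG₂, hd₂, hk₂⟩ := hinv'.exists_ker_fderiv hO
    (contDiffOn_const.sub hP) (fun x hx v ↦ by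
      change (v - P x v) - P x (v - P x v) = v - P x v
      rw [map_sub, hPP x hx, sub_self, sub_zero]) hx₀
  -- The differential of G₁ takes values in the kernel of P x₀ and that of G₂ in its range. The sum
  -- thus keeps the two submersions apart, and its differential at x₀ is (1 - P x₀) + P x₀ = 1.
  have hG : ContDiffOn ℝ ∞ (fun x ↦ G₁ x + G₂ x) (U₁ ∩ U₂) :=
    (hG₁.mono inter_subset_left).add (hG₂.mono inter_subset_right)
  have hd : HasFDerivAt (fun x ↦ G₁ x + G₂ x)
      ((ContinuousLinearEquiv.refl ℝ E : E ≃L[ℝ] E) : E →L[ℝ] E) x₀ := by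
    convert! hd₁.add hd₂ using 1
    ext v
    change v = (v - P x₀ v) + (v - (v - P x₀ v))
    abel
  obtain ⟨e, he0, heU, hee, hes, -⟩ := hG.exists_openPartialHomeomorph (hU₁.inter hU₂) ⟨hx₁, hx₂⟩ hd
  have hee' : (e : E → E) = fun x ↦ G₁ x + G₂ x := funext hee
  refine ⟨e, he0, (heU.trans inter_subset_left).trans hUO₁, ?_, hes, fun x hx v ↦ ?_⟩
  · rw [hee']; exact hG.mono heU
  · have h1 := hk₁ x (heU hx).1 v
    have h2 := hk₂ x (heU hx).2 v
    have h3 : fderiv ℝ e x v = fderiv ℝ G₁ x v + fderiv ℝ G₂ x v := by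
      have hd1 := ((hG₁.contDiffAt (hU₁.mem_nhds (heU hx).1)).differentiableAt
        (by simp)).hasFDerivAt
      have hd2 := ((hG₂.contDiffAt (hU₂.mem_nhds (heU hx).2)).differentiableAt
        (by simp)).hasFDerivAt
      have hd3 : HasFDerivAt (fun x ↦ G₁ x + G₂ x) (fderiv ℝ G₁ x + fderiv ℝ G₂ x) x := hd1.add hd2
      rw [hee', hd3.fderiv]
      rfl
    change (fderiv ℝ G₂ x v - P x₀ (fderiv ℝ G₂ x v) = 0) ∧
      (fderiv ℝ G₂ x v = 0 ↔ v - P x v = v) at h2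
    have h4 := sub_eq_zero.1 h2.1
    rw [h3, map_add, h1.1, ← h4, zero_add]
    refine ⟨?_, ?_⟩
    · rw [← h1.2]
      exact ⟨fun h ↦ by simpa using h, fun h ↦ by rw [h, zero_add]⟩
    · rw [h2.2]
      simp
end Frobenius

/-! ## Vector fields in coordinates -/

section Coordinates

variable {E : Type*} [NormedAddCommGroup E] [NormedSpace ℝ E]
  {M : Type*} [TopologicalSpace M] [ChartedSpace E M]
  {V : Type*} [NormedAddCommGroup V] [NormedSpace ℝ V]

theorem mvfderiv_congr_of_eventuallyEq {F : Type*} [NormedAddCommGroup F] [NormedSpace ℝ F]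
    {f f' : M → F} {p : M} (h : f =ᶠ[𝓝 p] f') :
    mvfderiv 𝓘(ℝ, E) f p = mvfderiv 𝓘(ℝ, E) f' p := by
  ext v
  exact congrArg (fun L : E →L[ℝ] F ↦ L v) h.mfderiv_eq

namespace PartialDiffeomorph

variable (e : PartialDiffeomorph 𝓘(ℝ, E) 𝓘(ℝ, V) M V ∞)

omit e in
theorem contMDiffAt {E M F N : Type*} [NormedAddCommGroup E] [NormedSpace ℝ E]
    [TopologicalSpace M] [ChartedSpace E M] [NormedAddCommGroup F] [NormedSpace ℝ F]
    [TopologicalSpace N] [ChartedSpace F N] (e : PartialDiffeomorph 𝓘(ℝ, E) 𝓘(ℝ, F) M N ∞)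
    {q : M} (hq : q ∈ e.source) : CMDiffAt ∞ e q :=
  (e.contMDiffOn q hq).contMDiffAt (e.open_source.mem_nhds hq)

theorem isInvertible_mfderiv {q : M} (hq : q ∈ e.source) :
    (mfderiv 𝓘(ℝ, E) 𝓘(ℝ, V) e q).IsInvertible :=
  ⟨(PartialDiffeomorph.isLocalDiffeomorphAt _ _ _ e hq).mfderivToContinuousLinearEquiv (by simp), rfl⟩

/-- The vector field on the manifold with components `ξ` in the coordinates `e`. -/
def field (ξ : V → V) (q : M) : TangentSpace 𝓘(ℝ, E) q :=
  (mfderiv 𝓘(ℝ, E) 𝓘(ℝ, V) e q).inverse (ξ (e q))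

variable {e}

theorem mfderiv_field (ξ : V → V) {q : M} (hq : q ∈ e.source) :
    mfderiv 𝓘(ℝ, E) 𝓘(ℝ, V) e q (e.field ξ q) = ξ (e q) := by
  obtain ⟨A, hA⟩ := e.isInvertible_mfderiv hq
  simp only [field]
  rw [← hA, ContinuousLinearMap.inverse_equiv]
  exact A.apply_symm_apply _

theorem field_mfderiv {q : M} (hq : q ∈ e.source) (v : TangentSpace 𝓘(ℝ, E) q) {ξ : V → V}
    (hξ : ξ (e q) = mfderiv 𝓘(ℝ, E) 𝓘(ℝ, V) e q v) : e.field ξ q = v := by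
  obtain ⟨A, hA⟩ := e.isInvertible_mfderiv hq
  apply A.injective
  have h := mfderiv_field ξ hq
  rw [hξ, ← hA] at h
  exact h

theorem mvfderiv_comp {F : Type*} [NormedAddCommGroup F] [NormedSpace ℝ F] {f : M → F} {fh : V → F}
    {q : M} (hq : q ∈ e.source) (hfh : DifferentiableAt ℝ fh (e q))
    (hf : ∀ᶠ y in 𝓝 q, f y = fh (e y)) (v : TangentSpace 𝓘(ℝ, E) q) :
    mvfderiv 𝓘(ℝ, E) f q v = fderiv ℝ fh (e q) (mfderiv 𝓘(ℝ, E) 𝓘(ℝ, V) e q v) := by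
  rw [mvfderiv_congr_of_eventuallyEq (f' := fh ∘ e) hf]
  have h1 : MDifferentiableAt 𝓘(ℝ, V) 𝓘(ℝ, F) fh (e q) := hfh.mdifferentiableAt
  have h2 := mfderiv_comp_apply q h1 (e.mdifferentiableAt (by simp) hq) v
  rw [mfderiv_eq_fderiv] at h2
  exact h2

variable [IsManifold 𝓘(ℝ, E) ∞ M] [FiniteDimensional ℝ E]

theorem _root_.ContDiffAt.contMDiffAt_vectorField {ξ : Π x : V, TangentSpace 𝓘(ℝ, V) x} {x : V}
    (hξ : ContDiffAt ℝ ∞ (fun y ↦ (ξ y : V)) x) : CMDiffAt ∞ (T% ξ) x :=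
  contMDiffAt_vectorSpace_iff_contDiffAt.2 hξ

theorem _root_.DifferentiableAt.mdifferentiableAt_vectorField
    {ξ : Π x : V, TangentSpace 𝓘(ℝ, V) x} {x : V}
    (hξ : DifferentiableAt ℝ (fun y ↦ (ξ y : V)) x) : MDiffAt (T% ξ) x := by
  rw [mdifferentiableAt_totalSpace]
  refine ⟨mdifferentiableAt_id, ?_⟩
  simpa using! hξ.mdifferentiableAt

theorem contMDiffAt_field {ξ : V → V} {q : M} (hq : q ∈ e.source) (hξ : ContDiffAt ℝ ∞ ξ (e q)) :
    CMDiffAt ∞ (T% (e.field ξ)) q :=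
  ContMDiffAt.mpullback_vectorField_preimage
    (ContDiffAt.contMDiffAt_vectorField (ξ := (ξ : Π x : V, TangentSpace 𝓘(ℝ, V) x)) hξ)
    (e.contMDiffAt hq) (e.isInvertible_mfderiv hq) (by simp)

theorem mdifferentiableAt_field {ξ : V → V} {q : M} (hq : q ∈ e.source)
    (hξ : DifferentiableAt ℝ ξ (e q)) : MDiffAt (T% (e.field ξ)) q :=
  MDifferentiableAt.mpullback_vectorField (n := ∞)
    (DifferentiableAt.mdifferentiableAt_vectorField
      (ξ := (ξ : Π x : V, TangentSpace 𝓘(ℝ, V) x)) hξ)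
    (e.contMDiffAt hq) (e.isInvertible_mfderiv hq) (by norm_cast)

theorem _root_.mlieBracket_eq_lieBracket (ξ η : Π x : V, TangentSpace 𝓘(ℝ, V) x) :
    mlieBracket 𝓘(ℝ, V) ξ η = lieBracket ℝ ξ η := by
  rw [← mlieBracketWithin_univ, mlieBracketWithin_eq_lieBracketWithin]
  exact lieBracketWithin_univ

theorem mlieBracket_field {ξ η : V → V} {q : M} (hq : q ∈ e.source)
    (hξ : DifferentiableAt ℝ ξ (e q)) (hη : DifferentiableAt ℝ η (e q)) :
    mlieBracket 𝓘(ℝ, E) (e.field ξ) (e.field η) q =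
      e.field (fun x ↦ fderiv ℝ η x (ξ x) - fderiv ℝ ξ x (η x)) q := by
  have : IsManifold 𝓘(ℝ, E) (minSmoothness ℝ 2) M := IsManifold.of_le (n := ∞) (by simp; norm_cast)
  have h1 := mpullback_mlieBracket (I := 𝓘(ℝ, E)) (n := ∞)
    (DifferentiableAt.mdifferentiableAt_vectorField
      (ξ := (ξ : Π x : V, TangentSpace 𝓘(ℝ, V) x)) hξ)
    (DifferentiableAt.mdifferentiableAt_vectorField
      (ξ := (η : Π x : V, TangentSpace 𝓘(ℝ, V) x)) hη) (e.contMDiffAt hq) (by simp; norm_cast)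
  refine h1.symm.trans ?_
  have h2 := mlieBracket_eq_lieBracket (ξ : Π x : V, TangentSpace 𝓘(ℝ, V) x) η
  simp only [mpullback_apply]
  exact congrArg (fun X : V → V ↦ (mfderiv 𝓘(ℝ, E) 𝓘(ℝ, V) e q).inverse (X (e q))) h2

theorem mlieBracket_field_const (w w' : V) {q : M} (hq : q ∈ e.source) :
    mlieBracket 𝓘(ℝ, E) (e.field fun _ ↦ w) (e.field fun _ ↦ w') q = 0 := by
  rw [mlieBracket_field hq (by fun_prop) (by fun_prop)]
  refine field_mfderiv hq _ ?_
  simp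
  rfl

omit [IsManifold 𝓘(ℝ, E) ∞ M] [FiniteDimensional ℝ E] in
theorem contDiffAt_comp_symm {F : Type*} [NormedAddCommGroup F] [NormedSpace ℝ F]
    {f : M → F} {q : M} (hq : q ∈ e.source) (hf : CMDiffAt ∞ f q) :
    ContDiffAt ℝ ∞ (fun x ↦ f (e.symm x)) (e q) := by
  have hs : ContMDiffAt 𝓘(ℝ, V) 𝓘(ℝ, E) ∞ e.symm (e q) := e.symm.contMDiffAt (e.map_source hq)
  have h : e.symm (e q) = q := e.left_inv hq
  rw [← h] at hf
  exact (ContMDiffAt.comp (e q) hf hs).contDiffAt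

omit [IsManifold 𝓘(ℝ, E) ∞ M] [FiniteDimensional ℝ E] in
theorem mvfderiv_eq_fderiv {F : Type*} [NormedAddCommGroup F] [NormedSpace ℝ F]
    {f : M → F} {q : M} (hq : q ∈ e.source) (hf : CMDiffAt ∞ f q) (v : TangentSpace 𝓘(ℝ, E) q) :
    mvfderiv 𝓘(ℝ, E) f q v =
      fderiv ℝ (fun x ↦ f (e.symm x)) (e q) (mfderiv 𝓘(ℝ, E) 𝓘(ℝ, V) e q v) := by
  refine mvfderiv_comp hq ((contDiffAt_comp_symm hq hf).differentiableAt (by simp)) ?_ v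
  filter_upwards [e.open_source.mem_nhds hq] with y hy
  exact congrArg f (e.left_inv hy).symm

omit [IsManifold 𝓘(ℝ, E) ∞ M] [FiniteDimensional ℝ E] in
/-- Mixed derivatives along coordinate fields commute. -/
theorem mvfderiv_mvfderiv_field_comm {F : Type*} [NormedAddCommGroup F] [NormedSpace ℝ F]
    {f : M → F} {q : M} (hq : q ∈ e.source) (hf : ∀ᶠ y in 𝓝 q, CMDiffAt ∞ f y) (w w' : V) :
    mvfderiv 𝓘(ℝ, E) (fun y ↦ mvfderiv 𝓘(ℝ, E) f y (e.field (fun _ ↦ w) y)) q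
        (e.field (fun _ ↦ w') q) =
      mvfderiv 𝓘(ℝ, E) (fun y ↦ mvfderiv 𝓘(ℝ, E) f y (e.field (fun _ ↦ w') y)) q
        (e.field (fun _ ↦ w) q) := by
  set fh : V → F := fun x ↦ f (e.symm x)
  have hfh : ContDiffAt ℝ ∞ fh (e q) := contDiffAt_comp_symm hq hf.self_of_nhds
  have hd : DifferentiableAt ℝ (fderiv ℝ fh) (e q) :=
    (hfh.fderiv_right (m := 1) (by norm_cast)).differentiableAt (by simp)
  have key : ∀ w w' : V,
      mvfderiv 𝓘(ℝ, E) (fun y ↦ mvfderiv 𝓘(ℝ, E) f y (e.field (fun _ ↦ w) y)) q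
        (e.field (fun _ ↦ w') q) = fderiv ℝ (fderiv ℝ fh) (e q) w' w := by
    intro w w'
    rw [mvfderiv_comp (fh := fun x ↦ fderiv ℝ fh x w) hq (hd.clm_apply (by fun_prop)),
      mfderiv_field _ hq, fderiv_clm_apply hd (by fun_prop)]
    · simp
    · filter_upwards [e.open_source.mem_nhds hq, hf] with y hy hfy
      rw [mvfderiv_eq_fderiv hy hfy, mfderiv_field _ hy]
  rw [key, key]
  exact hfh.isSymmSndFDerivAt (by simp; norm_cast) w' w

end PartialDiffeomorph

/-- The preferred chart at a point as a partial diffeomorphism. -/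
def chartDiffeomorph [IsManifold 𝓘(ℝ, E) ∞ M] (p : M) :
    PartialDiffeomorph 𝓘(ℝ, E) 𝓘(ℝ, E) M E ∞ where
  toPartialEquiv := (chartAt E p).toPartialEquiv
  open_source := (chartAt E p).open_source
  open_target := (chartAt E p).open_target
  contMDiffOn_toFun := contMDiffOn_chart
  contMDiffOn_invFun := contMDiffOn_chart_symm

theorem mem_chartDiffeomorph_source [IsManifold 𝓘(ℝ, E) ∞ M] (p : M) :
    p ∈ (chartDiffeomorph (E := E) p).source := mem_chart_source E p

variable [IsManifold 𝓘(ℝ, E) ∞ M]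

theorem trivializationAt_eq_mfderiv {p q : M} (hq : q ∈ (chartAt E p).source)
    (v : TangentSpace 𝓘(ℝ, E) q) :
    (trivializationAt E (TangentSpace 𝓘(ℝ, E) : M → Type _) p ⟨q, v⟩).2 =
      mvfderiv 𝓘(ℝ, E) (chartAt E p) q v := by
  have h := TangentBundle.continuousLinearMapAt_trivializationAt (I := 𝓘(ℝ, E)) hq
  have h2 := congrArg (fun L : E →L[ℝ] E ↦ L v) h
  have h3 : q ∈ (trivializationAt E (TangentSpace 𝓘(ℝ, E) : M → Type _) p).baseSet := by
    simpa using hq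
  have h4 := congrFun (Trivialization.coe_linearMapAt_of_mem (R := ℝ)
    (trivializationAt E (TangentSpace 𝓘(ℝ, E) : M → Type _) p) h3) v
  exact h4.symm.trans h2

/-- The canonical extension of a tangent vector has constant components in the preferred chart;
brackets of such extensions can therefore be computed in coordinates, where they vanish. -/
theorem extend_eq_field {p q : M} (hq : q ∈ (chartAt E p).source)
    (v : TangentSpace 𝓘(ℝ, E) p) :
    extend E v q = (chartDiffeomorph p).field
      (fun _ ↦ (trivializationAt E (TangentSpace 𝓘(ℝ, E) : M → Type _) p ⟨p, v⟩).2) q := by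
  have h3 : q ∈ (trivializationAt E (TangentSpace 𝓘(ℝ, E) : M → Type _) p).baseSet := by
    simpa using hq
  refine (PartialDiffeomorph.field_mfderiv (e := chartDiffeomorph p) hq _ ?_).symm
  have h := trivializationAt_eq_mfderiv hq (extend E v q)
  rw [extend, Trivialization.apply_mk_symm _ h3] at h
  exact h

theorem mlieBracket_extend [FiniteDimensional ℝ E] {p : M} (v w : TangentSpace 𝓘(ℝ, E) p) :
    mlieBracket 𝓘(ℝ, E) (extend E v) (extend E w) p = 0 := by
  have h : ∀ v : TangentSpace 𝓘(ℝ, E) p, 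
      (extend E v : Π q : M, TangentSpace 𝓘(ℝ, E) q) =ᶠ[𝓝 p] (chartDiffeomorph p).field
      (fun _ ↦ (trivializationAt E (TangentSpace 𝓘(ℝ, E) : M → Type _) p ⟨p, v⟩).2) := fun v ↦ by
    filter_upwards [(chartAt E p).open_source.mem_nhds (mem_chart_source E p)] with q hq
    exact extend_eq_field hq v
  rw [(h v).mlieBracket_vectorField_eq (h w)]
  exact PartialDiffeomorph.mlieBracket_field_const _ _ (mem_chartDiffeomorph_source p)

end Coordinates

/-! ## The connection along an isometric immersion -/

section Along

set_option linter.unusedSectionVars false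

variable {E : Type*} [NormedAddCommGroup E] [NormedSpace ℝ E] [FiniteDimensional ℝ E]
  {M : Type*} [TopologicalSpace M] [ChartedSpace E M] [IsManifold 𝓘(ℝ, E) ∞ M]
  {E' : Type*} [NormedAddCommGroup E'] [NormedSpace ℝ E'] [FiniteDimensional ℝ E']
  {N : Type*} [TopologicalSpace N] [ChartedSpace E' N] [IsManifold 𝓘(ℝ, E') ∞ N]

theorem IsLocallyProduct.mdifferentiableAt_apply {gN : RiemMetric E' N}
    {F : Π x : N, TangentSpace 𝓘(ℝ, E') x →L[ℝ] TangentSpace 𝓘(ℝ, E') x}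
    (hF : IsLocallyProduct gN F) {Y : Π x : N, TangentSpace 𝓘(ℝ, E') x} {x : N}
    (hY : MDiffAt (T% Y) x) : MDiffAt (T% (fun x ↦ F x (Y x))) x :=
  MDifferentiableAt.clm_bundle_apply (F₁ := E') (F₂ := E')
    (hF.smooth.mdifferentiableAt (by simp)) hY

namespace IsometricImmersion

variable {gM : RiemMetric E M} {gN : RiemMetric E' N} (φ : IsometricImmersion gM gN) {p : M}

theorem mdifferentiableAt_toFun : MDiffAt φ.toFun p := φ.contMDiff.mdifferentiableAt (by simp)

theorem eventually_mem_baseSet :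
    ∀ᶠ q in 𝓝 p, φ.toFun q ∈ (trivializationAt E' (TangentSpace 𝓘(ℝ, E') : N → Type _)
      (φ.toFun p)).baseSet :=
  φ.contMDiff.continuous.continuousAt.eventually
    ((trivializationAt E' (TangentSpace 𝓘(ℝ, E') : N → Type _)
      (φ.toFun p)).open_baseSet.mem_nhds (FiberBundle.mem_baseSet_trivializationAt' _))

theorem covAlong_congr {s s' : Π q : M, TangentSpace 𝓘(ℝ, E') (φ.toFun q)}
    (h : ∀ᶠ q in 𝓝 p, s q = s' q) (u : TangentSpace 𝓘(ℝ, E) p) :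
    φ.covAlong s p u = φ.covAlong s' p u := by
  have h1 : φ.coord p s =ᶠ[𝓝 p] φ.coord p s' := by
    filter_upwards [h] with q hq
    simp only [coord, hq]
  rw [covAlong, covAlong, mvfderiv_congr h1, h.self_of_nhds]

theorem mdifferentiableAt_coord_comp {Y : Π x : N, TangentSpace 𝓘(ℝ, E') x}
    (hY : MDiffAt (T% Y) (φ.toFun p)) : MDiffAt (φ.coord p fun q ↦ Y (φ.toFun q)) p := by
  rw [mdifferentiableAt_totalSpace] at hY
  exact hY.2.comp p φ.mdifferentiableAt_toFun

theorem mdifferentiableAt_coord_congr {s s' : Π q : M, TangentSpace 𝓘(ℝ, E') (φ.toFun q)}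
    (h : ∀ᶠ q in 𝓝 p, s q = s' q) (hs : MDiffAt (φ.coord p s) p) : MDiffAt (φ.coord p s') p := by
  refine hs.congr_of_eventuallyEq ?_
  filter_upwards [h] with q hq
  simp only [coord, hq]

theorem mdifferentiableAt_coord_add {s s' : Π q : M, TangentSpace 𝓘(ℝ, E') (φ.toFun q)}
    (hs : MDiffAt (φ.coord p s) p) (hs' : MDiffAt (φ.coord p s') p) :
    MDiffAt (φ.coord p (s + s')) p :=
  (hs.add hs').congr_of_eventuallyEq (φ.coord_add p s s')

theorem mdifferentiableAt_coord_smul {f : M → ℝ} (hf : MDiffAt f p)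
    {s : Π q : M, TangentSpace 𝓘(ℝ, E') (φ.toFun q)}
    (hs : MDiffAt (φ.coord p s) p) : MDiffAt (φ.coord p (f • s)) p :=
  (hf.smul hs).congr_of_eventuallyEq (φ.coord_smul p f s)

/-- Induction principle for differentiable sections of the pulled back tangent bundle. -/
theorem along_induction {Pr : (Π q : M, TangentSpace 𝓘(ℝ, E') (φ.toFun q)) → Prop}
    (hcongr : ∀ s s', (∀ᶠ q in 𝓝 p, s q = s' q) → Pr s → Pr s')
    (hsmul : ∀ (f : M → ℝ) (Y : Π x : N, TangentSpace 𝓘(ℝ, E') x), MDiffAt f p →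
      MDiffAt (T% Y) (φ.toFun p) → Pr (f • fun q ↦ Y (φ.toFun q)))
    (hadd : ∀ s s', MDiffAt (φ.coord p s) p → MDiffAt (φ.coord p s') p → Pr s → Pr s' →
      Pr (s + s'))
    {s : Π q : M, TangentSpace 𝓘(ℝ, E') (φ.toFun q)} (hs : MDiffAt (φ.coord p s) p) : Pr s := by
  let t := trivializationAt E' (TangentSpace 𝓘(ℝ, E') : N → Type _) (φ.toFun p)
  let b := Module.finBasis ℝ E'
  -- Near p a section of the pulled back bundle is the sum of the `c i` times the restrictions of
  -- the ambient fields `Y i`, which have constant components in the trivialization around φ p.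
  let Y : Fin (Module.finrank ℝ E') → Π x : N, TangentSpace 𝓘(ℝ, E') x :=
    fun i ↦ extend E' (t.symm (φ.toFun p) (b i))
  let c : Fin (Module.finrank ℝ E') → M → ℝ := fun i q ↦ b.coord i (φ.coord p s q)
  have hc : ∀ i, MDiffAt (c i) p := fun i ↦
    ((LinearMap.toContinuousLinearMap (b.coord i)).mdifferentiableAt).comp p hs
  have hY : ∀ i, MDiffAt (T% (Y i)) (φ.toFun p) := fun i ↦ mdifferentiableAt_extend 𝓘(ℝ, E') E' _
  have hsum : ∀ I : Finset (Fin (Module.finrank ℝ E')),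
      MDiffAt (φ.coord p (∑ i ∈ I, c i • fun q ↦ Y i (φ.toFun q))) p ∧
        Pr (∑ i ∈ I, c i • fun q ↦ Y i (φ.toFun q)) := by
    classical
    intro I
    induction I using Finset.induction_on with
    | empty =>
      have h0 : ((0 : M → ℝ) • fun q ↦ (0 : Π x : N, TangentSpace 𝓘(ℝ, E') x) (φ.toFun q)) =
          (0 : Π q : M, TangentSpace 𝓘(ℝ, E') (φ.toFun q)) := by
        funext q; simp
      have hz : MDiffAt (T% (0 : Π x : N, TangentSpace 𝓘(ℝ, E') x)) (φ.toFun p) :=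
        mdifferentiable_zeroSection ..
      have hf : MDiffAt (0 : M → ℝ) p := mdifferentiableAt_const
      rw [Finset.sum_empty, ← h0]
      exact ⟨φ.mdifferentiableAt_coord_smul hf (φ.mdifferentiableAt_coord_comp hz),
        hsmul _ _ hf hz⟩
    | insert a I ha ih =>
      rw [Finset.sum_insert ha]
      have h1 := φ.mdifferentiableAt_coord_smul (hc a) (φ.mdifferentiableAt_coord_comp (hY a))
      exact ⟨φ.mdifferentiableAt_coord_add h1 ih.1, hadd _ _ h1 ih.1 (hsmul _ _ (hc a) (hY a)) ih.2⟩
  refine hcongr _ _ ?_ (hsum Finset.univ).2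
  filter_upwards [φ.eventually_mem_baseSet (p := p)] with q hq
  have hp : φ.toFun p ∈ t.baseSet := FiberBundle.mem_baseSet_trivializationAt' _
  have hYq : ∀ i, Y i (φ.toFun q) = t.symmₗ ℝ (φ.toFun q) (b i) := fun i ↦ by
    simp only [Y, extend]
    rw [Trivialization.symmₗ_apply _ hq]
    congr 1
    exact congrArg Prod.snd (Trivialization.apply_mk_symm t hp (b i))
  have h1 : s q = t.symmₗ ℝ (φ.toFun q) (φ.coord p s q) := by
    rw [Trivialization.symmₗ_apply _ hq]
    exact (Trivialization.symm_apply_apply_mk _ hq _).symm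
  rw [h1]
  conv_rhs => rw [← b.sum_repr (φ.coord p s q)]
  simp only [map_sum, map_smul, Finset.sum_apply, Pi.smul_apply', hYq]
  rfl

/-- The connection along the immersion is metric. -/
theorem mvfderiv_inner_along {s s' : Π q : M, TangentSpace 𝓘(ℝ, E') (φ.toFun q)}
    (hs : MDiffAt (φ.coord p s) p) (hs' : MDiffAt (φ.coord p s') p) (u : TangentSpace 𝓘(ℝ, E) p) :
    MDiffAt (fun q ↦ gN.inner (φ.toFun q) (s q) (s' q)) p ∧
    mvfderiv 𝓘(ℝ, E) (fun q ↦ gN.inner (φ.toFun q) (s q) (s' q)) p u =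
      gN.inner (φ.toFun p) (φ.covAlong s p u) (s' p) +
        gN.inner (φ.toFun p) (s p) (φ.covAlong s' p u) := by
  -- Induction on s, with a nested one on s', leaves the case of multiples f • Y ∘ φ and f' • Y' ∘
  -- φ, where the claim follows from the product and chain rules and from metric compatibility on N.
  -- Differentiability is carried along because the sum rule needs it.
  refine φ.along_induction (p := p) (Pr := fun s ↦ ∀ s' : Π q : M, TangentSpace 𝓘(ℝ, E') (φ.toFun q),
    MDiffAt (φ.coord p s') p → MDiffAt (fun q ↦ gN.inner (φ.toFun q) (s q) (s' q)) p ∧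
    mvfderiv 𝓘(ℝ, E) (fun q ↦ gN.inner (φ.toFun q) (s q) (s' q)) p u =
      gN.inner (φ.toFun p) (φ.covAlong s p u) (s' p) +
        gN.inner (φ.toFun p) (s p) (φ.covAlong s' p u)) ?_ ?_ ?_ hs s' hs'
  · intro s₁ s₂ h ih s' hs'
    have h1 : (fun q ↦ gN.inner (φ.toFun q) (s₂ q) (s' q)) =ᶠ[𝓝 p]
        fun q ↦ gN.inner (φ.toFun q) (s₁ q) (s' q) := by
      filter_upwards [h] with q hq
      rw [hq]
    rw [mvfderiv_congr h1, (ih s' hs').2, φ.covAlong_congr h, h.self_of_nhds]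
    exact ⟨(ih s' hs').1.congr_of_eventuallyEq h1, rfl⟩
  · intro f Y hf hY s' hs'
    refine φ.along_induction (p := p) (Pr := fun s' : Π q : M, TangentSpace 𝓘(ℝ, E') (φ.toFun q) ↦
      MDiffAt (fun q ↦ gN.inner (φ.toFun q) ((f • fun q ↦ Y (φ.toFun q)) q) (s' q)) p ∧
      mvfderiv 𝓘(ℝ, E) (fun q ↦ gN.inner (φ.toFun q) ((f • fun q ↦ Y (φ.toFun q)) q) (s' q)) p u =
      gN.inner (φ.toFun p) (φ.covAlong (f • fun q ↦ Y (φ.toFun q)) p u) (s' p) +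
        gN.inner (φ.toFun p) ((f • fun q ↦ Y (φ.toFun q)) p) (φ.covAlong s' p u)) ?_ ?_ ?_ hs'
    · intro s₁ s₂ h ih
      have h1 : (fun q ↦ gN.inner (φ.toFun q) ((f • fun q ↦ Y (φ.toFun q)) q) (s₂ q)) =ᶠ[𝓝 p]
          fun q ↦ gN.inner (φ.toFun q) ((f • fun q ↦ Y (φ.toFun q)) q) (s₁ q) := by
        filter_upwards [h] with q hq
        rw [hq]
      rw [mvfderiv_congr h1, ih.2, φ.covAlong_congr h, h.self_of_nhds]
      exact ⟨ih.1.congr_of_eventuallyEq h1, rfl⟩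
    · intro f' Y' hf' hY'
      have hφ := φ.mdifferentiableAt_toFun (p := p)
      have hm := gN.mdifferentiableAt_inner hY hY'
      have hm' : MDiffAt (fun q ↦ gN.inner (φ.toFun q) (Y (φ.toFun q)) (Y' (φ.toFun q))) p :=
        hm.comp p hφ
      have h1 : (fun q ↦ gN.inner (φ.toFun q) ((f • fun q ↦ Y (φ.toFun q)) q)
          ((f' • fun q ↦ Y' (φ.toFun q)) q)) = fun q ↦ f q * (f' q *
            gN.inner (φ.toFun q) (Y (φ.toFun q)) (Y' (φ.toFun q))) := by
        funext q
        simp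
        ring
      have hm'' : MDiffAt (fun q ↦ f' q *
          gN.inner (φ.toFun q) (Y (φ.toFun q)) (Y' (φ.toFun q))) p := hf'.mul hm'
      have h2 : mvfderiv 𝓘(ℝ, E) (fun q ↦ gN.inner (φ.toFun q) (Y (φ.toFun q)) (Y' (φ.toFun q))) p u =
          mvfderiv 𝓘(ℝ, E') (fun x ↦ gN.inner x (Y x) (Y' x)) (φ.toFun p) (φ.d p u) :=
        mvfderiv_comp_apply p hm hφ u
      have hX := mdifferentiableAt_extend 𝓘(ℝ, E') E' (φ.d p u)
      have h3 := gN.leviCivita_metric hX hY hY'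
      rw [extend_apply_self] at h3
      rw [h1]
      refine ⟨hf.mul hm'', ?_⟩
      rw [mvfderiv_fun_mul hf hm'', mvfderiv_fun_mul hf' hm',
        φ.covAlong_smul hf (φ.mdifferentiableAt_coord_comp hY),
        φ.covAlong_smul hf' (φ.mdifferentiableAt_coord_comp hY'),
        φ.covAlong_comp hY, φ.covAlong_comp hY']
      simp [h2, h3]
      ring
    · intro s₁ s₂ hs₁ hs₂ ih₁ ih₂
      have h1 : (fun q ↦ gN.inner (φ.toFun q) ((f • fun q ↦ Y (φ.toFun q)) q) ((s₁ + s₂) q)) =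
          fun q ↦ gN.inner (φ.toFun q) ((f • fun q ↦ Y (φ.toFun q)) q) (s₁ q) +
            gN.inner (φ.toFun q) ((f • fun q ↦ Y (φ.toFun q)) q) (s₂ q) := by
        funext q
        rw [Pi.add_apply, map_add]
      rw [h1, mvfderiv_fun_add ih₁.1 ih₂.1, φ.covAlong_add hs₁ hs₂, add_apply, ih₁.2, ih₂.2,
        Pi.add_apply, map_add, map_add]
      exact ⟨ih₁.1.add ih₂.1, by ring⟩
  · intro s₁ s₂ hs₁ hs₂ ih₁ ih₂ s' hs'
    have h1 : (fun q ↦ gN.inner (φ.toFun q) ((s₁ + s₂) q) (s' q)) =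
        fun q ↦ gN.inner (φ.toFun q) (s₁ q) (s' q) + gN.inner (φ.toFun q) (s₂ q) (s' q) := by
      funext q
      rw [Pi.add_apply, map_add]; rfl
    obtain ⟨a1, a2⟩ := ih₁ s' hs'
    obtain ⟨b1, b2⟩ := ih₂ s' hs'
    rw [h1, mvfderiv_fun_add a1 b1, φ.covAlong_add hs₁ hs₂, add_apply, a2, b2,
      Pi.add_apply, map_add, map_add]
    refine ⟨a1.add b1, ?_⟩
    simp only [add_apply]
    ring

/-- On restrictions of ambient fields this is ∇̄F = 0; the general case follows because both sides
obey the same sum and Leibniz rules. -/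
theorem mdifferentiableAt_coord_F
    {F : Π x : N, TangentSpace 𝓘(ℝ, E') x →L[ℝ] TangentSpace 𝓘(ℝ, E') x}
    (hF : IsLocallyProduct gN F) {s : Π q : M, TangentSpace 𝓘(ℝ, E') (φ.toFun q)}
    (hs : MDiffAt (φ.coord p s) p) (u : TangentSpace 𝓘(ℝ, E) p) :
    MDiffAt (φ.coord p fun q ↦ F (φ.toFun q) (s q)) p ∧
      φ.covAlong (fun q ↦ F (φ.toFun q) (s q)) p u = F (φ.toFun p) (φ.covAlong s p u) := by
  refine φ.along_induction (p := p) (Pr := fun s ↦ MDiffAt (φ.coord p fun q ↦ F (φ.toFun q) (s q)) p ∧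
      φ.covAlong (fun q ↦ F (φ.toFun q) (s q)) p u = F (φ.toFun p) (φ.covAlong s p u))
      ?_ ?_ ?_ hs
  · intro s s' h ih
    have h' : ∀ᶠ q in 𝓝 p, F (φ.toFun q) (s q) = F (φ.toFun q) (s' q) := by
      filter_upwards [h] with q hq
      rw [hq]
    rw [← φ.covAlong_congr h', ← φ.covAlong_congr h]
    exact ⟨φ.mdifferentiableAt_coord_congr h' ih.1, ih.2⟩
  · intro f Y hf hY
    have hFY : MDiffAt (T% (fun x ↦ F x (Y x))) (φ.toFun p) := hF.mdifferentiableAt_apply hY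
    have h1 : (fun q ↦ F (φ.toFun q) ((f • fun q ↦ Y (φ.toFun q)) q)) =
        f • fun q ↦ (fun x ↦ F x (Y x)) (φ.toFun q) := by
      funext q
      exact map_smul (F (φ.toFun q)) _ _
    rw [h1, φ.covAlong_smul hf (φ.mdifferentiableAt_coord_comp hFY),
      φ.covAlong_smul hf (φ.mdifferentiableAt_coord_comp hY), φ.covAlong_comp hFY,
      φ.covAlong_comp hY, hF.parallel _ _ _ hY]
    refine ⟨φ.mdifferentiableAt_coord_smul hf (φ.mdifferentiableAt_coord_comp hFY), ?_⟩
    rw [map_add, map_smul, map_smul]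
  · intro s s' hs hs' ih ih'
    have h1 : (fun q ↦ F (φ.toFun q) ((s + s') q)) =
        (fun q ↦ F (φ.toFun q) (s q)) + fun q ↦ F (φ.toFun q) (s' q) := by
      funext q
      exact map_add (F (φ.toFun q)) _ _
    rw [h1, φ.covAlong_add ih.1 ih'.1, φ.covAlong_add hs hs', ih.2, ih'.2, map_add]
    exact ⟨φ.mdifferentiableAt_coord_add ih.1 ih'.1, rfl⟩

/-- Torsion-freeness along the immersion, on coordinate fields. -/
theorem covAlong_push_field_comm {V : Type*} [NormedAddCommGroup V] [NormedSpace ℝ V]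
    {e : PartialDiffeomorph 𝓘(ℝ, E) 𝓘(ℝ, V) M V ∞} (hp : p ∈ e.source) (w w' : V) :
    φ.covAlong (φ.push (e.field fun _ ↦ w)) p (e.field (fun _ ↦ w') p) =
      φ.covAlong (φ.push (e.field fun _ ↦ w')) p (e.field (fun _ ↦ w) p) := by
  have hψ : ∀ᶠ q in 𝓝 p, CMDiffAt ∞ (fun q ↦ chartAt E' (φ.toFun p) (φ.toFun q)) q := by
    filter_upwards [φ.contMDiff.continuous.continuousAt.eventually
      ((chartAt E' (φ.toFun p)).open_source.mem_nhds (mem_chart_source E' _))] with q hq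
    exact ContMDiffAt.comp q ((chartDiffeomorph (φ.toFun p)).contMDiffAt hq) φ.contMDiff.contMDiffAt
  have hcoord : ∀ X : Π q : M, TangentSpace 𝓘(ℝ, E) q, φ.coord p (φ.push X) =ᶠ[𝓝 p]
      fun q ↦ mvfderiv 𝓘(ℝ, E) (fun q ↦ chartAt E' (φ.toFun p) (φ.toFun q)) q (X q) := by
    intro X
    filter_upwards [φ.contMDiff.continuous.continuousAt.eventually
      ((chartAt E' (φ.toFun p)).open_source.mem_nhds (mem_chart_source E' _))] with q hq
    have h1 : φ.coord p (φ.push X) q = mvfderiv 𝓘(ℝ, E') (chartAt E' (φ.toFun p)) (φ.toFun q)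
      (φ.push X q) := trivializationAt_eq_mfderiv hq _
    rw [h1]
    exact (mfderiv_comp_apply q ((chartDiffeomorph (φ.toFun p)).mdifferentiableAt (by simp) hq)
      φ.mdifferentiableAt_toFun (X q)).symm
  have h1 := PartialDiffeomorph.mvfderiv_mvfderiv_field_comm hp hψ w w'
  have hv := mdifferentiableAt_extend 𝓘(ℝ, E') E' (φ.push (e.field fun _ ↦ w) p)
  have hw := mdifferentiableAt_extend 𝓘(ℝ, E') E' (φ.push (e.field fun _ ↦ w') p)
  have h2 := gN.leviCivita.torsion_eq_zero_iff.1 gN.leviCivita_torsion hv hw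
  rw [mlieBracket_extend, sub_eq_zero, extend_apply_self, extend_apply_self] at h2
  -- In the chart the components of dφ(X) are the derivative of the coordinates of φ along X. The
  -- first terms agree by symmetry of second derivatives, the second terms by torsion-freeness of
  -- the ambient connection on commuting extensions.
  rw [covAlong, covAlong, mvfderiv_congr (hcoord _), mvfderiv_congr (hcoord _), h1]
  congr 1
  exact h2.symm

theorem inner_tan (w : TangentSpace 𝓘(ℝ, E') (φ.toFun p)) (v : TangentSpace 𝓘(ℝ, E) p) :
    gM.inner p (φ.tan p w) v = gN.inner (φ.toFun p) w (φ.d p v) := by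
  simp only [tan, LinearMap.comp_apply, LinearEquiv.coe_coe, RiemMetric.inner_sharp]
  rfl

theorem inner_d (u v : TangentSpace 𝓘(ℝ, E) p) :
    gN.inner (φ.toFun p) (φ.d p u) (φ.d p v) = gM.inner p u v := φ.isometric p u v

theorem exists_coordinate_field (v : TangentSpace 𝓘(ℝ, E) p) :
    ∃ w : E, (chartDiffeomorph p).field (fun _ ↦ w) p = v :=
  ⟨mfderiv 𝓘(ℝ, E) 𝓘(ℝ, E) (chartDiffeomorph p) p v,
    PartialDiffeomorph.field_mfderiv (mem_chartDiffeomorph_source p) v rfl⟩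

theorem mdifferentiableAt_coordinate_field (w : E) :
    MDiffAt (T% ((chartDiffeomorph p).field (fun _ ↦ w))) p :=
  PartialDiffeomorph.mdifferentiableAt_field (mem_chartDiffeomorph_source p) (by fun_prop)

theorem sff_apply {V : Π q : M, TangentSpace 𝓘(ℝ, E) q} (hV : MDiffAt (T% V) p)
    (u : TangentSpace 𝓘(ℝ, E) p) :
    φ.sff p u (V p) = φ.nor p (φ.covAlong (φ.push V) p u) :=
  TensorialAt.mkHom_apply _ hV

/-- Both vectors extend to coordinate fields, for which ∇̄ along the immersion is symmetric. -/
theorem sff_symm (u v : TangentSpace 𝓘(ℝ, E) p) : φ.sff p u v = φ.sff p v u := by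
  obtain ⟨w, rfl⟩ := exists_coordinate_field u
  obtain ⟨w', rfl⟩ := exists_coordinate_field v
  rw [φ.sff_apply (mdifferentiableAt_coordinate_field w'),
    φ.sff_apply (mdifferentiableAt_coordinate_field w),
    φ.covAlong_push_field_comm (mem_chartDiffeomorph_source p)]

theorem covAlong_push_smul {f : M → ℝ} {Y : Π q : M, TangentSpace 𝓘(ℝ, E) q} (hf : MDiffAt f p)
    (hY : MDiffAt (T% Y) p) (u : TangentSpace 𝓘(ℝ, E) p) :
    φ.covAlong (φ.push (f • Y)) p u =
      f p • φ.covAlong (φ.push Y) p u + mvfderiv 𝓘(ℝ, E) f p u • φ.d p (Y p) := by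
  have h : φ.push (f • Y) = f • φ.push Y := by
    funext q; exact map_smul (φ.d q) (f q) (Y q)
  rw [h, φ.covAlong_smul hf (φ.mdifferentiableAt_coord_push hY)]
  rfl

theorem covAlong_push_add {Y Y' : Π q : M, TangentSpace 𝓘(ℝ, E) q}
    (hY : MDiffAt (T% Y) p) (hY' : MDiffAt (T% Y') p) (u : TangentSpace 𝓘(ℝ, E) p) :
    φ.covAlong (φ.push (Y + Y')) p u = φ.covAlong (φ.push Y) p u + φ.covAlong (φ.push Y') p u := by
  have h : φ.push (Y + Y') = φ.push Y + φ.push Y' := by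
    funext q; exact map_add (φ.d q) (Y q) (Y' q)
  rw [h, φ.covAlong_add (φ.mdifferentiableAt_coord_push hY) (φ.mdifferentiableAt_coord_push hY')]

/-- The Gauss formula. -/
theorem tan_covAlong_push {Y : Π q : M, TangentSpace 𝓘(ℝ, E) q} (hY : MDiffAt (T% Y) p)
    (u : TangentSpace 𝓘(ℝ, E) p) :
    φ.tan p (φ.covAlong (φ.push Y) p u) = gM.leviCivita Y p u := by
  -- The derivative terms of the two Leibniz rules cancel, so the difference depends only on Y p and
  -- the field may be replaced by a coordinate field.
  have ht : TensorialAt 𝓘(ℝ, E) E (fun Y ↦ φ.tan p (φ.covAlong (φ.push Y) p u) -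
      gM.leviCivita Y p u) p :=
    { smul := fun {f Y} hf hY ↦ by
        have h2 := gM.leviCivita.isCovariantDerivativeOn.leibniz (s := Set.univ) hY hf
        rw [φ.covAlong_push_smul hf hY, h2, map_add, map_smul, map_smul, φ.tan_d]
        simp only [add_apply, smul_apply, ContinuousLinearMap.smulRight_apply, smul_sub]
        abel
      add := fun {Y Y'} hY hY' ↦ by
        have h2 := gM.leviCivita.isCovariantDerivativeOn.add (s := Set.univ) hY hY'
        rw [φ.covAlong_push_add hY hY', h2, map_add]
        simp only [add_apply]
        abel }
  obtain ⟨w, hw⟩ := exists_coordinate_field (Y p)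
  have h0 := ht.pointwise hY (mdifferentiableAt_coordinate_field w) hw.symm
  rw [← sub_eq_zero]
  refine h0.trans (sub_eq_zero.2 ?_)
  obtain ⟨w₁, rfl⟩ := exists_coordinate_field u
  refine gM.ext_inner p fun v ↦ ?_
  obtain ⟨w₂, rfl⟩ := exists_coordinate_field v
  have hp := mem_chartDiffeomorph_source (E := E) p
  have hX := fun w ↦ mdifferentiableAt_coordinate_field (E := E) (p := p) w
  generalize chartDiffeomorph (E := E) p = e at *
  have hi : ∀ w w' w'' : E, mvfderiv 𝓘(ℝ, E) (fun q ↦ gM.inner q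
      (e.field (fun _ ↦ w) q) (e.field (fun _ ↦ w') q)) p (e.field (fun _ ↦ w'') p) =
      gN.inner (φ.toFun p) (φ.covAlong (φ.push (e.field (fun _ ↦ w))) p (e.field (fun _ ↦ w'') p))
        (φ.push (e.field (fun _ ↦ w')) p) + gN.inner (φ.toFun p) (φ.push (e.field (fun _ ↦ w)) p)
        (φ.covAlong (φ.push (e.field (fun _ ↦ w'))) p (e.field (fun _ ↦ w'') p)) :=
    fun w w' w'' ↦ by
      have h1 : (fun q ↦ gM.inner q (e.field (fun _ ↦ w) q) (e.field (fun _ ↦ w') q)) =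
          fun q ↦ gN.inner (φ.toFun q) (φ.push (e.field (fun _ ↦ w)) q)
            (φ.push (e.field (fun _ ↦ w')) q) := by
        funext q
        exact (φ.inner_d _ _).symm
      rw [h1]
      exact (φ.mvfderiv_inner_along (φ.mdifferentiableAt_coord_push (hX w))
        (φ.mdifferentiableAt_coord_push (hX w')) _).2
  -- On coordinate fields the brackets in the Koszul formula vanish; expanding the remaining terms
  -- by metricity along φ and using the symmetry of `covAlong` leaves twice the required inner
  -- product.
  have hk := gM.inner_nabla (hX w₁) (hX w) (hX w₂)
  change 2 * gM.inner p (gM.leviCivita _ p _) _ = _ at hk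
  rw [RiemMetric.koszul, hi, hi, hi, PartialDiffeomorph.mlieBracket_field_const _ _ hp,
    PartialDiffeomorph.mlieBracket_field_const _ _ hp,
    PartialDiffeomorph.mlieBracket_field_const _ _ hp,
    φ.covAlong_push_field_comm hp w w₂, φ.covAlong_push_field_comm hp w₁ w,
    φ.covAlong_push_field_comm hp w₁ w₂] at hk
  have hs := fun a b ↦ gN.symm (φ.toFun p) (φ.push (e.field (fun _ ↦ a)) p) b
  rw [φ.inner_tan]
  simp only [hs, map_zero, zero_apply] at hk
  have : φ.d p (e.field (fun _ ↦ w₂) p) =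
    φ.push (e.field (fun _ ↦ w₂)) p := rfl
  rw [this]
  linarith

end IsometricImmersion
end Along

/-! ## The eigenspaces of `T²` -/

section Eigenspaces

set_option linter.unusedSectionVars false

variable {E : Type*} [NormedAddCommGroup E] [NormedSpace ℝ E] [FiniteDimensional ℝ E]
  {M : Type*} [TopologicalSpace M] [ChartedSpace E M] [IsManifold 𝓘(ℝ, E) ∞ M]
  {E' : Type*} [NormedAddCommGroup E'] [NormedSpace ℝ E'] [FiniteDimensional ℝ E']
  {N : Type*} [TopologicalSpace N] [ChartedSpace E' N] [IsManifold 𝓘(ℝ, E') ∞ N]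
  {gM : RiemMetric E M} {gN : RiemMetric E' N}
  {F : Π x : N, TangentSpace 𝓘(ℝ, E') x →L[ℝ] TangentSpace 𝓘(ℝ, E') x}

/-- An isometric involution is self-adjoint. T, being the tangential compression of F, inherits
this. -/
theorem IsLocallyProduct.inner_left (hF : IsLocallyProduct gN F) (x : N)
    (u v : TangentSpace 𝓘(ℝ, E') x) : gN.inner x (F x u) v = gN.inner x u (F x v) := by
  rw [← hF.isometry x u (F x v), hF.sq]

theorem RiemMetric.eq_zero_of_inner_self (g : RiemMetric E M) {p : M} {u : TangentSpace 𝓘(ℝ, E) p}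
    (h : g.inner p u u = 0) : u = 0 := by
  by_contra hne
  exact (g.pos p u hne).ne' h

namespace IsometricImmersion

variable (φ : IsometricImmersion gM gN) {p : M}

theorem d_tan_add_nor (w : TangentSpace 𝓘(ℝ, E') (φ.toFun p)) :
    φ.d p (φ.tan p w) + φ.nor p w = w := by
  simp [nor]

theorem inner_nor_d (w : TangentSpace 𝓘(ℝ, E') (φ.toFun p)) (v : TangentSpace 𝓘(ℝ, E) p) :
    gN.inner (φ.toFun p) (φ.nor p w) (φ.d p v) = 0 := by
  have h : φ.nor p w = w - φ.d p (φ.tan p w) := by simp [nor]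
  rw [h, map_sub, sub_apply, φ.inner_d, φ.inner_tan, sub_self]

theorem inner_nor_nor {ξ : TangentSpace 𝓘(ℝ, E') (φ.toFun p)}
    (hξ : ∀ v, gN.inner (φ.toFun p) ξ (φ.d p v) = 0) (w : TangentSpace 𝓘(ℝ, E') (φ.toFun p)) :
    gN.inner (φ.toFun p) ξ (φ.nor p w) = gN.inner (φ.toFun p) ξ w := by
  have h : φ.nor p w = w - φ.d p (φ.tan p w) := by simp [nor]
  rw [h, map_sub, hξ, sub_zero]

theorem d_opT_add_opN (u : TangentSpace 𝓘(ℝ, E) p) :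
    φ.d p (φ.opT F p u) + φ.opN F p u = F (φ.toFun p) (φ.d p u) :=
  φ.d_tan_add_nor _

theorem inner_opT (u v : TangentSpace 𝓘(ℝ, E) p) :
    gM.inner p (φ.opT F p u) v = gN.inner (φ.toFun p) (F (φ.toFun p) (φ.d p u)) (φ.d p v) :=
  φ.inner_tan _ _

theorem inner_opT_left (hF : IsLocallyProduct gN F) (u v : TangentSpace 𝓘(ℝ, E) p) :
    gM.inner p (φ.opT F p u) v = gM.inner p u (φ.opT F p v) := by
  rw [φ.inner_opT, gM.symm p u, φ.inner_opT, hF.inner_left, gN.symm]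

theorem inner_opN_d (u v : TangentSpace 𝓘(ℝ, E) p) :
    gN.inner (φ.toFun p) (φ.opN F p u) (φ.d p v) = 0 := φ.inner_nor_d _ _

theorem mem_dist {c : ℝ} {u : TangentSpace 𝓘(ℝ, E) p} :
    u ∈ φ.dist F c p ↔ φ.opT F p (φ.opT F p u) = c ^ 2 • u := by
  simp [dist, sub_eq_zero]

theorem mem_distT {u : TangentSpace 𝓘(ℝ, E) p} :
    u ∈ φ.distT F p ↔ φ.opT F p (φ.opT F p u) = u := by
  simp [mem_dist]

/-- |Tu|² = ⟨u, T²u⟩ = 0, since T is self-adjoint. -/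
theorem opT_eq_zero (hF : IsLocallyProduct gN F) {u : TangentSpace 𝓘(ℝ, E) p}
    (hu : u ∈ φ.distPerp F p) : φ.opT F p u = 0 := by
  refine gM.eq_zero_of_inner_self ?_
  rw [φ.inner_opT_left hF, φ.mem_dist.1 hu]
  simp

theorem inner_F_d_eq_zero (hF : IsLocallyProduct gN F) {u : TangentSpace 𝓘(ℝ, E) p}
    (hu : u ∈ φ.distPerp F p) (v : TangentSpace 𝓘(ℝ, E) p) :
    gN.inner (φ.toFun p) (F (φ.toFun p) (φ.d p u)) (φ.d p v) = 0 := by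
  rw [← φ.inner_opT, φ.opT_eq_zero hF hu, map_zero, zero_apply]

/-- |Tu|² = ⟨u, T²u⟩ = |u|² = |Fu|², so the normal part of Fu has length zero. -/
theorem F_d_eq (hF : IsLocallyProduct gN F) {u : TangentSpace 𝓘(ℝ, E) p}
    (hu : u ∈ φ.distT F p) : F (φ.toFun p) (φ.d p u) = φ.d p (φ.opT F p u) := by
  have h := φ.d_opT_add_opN (F := F) u
  have h0 : φ.opN F p u = 0 := by
    refine gN.eq_zero_of_inner_self ?_
    have h1 := hF.isometry (φ.toFun p) (φ.d p u) (φ.d p u)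
    have h2 := φ.inner_opN_d (F := F) u (φ.opT F p u)
    have h3 := h2
    rw [gN.symm] at h3
    rw [← h, φ.inner_d] at h1
    simp only [map_add, add_apply] at h1
    rw [h2, h3, φ.inner_d, φ.inner_opT_left hF, φ.mem_distT.1 hu] at h1
    linarith
  rw [← h, h0, add_zero]

theorem inner_eq_zero_of_mem_dist (hF : IsLocallyProduct gN F) {a b : ℝ} (hab : a ^ 2 ≠ b ^ 2)
    {u v : TangentSpace 𝓘(ℝ, E) p} (hu : u ∈ φ.dist F a p) (hv : v ∈ φ.dist F b p) :
    gM.inner p u v = 0 := by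
  have h := (φ.inner_opT_left hF (φ.opT F p u) v).trans (φ.inner_opT_left hF u _)
  rw [φ.mem_dist.1 hu, φ.mem_dist.1 hv] at h
  simp only [map_smul, smul_apply, smul_eq_mul] at h
  have h1 : (a ^ 2 - b ^ 2) * gM.inner p u v = 0 := by linarith
  exact (mul_eq_zero.1 h1).resolve_left (sub_ne_zero.2 hab)

variable (F) in
/-- The projection onto `D^T` along `D^⊥ ⊕ D^θ`. -/
def projT (θ : ℝ) (p : M) : TangentSpace 𝓘(ℝ, E) p →ₗ[ℝ] TangentSpace 𝓘(ℝ, E) p :=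
  -- This is the interpolation polynomial λ(λ - cos²θ)/(1 - cos²θ) evaluated at λ = T²: it is 1 at λ
  -- = 1 and 0 at the eigenvalues 0 and cos²θ. Being polynomial in T, the projection is as smooth as
  -- T.
  (Real.sin θ ^ 2)⁻¹ • (φ.opT F p ∘ₗ φ.opT F p ∘ₗ
    (φ.opT F p ∘ₗ φ.opT F p - Real.cos θ ^ 2 • LinearMap.id))

theorem projT_apply (θ : ℝ) (u : TangentSpace 𝓘(ℝ, E) p) : φ.projT F θ p u =
    (Real.sin θ ^ 2)⁻¹ • (φ.opT F p (φ.opT F p (φ.opT F p (φ.opT F p u))) -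
      Real.cos θ ^ 2 • φ.opT F p (φ.opT F p u)) := by
  simp [projT]

variable {φ} {θ : ℝ}

namespace IsProperSkewSemiInvariantOrderOne

variable (hM : φ.IsProperSkewSemiInvariantOrderOne F θ)
include hM

theorem sin_pos : 0 < Real.sin θ :=
  Real.sin_pos_of_pos_of_lt_pi hM.angle.1 (by linarith [hM.angle.2, Real.pi_pos])

theorem cos_sq_mem : Real.cos θ ^ 2 ∈ Ioo (0 : ℝ) 1 := by
  have h := hM.skew.mem_Ioo 0
  exact ⟨by have := h.1; positivity, by nlinarith [h.1, h.2]⟩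

theorem exists_add (v : TangentSpace 𝓘(ℝ, E) p) : ∃ a ∈ φ.distPerp F p, ∃ b ∈ φ.distT F p,
    ∃ d ∈ φ.distSlant F θ p, a + b + d = v := by
  have h : v ∈ φ.distPerp F p ⊔ φ.distT F p ⊔ ⨆ _ : Fin 1, φ.distSlant F θ p := by
    rw [hM.skew.decomposition p]; trivial
  rw [ciSup_const, Submodule.mem_sup] at h
  obtain ⟨y, hy, d, hd, rfl⟩ := h
  obtain ⟨a, ha, b, hb, rfl⟩ := Submodule.mem_sup.1 hy
  exact ⟨a, ha, b, hb, d, hd, rfl⟩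

theorem projT_mem (v : TangentSpace 𝓘(ℝ, E) p) : φ.projT F θ p v ∈ φ.distT F p ∧
    v - φ.projT F θ p v ∈ φ.distPerp F p ⊔ φ.distSlant F θ p := by
  obtain ⟨a, ha, b, hb, d, hd, rfl⟩ := hM.exists_add v
  have h1 : φ.projT F θ p (a + b + d) = b := by
    have hs := hM.sin_pos
    rw [φ.projT_apply]
    simp only [map_add, φ.mem_distT.1 hb, φ.mem_dist.1 ha, φ.mem_dist.1 hd, map_smul]
    rw [inv_smul_eq_iff₀ (by positivity), Real.sin_sq]
    module
  rw [h1]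
  refine ⟨hb, ?_⟩
  rw [show a + b + d - b = a + d by abel]
  exact Submodule.add_mem_sup ha hd

theorem inner_eq_zero (hF : IsLocallyProduct gN F) {u v : TangentSpace 𝓘(ℝ, E) p}
    (hu : u ∈ φ.distPerp F p ⊔ φ.distSlant F θ p) (hv : v ∈ φ.distT F p) : gM.inner p u v = 0 := by
  obtain ⟨a, ha, d, hd, rfl⟩ := Submodule.mem_sup.1 hu
  have hc := hM.cos_sq_mem
  rw [map_add, add_apply, φ.inner_eq_zero_of_mem_dist hF (by simp) ha hv,
    φ.inner_eq_zero_of_mem_dist hF (by simpa using hc.2.ne) hd hv, add_zero]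

theorem projT_eq_self_iff {v : TangentSpace 𝓘(ℝ, E) p} :
    φ.projT F θ p v = v ↔ v ∈ φ.distT F p := by
  refine ⟨fun h ↦ h ▸ (hM.projT_mem v).1, fun h ↦ ?_⟩
  have hs := hM.sin_pos
  rw [φ.projT_apply]
  simp only [φ.mem_distT.1 h]
  rw [inv_smul_eq_iff₀ (by positivity), Real.sin_sq]
  module

theorem projT_eq_zero_iff {v : TangentSpace 𝓘(ℝ, E) p} :
    φ.projT F θ p v = 0 ↔ v ∈ φ.distPerp F p ⊔ φ.distSlant F θ p := by
  refine ⟨fun h ↦ by simpa [h] using (hM.projT_mem v).2, fun h ↦ ?_⟩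
  obtain ⟨a, ha, d, hd, rfl⟩ := Submodule.mem_sup.1 h
  rw [φ.projT_apply]
  simp only [map_add, φ.mem_dist.1 ha, φ.mem_dist.1 hd, map_smul]
  simp [smul_smul]

end IsProperSkewSemiInvariantOrderOne

/-! ### The shape operators -/

variable (φ)

theorem inner_shape (ξ : TangentSpace 𝓘(ℝ, E') (φ.toFun p)) (u v : TangentSpace 𝓘(ℝ, E) p) :
    gM.inner p (φ.shape p ξ u) v = gN.inner (φ.toFun p) ξ (φ.sff p u v) := by
  rw [shape, RiemMetric.inner_sharp]
  rfl

section

variable {φ} (hF : IsLocallyProduct gN F) {X : Π q : M, TangentSpace 𝓘(ℝ, E) q}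
  (hX : MDiffAt (T% X) p) (hTX : MDiffAt (T% (fun q ↦ φ.opT F q (X q))) p)
  (hXT : ∀ᶠ q in 𝓝 p, X q ∈ φ.distT F q) (u : TangentSpace 𝓘(ℝ, E) p)
include hF hX hTX hXT

/-- Near p the field TX is mapped by dφ to F applied to the image of X, and F commutes with ∇̄ along
the immersion. -/
theorem sff_opT : φ.sff p (φ.opT F p (X p)) u =
    φ.nor p (F (φ.toFun p) (φ.covAlong (φ.push X) p u)) := by
  rw [φ.sff_symm]
  refine (φ.sff_apply hTX u).trans ?_
  rw [← (φ.mdifferentiableAt_coord_F hF (φ.mdifferentiableAt_coord_push hX) u).2]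
  congr 1
  refine φ.covAlong_congr ?_ u
  filter_upwards [hXT] with q hq
  exact (φ.F_d_eq hF hq).symm

/-- FV is normal, so ⟨FV, h(TX, u)⟩ = ⟨FV, F ∇̄_u X⟩ = ⟨V, ∇̄_u X⟩, and only the tangential part of
∇̄_u X contributes. -/
theorem inner_shape_perp {V : TangentSpace 𝓘(ℝ, E) p} (hV : V ∈ φ.distPerp F p) :
    gM.inner p (φ.shape p (F (φ.toFun p) (φ.d p V)) (φ.opT F p (X p))) u =
      gM.inner p (gM.leviCivita X p u) V := by
  rw [φ.inner_shape, sff_opT hF hX hTX hXT, φ.inner_nor_nor (φ.inner_F_d_eq_zero hF hV),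
    hF.isometry, ← φ.tan_covAlong_push hX, φ.inner_tan, gN.symm]

/-- With NZ = FZ - TZ and NTZ = FTZ - cos²θ Z, the two terms containing TZ cancel because F is
self-adjoint; what is left is (1 - cos²θ) ⟨Z, ∇̄_u X⟩. -/
theorem inner_shape_slant {Z : TangentSpace 𝓘(ℝ, E) p} (hZ : Z ∈ φ.distSlant F θ p) :
    gM.inner p (φ.shape p (φ.opN F p Z) (φ.opT F p (X p)) +
        φ.shape p (φ.opN F p (φ.opT F p Z)) (X p)) u =
      Real.sin θ ^ 2 * gM.inner p (gM.leviCivita X p u) Z := by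
  have h1 := φ.d_opT_add_opN (F := F) Z
  have h2 := φ.d_opT_add_opN (F := F) (φ.opT F p Z)
  have h3 : φ.sff p (X p) u = φ.nor p (φ.covAlong (φ.push X) p u) := by
    rw [φ.sff_symm]
    exact φ.sff_apply hX u
  rw [map_add, add_apply, φ.inner_shape, φ.inner_shape, sff_opT hF hX hTX hXT, h3,
    φ.inner_nor_nor (φ.inner_opN_d _), φ.inner_nor_nor (φ.inner_opN_d _), eq_sub_of_add_eq' h1,
    eq_sub_of_add_eq' h2, map_sub, map_sub, sub_apply, sub_apply, hF.isometry, hF.inner_left,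
    φ.mem_dist.1 hZ, map_smul, map_smul, smul_apply, smul_eq_mul, Real.sin_sq,
    ← φ.tan_covAlong_push hX, φ.inner_tan, gN.symm _ _ (φ.d p Z)]
  ring

end

end IsometricImmersion
end Eigenspaces

/-! ## Smooth fields of endomorphisms in coordinates -/

section Endomorphisms

set_option linter.unusedSectionVars false

variable {E : Type*} [NormedAddCommGroup E] [NormedSpace ℝ E] [FiniteDimensional ℝ E]
  {M : Type*} [TopologicalSpace M] [ChartedSpace E M] [IsManifold 𝓘(ℝ, E) ∞ M]
  {V : Type*} [NormedAddCommGroup V] [NormedSpace ℝ V] [FiniteDimensional ℝ V]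

theorem RiemMetric.contMDiffAt_inner (g : RiemMetric E M) {X Y : Π x : M, TangentSpace 𝓘(ℝ, E) x}
    {x : M} (hX : CMDiffAt ∞ (T% X) x) (hY : CMDiffAt ∞ (T% Y) x) :
    CMDiffAt ∞ (fun y ↦ g.inner y (X y) (Y y)) x := by
  have : ContMDiffAt 𝓘(ℝ, E) (𝓘(ℝ, E).prod 𝓘(ℝ)) ∞
      (fun m ↦ TotalSpace.mk' ℝ (E := Bundle.Trivial M ℝ) m (g.inner m (X m) (Y m))) x := by
    apply ContMDiffAt.clm_bundle_apply₂ (F₁ := E) (F₂ := E)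
    · exact g.contMDiff.contMDiffAt
    · exact hX
    · exact hY
  simp only [contMDiffAt_totalSpace] at this
  exact this.2

namespace PartialDiffeomorph

variable {e : PartialDiffeomorph 𝓘(ℝ, E) 𝓘(ℝ, V) M V ∞}

variable (e) in
/-- The inverse of the differential of the coordinates. -/
def fieldMap (q : M) : V →ₗ[ℝ] TangentSpace 𝓘(ℝ, E) q :=
  (mfderiv 𝓘(ℝ, E) 𝓘(ℝ, V) e q).inverse.toLinearMap

variable (e) in
/-- The coordinate expression of a field of bilinear forms. -/
def form (B : Π q : M, LinearMap.BilinForm ℝ (TangentSpace 𝓘(ℝ, E) q)) (x : V) :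
    V →L[ℝ] V →L[ℝ] ℝ :=
  LinearMap.toContinuousLinearMap (LinearMap.toContinuousLinearMap.toLinearMap ∘ₗ
    (B (e.symm x)).compl₁₂ (e.fieldMap (e.symm x)) (e.fieldMap (e.symm x)))

theorem form_apply (B : Π q : M, LinearMap.BilinForm ℝ (TangentSpace 𝓘(ℝ, E) q)) (x w w' : V) :
    e.form B x w w' = B (e.symm x) (e.field (fun _ ↦ w) (e.symm x))
      (e.field (fun _ ↦ w') (e.symm x)) := rfl

theorem contDiffOn_form {B : Π q : M, LinearMap.BilinForm ℝ (TangentSpace 𝓘(ℝ, E) q)}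
    (hB : ∀ w w' : V, ∀ q ∈ e.source,
      CMDiffAt ∞ (fun q ↦ B q (e.field (fun _ ↦ w) q) (e.field (fun _ ↦ w') q)) q) :
    ContDiffOn ℝ ∞ (e.form B) e.target := by
  rw [contDiffOn_clm_apply]
  intro w
  rw [contDiffOn_clm_apply]
  intro w' x hx
  have hq : e.symm x ∈ e.source := e.map_target hx
  have h := contDiffAt_comp_symm hq (hB w w' _ hq)
  rw [show e (e.symm x) = x from e.right_inv hx] at h
  exact h.contDiffWithinAt

/-- Smoothness of ⟨A u, v⟩ on coordinate fields is enough: in coordinates A is G⁻¹ B, where G is the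
matrix of the metric and B that of ⟨A ·, ·⟩, and inversion is smooth. -/
theorem exists_contDiffOn_endomorphism (g : RiemMetric E M)
    {A : Π q : M, TangentSpace 𝓘(ℝ, E) q →ₗ[ℝ] TangentSpace 𝓘(ℝ, E) q}
    (hA : ∀ w w' : V, ∀ q ∈ e.source, CMDiffAt ∞
      (fun q ↦ g.inner q (A q (e.field (fun _ ↦ w) q)) (e.field (fun _ ↦ w') q)) q) :
    ∃ Ah : V → V →L[ℝ] V, ContDiffOn ℝ ∞ Ah e.target ∧ ∀ q ∈ e.source,
      ∀ v : TangentSpace 𝓘(ℝ, E) q, Ah (e q) (mfderiv 𝓘(ℝ, E) 𝓘(ℝ, V) e q v) =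
        mfderiv 𝓘(ℝ, E) 𝓘(ℝ, V) e q (A q v) := by
  set G := e.form g.bilin
  set B := e.form fun q ↦ g.bilin q ∘ₗ A q
  have hG : ContDiffOn ℝ ∞ G e.target := contDiffOn_form fun w w' q hq ↦
    g.contMDiffAt_inner (contMDiffAt_field hq contDiffAt_const)
      (contMDiffAt_field hq contDiffAt_const)
  have hB : ContDiffOn ℝ ∞ B e.target := contDiffOn_form hA
  have hinv : ∀ x ∈ e.target, ∃ L : V ≃L[ℝ] (V →L[ℝ] ℝ), (L : V →L[ℝ] V →L[ℝ] ℝ) = G x := by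
    intro x hx
    have hq : e.symm x ∈ e.source := e.map_target hx
    have hinj : Function.Injective (G x).toLinearMap := by
      rw [← LinearMap.ker_eq_bot, LinearMap.ker_eq_bot']
      intro w hw
      have h1 : G x w w = 0 := by
        have : G x w = 0 := hw
        rw [this]; rfl
      have h2 := g.eq_zero_of_inner_self (p := e.symm x) h1
      have h3 := mfderiv_field (e := e) (fun _ ↦ w) hq
      exact h3.symm.trans ((congrArg _ h2).trans (map_zero _))
    have hdim : Module.finrank ℝ V = Module.finrank ℝ (V →L[ℝ] ℝ) := by
      rw [← LinearMap.toContinuousLinearMap.finrank_eq (M := V →ₗ[ℝ] ℝ)]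
      exact (Subspace.dual_finrank_eq (K := ℝ) (V := V)).symm
    exact ⟨(LinearEquiv.ofInjectiveOfFinrankEq (G x).toLinearMap hinj hdim).toContinuousLinearEquiv, by
      ext; rfl⟩
  refine ⟨fun x ↦ (G x).inverse ∘L B x, fun x hx ↦ ?_, fun q hq v ↦ ?_⟩
  · obtain ⟨L, hL⟩ := hinv x hx
    have h1 : ContDiffAt ℝ ∞ ContinuousLinearMap.inverse (G x) := hL ▸ contDiffAt_map_inverse L
    have h2 := h1.comp_contDiffWithinAt x (hG x hx)
    exact h2.clm_comp (hB x hx)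
  · obtain ⟨L, hL⟩ := hinv (e q) (e.map_source hq)
    have hl : e.symm (e q) = q := e.left_inv hq
    have hf : ∀ v : TangentSpace 𝓘(ℝ, E) q,
        e.field (fun _ ↦ (mfderiv 𝓘(ℝ, E) 𝓘(ℝ, V) e q v : V)) q = v :=
      fun v ↦ field_mfderiv hq v rfl
    have key : B (e q) (mfderiv 𝓘(ℝ, E) 𝓘(ℝ, V) e q v) =
        G (e q) (mfderiv 𝓘(ℝ, E) 𝓘(ℝ, V) e q (A q v)) := by
      ext w
      refine (form_apply _ _ _ _).trans (Eq.trans ?_ (form_apply _ _ _ _).symm)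
      rw [hl, hf, hf]
      rfl
    change (G (e q)).inverse (B (e q) _) = _
    rw [key, ← hL, ContinuousLinearMap.inverse_equiv]
    exact L.symm_apply_apply _

end PartialDiffeomorph

theorem exists_eventually_eq_field {X : Π q : M, TangentSpace 𝓘(ℝ, E) q} {p : M}
    (hX : MDiffAt (T% X) p) : ∃ ξ : E → E, DifferentiableAt ℝ ξ (chartDiffeomorph p p) ∧
      ∀ᶠ q in 𝓝 p, X q = (chartDiffeomorph p).field ξ q := by
  have hp := mem_chartDiffeomorph_source (E := E) p
  have hp' := (chartDiffeomorph (E := E) p).map_source hp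
  let k : M → E := fun q ↦
    (trivializationAt E (TangentSpace 𝓘(ℝ, E) : M → Type _) p ⟨q, X q⟩).2
  have hk : MDiffAt k p := by
    rw [mdifferentiableAt_totalSpace] at hX
    exact hX.2
  have hs : MDifferentiableAt 𝓘(ℝ, E) 𝓘(ℝ, E) (chartDiffeomorph (E := E) p).symm
      (chartDiffeomorph p p) := (chartDiffeomorph p).symm.mdifferentiableAt (by simp) hp'
  have h : (chartDiffeomorph (E := E) p).symm (chartDiffeomorph p p) = p :=
    (chartDiffeomorph p).left_inv hp
  refine ⟨fun x ↦ k ((chartDiffeomorph p).symm x), ?_, ?_⟩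
  · rw [← h] at hk
    exact mdifferentiableAt_iff_differentiableAt.1 (MDifferentiableAt.comp (g := k) _ hk hs)
  · filter_upwards [(chartDiffeomorph p).open_source.mem_nhds hp] with q hq
    refine (PartialDiffeomorph.field_mfderiv hq _ ?_).symm
    have h' : (chartDiffeomorph (E := E) p).symm (chartDiffeomorph p q) = q :=
      (chartDiffeomorph p).left_inv hq
    rw [h']
    exact trivializationAt_eq_mfderiv hq (X q)

end Endomorphisms

/-! ### Smoothness of T and of the projection onto D^T -/

section Submanifold

set_option linter.unusedSectionVars false

variable {E : Type*} [NormedAddCommGroup E] [NormedSpace ℝ E] [FiniteDimensional ℝ E]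
  {M : Type*} [TopologicalSpace M] [ChartedSpace E M] [IsManifold 𝓘(ℝ, E) ∞ M]
  {E' : Type*} [NormedAddCommGroup E'] [NormedSpace ℝ E'] [FiniteDimensional ℝ E']
  {N : Type*} [TopologicalSpace N] [ChartedSpace E' N] [IsManifold 𝓘(ℝ, E') ∞ N]
  {gM : RiemMetric E M} {gN : RiemMetric E' N}
  {F : Π x : N, TangentSpace 𝓘(ℝ, E') x →L[ℝ] TangentSpace 𝓘(ℝ, E') x}
  {V : Type*} [NormedAddCommGroup V] [NormedSpace ℝ V] [FiniteDimensional ℝ V]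

namespace IsometricImmersion

variable (φ : IsometricImmersion gM gN) {p : M}

theorem contMDiffAt_push {X : Π q : M, TangentSpace 𝓘(ℝ, E) q} (hX : CMDiffAt ∞ (T% X) p) :
    ContMDiffAt 𝓘(ℝ, E) 𝓘(ℝ, E').tangent ∞
      (fun q ↦ TotalSpace.mk' E' (E := fun x : N ↦ TangentSpace 𝓘(ℝ, E') x) (φ.toFun q)
        (φ.push X q)) p := by
  have h : ContMDiff 𝓘(ℝ, E).tangent 𝓘(ℝ, E').tangent ∞
      (tangentMap 𝓘(ℝ, E) 𝓘(ℝ, E') φ.toFun) :=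
    φ.contMDiff.contMDiff_tangentMap (by norm_cast)
  exact h.contMDiffAt.comp p hX

/-- The matrix entries are ⟨Tu, v⟩ = ⟨F dφ(u), dφ(v)⟩, an expression that does not involve the
tangential projection. -/
theorem exists_contDiffOn_opT (hF : IsLocallyProduct gN F)
    (e : PartialDiffeomorph 𝓘(ℝ, E) 𝓘(ℝ, V) M V ∞) :
    ∃ Th : V → V →L[ℝ] V, ContDiffOn ℝ ∞ Th e.target ∧ ∀ q ∈ e.source,
      ∀ v : TangentSpace 𝓘(ℝ, E) q, Th (e q) (mfderiv 𝓘(ℝ, E) 𝓘(ℝ, V) e q v) =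
        mfderiv 𝓘(ℝ, E) 𝓘(ℝ, V) e q (φ.opT F q v) := by
  refine PartialDiffeomorph.exists_contDiffOn_endomorphism gM fun w w' q hq ↦ ?_
  have h1 := φ.contMDiffAt_push
    (PartialDiffeomorph.contMDiffAt_field (e := e) (ξ := fun _ ↦ w) hq contDiffAt_const)
  have h2 := φ.contMDiffAt_push
    (PartialDiffeomorph.contMDiffAt_field (e := e) (ξ := fun _ ↦ w') hq contDiffAt_const)
  have h3 : ContMDiffAt 𝓘(ℝ, E) 𝓘(ℝ, E').tangent ∞
      (fun q ↦ TotalSpace.mk' E' (E := fun x : N ↦ TangentSpace 𝓘(ℝ, E') x) (φ.toFun q)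
        (F (φ.toFun q) (φ.push (e.field fun _ ↦ w) q))) q :=
    ContMDiffAt.clm_bundle_apply (F₁ := E') (F₂ := E')
      (hF.smooth.contMDiffAt.comp q φ.contMDiff.contMDiffAt) h1
  have h4 : ContMDiffAt 𝓘(ℝ, E) (𝓘(ℝ, E').prod 𝓘(ℝ)) ∞
      (fun q ↦ TotalSpace.mk' ℝ (E := Bundle.Trivial N ℝ) (φ.toFun q) (gN.inner (φ.toFun q)
        (F (φ.toFun q) (φ.push (e.field fun _ ↦ w) q)) (φ.push (e.field fun _ ↦ w') q))) q :=
    ContMDiffAt.clm_bundle_apply₂ (F₁ := E') (F₂ := E')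
      (gN.contMDiff.contMDiffAt.comp q φ.contMDiff.contMDiffAt) h3 h2
  rw [contMDiffAt_totalSpace] at h4
  refine h4.2.congr_of_eventuallyEq (Filter.Eventually.of_forall fun q ↦ ?_)
  exact φ.inner_opT _ _

theorem exists_contDiffOn_projT (hF : IsLocallyProduct gN F) (θ : ℝ)
    (e : PartialDiffeomorph 𝓘(ℝ, E) 𝓘(ℝ, V) M V ∞) :
    ∃ P : V → V →L[ℝ] V, ContDiffOn ℝ ∞ P e.target ∧ ∀ q ∈ e.source,
      ∀ v : TangentSpace 𝓘(ℝ, E) q, P (e q) (mfderiv 𝓘(ℝ, E) 𝓘(ℝ, V) e q v) =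
        mfderiv 𝓘(ℝ, E) 𝓘(ℝ, V) e q (φ.projT F θ q v) := by
  obtain ⟨Th, hTh, hT⟩ := φ.exists_contDiffOn_opT hF e
  have h2 : ContDiffOn ℝ ∞ (fun x ↦ Th x ∘L Th x) e.target := hTh.clm_comp hTh
  refine ⟨fun x ↦ (Real.sin θ ^ 2)⁻¹ • ((Th x ∘L Th x) ∘L (Th x ∘L Th x) -
    Real.cos θ ^ 2 • (Th x ∘L Th x)), ?_, fun q hq v ↦ ?_⟩
  · exact ((h2.clm_comp h2).sub (h2.const_smul _)).const_smul _
  · rw [φ.projT_apply, map_smul, map_sub, map_smul, ← hT q hq, ← hT q hq, ← hT q hq, ← hT q hq]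
    rfl

theorem mdifferentiableAt_opT (hF : IsLocallyProduct gN F) {X : Π q : M, TangentSpace 𝓘(ℝ, E) q}
    (hX : MDiffAt (T% X) p) : MDiffAt (T% (fun q ↦ φ.opT F q (X q))) p := by
  obtain ⟨Th, hTh, hT⟩ := φ.exists_contDiffOn_opT hF (chartDiffeomorph p)
  obtain ⟨ξ, hξ, hXξ⟩ := exists_eventually_eq_field hX
  have hp := mem_chartDiffeomorph_source (E := E) p
  have hp' := (chartDiffeomorph (E := E) p).map_source hp
  have h1 : DifferentiableAt ℝ (fun x ↦ Th x (ξ x)) (chartDiffeomorph p p) :=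
    (((hTh _ hp').contDiffAt ((chartDiffeomorph p).open_target.mem_nhds hp')).differentiableAt
      (by simp)).clm_apply hξ
  refine (PartialDiffeomorph.mdifferentiableAt_field hp h1).congr_of_eventuallyEq ?_
  filter_upwards [hXξ, (chartDiffeomorph p).open_source.mem_nhds hp] with q hq hqs
  have h2 := (PartialDiffeomorph.field_mfderiv (e := chartDiffeomorph p) hqs (φ.opT F q (X q))
    (ξ := fun x ↦ Th x (ξ x)) ?_).symm
  · simp only [h2]
  · rw [← hT q hqs, hq, PartialDiffeomorph.mfderiv_field _ hqs]

end IsometricImmersion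

end Submanifold

/-! ## The shape equations in terms of the Levi-Civita connection -/

section Splitting

variable {E : Type*} [NormedAddCommGroup E] [NormedSpace ℝ E]
  {M : Type*} [TopologicalSpace M] [ChartedSpace E M] [IsManifold 𝓘(ℝ, E) ∞ M]

/-- `P` is a smooth field of projections onto `D₂` along `D₁`, and `D₁` and `D₂` are
orthogonal. -/
structure IsOrthogonalSplitting (g : RiemMetric E M)
    (D₁ D₂ : Π p : M, Submodule ℝ (TangentSpace 𝓘(ℝ, E) p))
    (P : Π p : M, TangentSpace 𝓘(ℝ, E) p →ₗ[ℝ] TangentSpace 𝓘(ℝ, E) p) : Prop where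
  eq_self_iff : ∀ p v, P p v = v ↔ v ∈ D₂ p
  eq_zero_iff : ∀ p v, P p v = 0 ↔ v ∈ D₁ p
  idem : ∀ p v, P p (P p v) = P p v
  inner_eq_zero : ∀ p, ∀ u ∈ D₁ p, ∀ v ∈ D₂ p, g.inner p u v = 0
  smooth : ∀ p : M, ∃ Ph : E → E →L[ℝ] E, ContDiffOn ℝ ∞ Ph (chartDiffeomorph (E := E) p).target ∧
    ∀ q ∈ (chartDiffeomorph (E := E) p).source, ∀ v : TangentSpace 𝓘(ℝ, E) q,
      Ph (chartDiffeomorph (E := E) p q)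
          (mfderiv 𝓘(ℝ, E) 𝓘(ℝ, E) (chartDiffeomorph (E := E) p) q v) =
        mfderiv 𝓘(ℝ, E) 𝓘(ℝ, E) (chartDiffeomorph (E := E) p) q (P q v)

variable [FiniteDimensional ℝ E]

/-- `⟨∇_u X, v⟩ = -v[σ] ⟨X, u⟩` for the sections `X` of `D₂` and `v ∈ D₁`. -/
def HasWarpedConnection (g : RiemMetric E M)
    (D₁ D₂ : Π p : M, Submodule ℝ (TangentSpace 𝓘(ℝ, E) p)) (U : Set M) (σ : M → ℝ) : Prop :=
  ∀ p ∈ U, ∀ X : Π q : M, TangentSpace 𝓘(ℝ, E) q, MDiffAt (T% X) p →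
    (∀ᶠ q in 𝓝 p, X q ∈ D₂ q) → ∀ u, ∀ v ∈ D₁ p,
      g.inner p (g.leviCivita X p u) v = -mvfderiv 𝓘(ℝ, E) σ p v * g.inner p (X p) u

/-- The projection of a constant-coefficient field through v is a section of D₂ that still takes the
value v at p. -/
theorem IsOrthogonalSplitting.exists_section {g : RiemMetric E M}
    {D₁ D₂ : Π p : M, Submodule ℝ (TangentSpace 𝓘(ℝ, E) p)}
    {P : Π p : M, TangentSpace 𝓘(ℝ, E) p →ₗ[ℝ] TangentSpace 𝓘(ℝ, E) p}
    (h : IsOrthogonalSplitting g D₁ D₂ P) {p : M} {v : TangentSpace 𝓘(ℝ, E) p} (hv : v ∈ D₂ p) :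
    ∃ X : Π q : M, TangentSpace 𝓘(ℝ, E) q, MDiffAt (T% X) p ∧ (∀ᶠ q in 𝓝 p, X q ∈ D₂ q) ∧
      X p = v := by
  obtain ⟨Ph, hPh, hP⟩ := h.smooth p
  have hp := mem_chartDiffeomorph_source (E := E) p
  have hp' := (chartDiffeomorph (E := E) p).map_source hp
  set w : E := mfderiv 𝓘(ℝ, E) 𝓘(ℝ, E) (chartDiffeomorph (E := E) p) p v with hw
  have key : ∀ q ∈ (chartDiffeomorph (E := E) p).source,
      (chartDiffeomorph p).field (fun x ↦ Ph x w) q =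
        P q ((chartDiffeomorph p).field (fun _ ↦ w) q) := fun q hq ↦ by
    refine PartialDiffeomorph.field_mfderiv hq _ ?_
    rw [← hP q hq, PartialDiffeomorph.mfderiv_field _ hq]
  refine ⟨(chartDiffeomorph p).field fun x ↦ Ph x w, ?_, ?_, ?_⟩
  · refine PartialDiffeomorph.mdifferentiableAt_field hp ?_
    exact (((hPh _ hp').contDiffAt ((chartDiffeomorph p).open_target.mem_nhds hp')).differentiableAt
      (by simp)).clm_apply (by fun_prop)
  · filter_upwards [(chartDiffeomorph p).open_source.mem_nhds hp] with q hq
    rw [key q hq, ← h.eq_self_iff, h.idem]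
  · rw [key p hp, PartialDiffeomorph.field_mfderiv hp v hw.symm]
    exact (h.eq_self_iff p v).2 hv

end Splitting

/-! ### Equivalence of (∗) with the connection identity -/

section Submanifold

set_option linter.unusedSectionVars false

variable {E : Type*} [NormedAddCommGroup E] [NormedSpace ℝ E] [FiniteDimensional ℝ E]
  {M : Type*} [TopologicalSpace M] [ChartedSpace E M] [IsManifold 𝓘(ℝ, E) ∞ M]
  {E' : Type*} [NormedAddCommGroup E'] [NormedSpace ℝ E'] [FiniteDimensional ℝ E']
  {N : Type*} [TopologicalSpace N] [ChartedSpace E' N] [IsManifold 𝓘(ℝ, E') ∞ N]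
  {gM : RiemMetric E M} {gN : RiemMetric E' N}
  {F : Π x : N, TangentSpace 𝓘(ℝ, E') x →L[ℝ] TangentSpace 𝓘(ℝ, E') x}

namespace IsometricImmersion

variable {φ : IsometricImmersion gM gN} {θ : ℝ}

theorem IsProperSkewSemiInvariantOrderOne.isOrthogonalSplitting
    (hM : φ.IsProperSkewSemiInvariantOrderOne F θ) (hF : IsLocallyProduct gN F) :
    IsOrthogonalSplitting gM (fun p ↦ φ.distPerp F p ⊔ φ.distSlant F θ p) (φ.distT F)
      (φ.projT F θ) where
  eq_self_iff _ _ := hM.projT_eq_self_iff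
  eq_zero_iff _ _ := hM.projT_eq_zero_iff
  idem _ v := hM.projT_eq_self_iff.2 (hM.projT_mem v).1
  inner_eq_zero _ _ hu _ hv := hM.inner_eq_zero hF hu hv
  smooth p := φ.exists_contDiffOn_projT hF θ (chartDiffeomorph p)

/-- The two shape formulas compute the components of ∇_u X along D^⊥ and along D^θ, the latter up to
the nonzero factor sin²θ. From here on F, the immersion and θ play no role. -/
theorem satisfiesShapeEquations_iff (hM : φ.IsProperSkewSemiInvariantOrderOne F θ)
    (hF : IsLocallyProduct gN F) {U : Set M} {σ : M → ℝ} :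
    φ.SatisfiesShapeEquations F θ U σ ↔ ContMDiffOn 𝓘(ℝ, E) 𝓘(ℝ) ∞ σ U ∧
      (∀ p ∈ U, ∀ Y ∈ φ.distT F p, mvfderiv 𝓘(ℝ, E) σ p Y = 0) ∧
      HasWarpedConnection gM (fun p ↦ φ.distPerp F p ⊔ φ.distSlant F θ p) (φ.distT F) U σ := by
  have hs := hM.sin_pos
  constructor
  · intro h
    refine ⟨h.smooth, h.invariant, fun p hp X hX hXT u v hv ↦ ?_⟩
    have hTX := φ.mdifferentiableAt_opT hF hX
    obtain ⟨V, hV, Z, hZ, rfl⟩ := Submodule.mem_sup.1 hv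
    have h1 := inner_shape_perp hF hX hTX hXT u hV
    have h2 := inner_shape_slant hF hX hTX hXT u hZ
    rw [h.perp p hp _ hXT.self_of_nhds V hV] at h1
    rw [h.slant p hp _ hXT.self_of_nhds Z hZ] at h2
    simp only [map_smul, smul_apply, smul_eq_mul] at h1 h2
    have h3 : gM.inner p (gM.leviCivita X p u) Z =
        -mvfderiv 𝓘(ℝ, E) σ p Z * gM.inner p (X p) u := by
      have : Real.sin θ ^ 2 ≠ 0 := by positivity
      apply mul_left_cancel₀ this
      linarith
    rw [map_add, map_add, ← h1, h3]
    ring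
  · rintro ⟨h1, h2, h3⟩
    refine ⟨h1, h2, fun p hp X₀ hX₀ V hV ↦ gM.ext_inner p fun u ↦ ?_,
      fun p hp X₀ hX₀ Z hZ ↦ gM.ext_inner p fun u ↦ ?_⟩ <;>
    -- The shape equations concern a single vector of D^T, the connection identity a local section;
    -- the vector is extended to one.
    obtain ⟨X, hX, hXT, rfl⟩ := (hM.isOrthogonalSplitting hF).exists_section hX₀
    · rw [inner_shape_perp hF hX (φ.mdifferentiableAt_opT hF hX) hXT u hV,
        h3 p hp X hX hXT u V (Submodule.mem_sup_left hV)]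
      simp
    · rw [inner_shape_slant hF hX (φ.mdifferentiableAt_opT hF hX) hXT u hZ,
        h3 p hp X hX hXT u Z (Submodule.mem_sup_right hZ)]
      simp only [map_smul, smul_apply, smul_eq_mul]
      ring

end IsometricImmersion

end Submanifold

/-! ## The metric in coordinates adapted to an orthogonal splitting -/

section Adapted

set_option linter.unusedSectionVars false

variable {E : Type*} [NormedAddCommGroup E] [NormedSpace ℝ E] [FiniteDimensional ℝ E]
  {M : Type*} [TopologicalSpace M] [ChartedSpace E M] [IsManifold 𝓘(ℝ, E) ∞ M]
  {V : Type*} [NormedAddCommGroup V] [NormedSpace ℝ V]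
  {E₁ : Type*} [NormedAddCommGroup E₁] [NormedSpace ℝ E₁]
  {E₂ : Type*} [NormedAddCommGroup E₂] [NormedSpace ℝ E₂]

namespace PartialDiffeomorph

variable (g : RiemMetric E M)

/-- The coefficients of the metric in the coordinates `e`. -/
def coeff (e : PartialDiffeomorph 𝓘(ℝ, E) 𝓘(ℝ, V) M V ∞) (w w' : V) (q : M) : ℝ :=
  g.inner q (e.field (fun _ ↦ w) q) (e.field (fun _ ↦ w') q)

theorem coeff_comm (e : PartialDiffeomorph 𝓘(ℝ, E) 𝓘(ℝ, V) M V ∞) (w w' : V) (q : M) :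
    e.coeff g w w' q = e.coeff g w' w q := g.symm _ _ _

theorem contMDiffAt_coeff {e : PartialDiffeomorph 𝓘(ℝ, E) 𝓘(ℝ, V) M V ∞} (w w' : V) {q : M}
    (hq : q ∈ e.source) : CMDiffAt ∞ (e.coeff g w w') q :=
  g.contMDiffAt_inner (contMDiffAt_field hq contDiffAt_const)
    (contMDiffAt_field hq contDiffAt_const)

theorem two_mul_inner_leviCivita_field {e : PartialDiffeomorph 𝓘(ℝ, E) 𝓘(ℝ, V) M V ∞} (a b c : V)
    {q : M} (hq : q ∈ e.source) :
    2 * g.inner q (g.leviCivita (e.field fun _ ↦ b) q (e.field (fun _ ↦ a) q))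
        (e.field (fun _ ↦ c) q) =
      mvfderiv 𝓘(ℝ, E) (e.coeff g b c) q (e.field (fun _ ↦ a) q) +
        mvfderiv 𝓘(ℝ, E) (e.coeff g a c) q (e.field (fun _ ↦ b) q) -
        mvfderiv 𝓘(ℝ, E) (e.coeff g a b) q (e.field (fun _ ↦ c) q) := by
  have hX : ∀ w : V, MDiffAt (T% (e.field fun _ ↦ w)) q := fun w ↦
    mdifferentiableAt_field hq (by fun_prop)
  have h := g.inner_nabla (hX a) (hX b) (hX c)
  rw [RiemMetric.koszul, mlieBracket_field_const _ _ hq, mlieBracket_field_const _ _ hq,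
    mlieBracket_field_const _ _ hq] at h
  simp only [map_zero, zero_apply, add_zero, sub_zero] at h
  exact h

theorem field_prod (e : PartialDiffeomorph 𝓘(ℝ, E) 𝓘(ℝ, E₁ × E₂) M (E₁ × E₂) ∞) (a : E₁) (b : E₂)
    (q : M) : e.field (fun _ ↦ (a, b)) q = e.field (fun _ ↦ (a, 0)) q +
      e.field (fun _ ↦ (0, b)) q := by
  have h : ((a, b) : E₁ × E₂) = (a, 0) + (0, b) := by simp
  simp only [field]
  rw [h]
  exact map_add (mfderiv 𝓘(ℝ, E) 𝓘(ℝ, E₁ × E₂) e q).inverse _ _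

/-- The coordinates `e` are adapted to the splitting into `D₁` and `D₂`. -/
structure IsAdapted (e : PartialDiffeomorph 𝓘(ℝ, E) 𝓘(ℝ, E₁ × E₂) M (E₁ × E₂) ∞)
    (D₁ D₂ : Π p : M, Submodule ℝ (TangentSpace 𝓘(ℝ, E) p)) : Prop where
  leaf : ∀ q ∈ e.source, ∀ w w', e.field (fun _ ↦ (w, w')) q ∈ D₁ q ↔ w' = 0
  fibre : ∀ q ∈ e.source, ∀ w w', e.field (fun _ ↦ (w, w')) q ∈ D₂ q ↔ w = 0

namespace IsAdapted

variable {g} {D₁ D₂ : Π p : M, Submodule ℝ (TangentSpace 𝓘(ℝ, E) p)}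
  {P : Π p : M, TangentSpace 𝓘(ℝ, E) p →ₗ[ℝ] TangentSpace 𝓘(ℝ, E) p}
  {e : PartialDiffeomorph 𝓘(ℝ, E) 𝓘(ℝ, E₁ × E₂) M (E₁ × E₂) ∞}
  (he : e.IsAdapted D₁ D₂) (horth : ∀ p, ∀ u ∈ D₁ p, ∀ v ∈ D₂ p, g.inner p u v = 0)
  {q : M} (hq : q ∈ e.source) {σ : M → ℝ}
include he hq

theorem exists_eq_leaf {v : TangentSpace 𝓘(ℝ, E) q} (hv : v ∈ D₁ q) :
    ∃ w : E₁, e.field (fun _ ↦ (w, 0)) q = v := by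
  obtain ⟨⟨w, w'⟩, hw⟩ : ∃ w : E₁ × E₂, w = mfderiv 𝓘(ℝ, E) 𝓘(ℝ, E₁ × E₂) e q v := ⟨_, rfl⟩
  have h := field_mfderiv (e := e) hq v (ξ := fun _ ↦ (w, w')) hw
  obtain rfl : w' = 0 := (he.leaf q hq w w').1 (h ▸ hv)
  exact ⟨w, h⟩

theorem exists_eq_fibre {v : TangentSpace 𝓘(ℝ, E) q} (hv : v ∈ D₂ q) :
    ∃ w : E₂, e.field (fun _ ↦ (0, w)) q = v := by
  obtain ⟨⟨w, w'⟩, hw⟩ : ∃ w : E₁ × E₂, w = mfderiv 𝓘(ℝ, E) 𝓘(ℝ, E₁ × E₂) e q v := ⟨_, rfl⟩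
  have h := field_mfderiv (e := e) hq v (ξ := fun _ ↦ (w, w')) hw
  obtain rfl : w = 0 := (he.fibre q hq w w').1 (h ▸ hv)
  exact ⟨w', h⟩

include horth

theorem coeff_mixed (w : E₁) (x : E₂) : e.coeff g (w, 0) (0, x) q = 0 :=
  horth q _ ((he.leaf q hq w 0).2 rfl) _ ((he.fibre q hq 0 x).2 rfl)

theorem coeff_mixed' (w : E₁) (x : E₂) : e.coeff g (0, x) (w, 0) q = 0 := by
  rw [coeff_comm]
  exact he.coeff_mixed horth hq w x

theorem mvfderiv_coeff_mixed (w : E₁) (x : E₂) (u : TangentSpace 𝓘(ℝ, E) q) :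
    mvfderiv 𝓘(ℝ, E) (e.coeff g (w, 0) (0, x)) q u = 0 := by
  have h : e.coeff g (w, 0) (0, x) =ᶠ[𝓝 q] fun _ ↦ 0 := by
    filter_upwards [e.open_source.mem_nhds hq] with y hy
    exact he.coeff_mixed horth hy w x
  rw [mvfderiv_congr_of_eventuallyEq h, mvfderiv_const, zero_apply]

theorem mvfderiv_coeff_mixed' (w : E₁) (x : E₂) (u : TangentSpace 𝓘(ℝ, E) q) :
    mvfderiv 𝓘(ℝ, E) (e.coeff g (0, x) (w, 0)) q u = 0 := by
  have h : e.coeff g (0, x) (w, 0) =ᶠ[𝓝 q] fun _ ↦ 0 := by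
    filter_upwards [e.open_source.mem_nhds hq] with y hy
    exact he.coeff_mixed' horth hy w x
  rw [mvfderiv_congr_of_eventuallyEq h, mvfderiv_const, zero_apply]

theorem mvfderiv_coeff_prod_leaf (a : E₁) (b : E₂) (w : E₁) (u : TangentSpace 𝓘(ℝ, E) q) :
    mvfderiv 𝓘(ℝ, E) (e.coeff g (a, b) (w, 0)) q u =
      mvfderiv 𝓘(ℝ, E) (e.coeff g (a, 0) (w, 0)) q u := by
  have h : e.coeff g (a, b) (w, 0) =ᶠ[𝓝 q] e.coeff g (a, 0) (w, 0) := by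
    filter_upwards [e.open_source.mem_nhds hq] with y hy
    have := he.coeff_mixed' horth hy w b
    simp only [coeff] at this ⊢
    rw [e.field_prod a b, map_add, add_apply, this, add_zero]
  rw [mvfderiv_congr_of_eventuallyEq h]

theorem mvfderiv_coeff_prod_fibre (a : E₁) (b : E₂) (x : E₂) (u : TangentSpace 𝓘(ℝ, E) q) :
    mvfderiv 𝓘(ℝ, E) (e.coeff g (a, b) (0, x)) q u =
      mvfderiv 𝓘(ℝ, E) (e.coeff g (0, b) (0, x)) q u := by
  have h : e.coeff g (a, b) (0, x) =ᶠ[𝓝 q] e.coeff g (0, b) (0, x) := by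
    filter_upwards [e.open_source.mem_nhds hq] with y hy
    have := he.coeff_mixed horth hy a x
    simp only [coeff] at this ⊢
    rw [e.field_prod a b, map_add, add_apply, this, zero_add]
  rw [mvfderiv_congr_of_eventuallyEq h]

section

variable {U : Set M} (hU : q ∈ U) (hσ : HasWarpedConnection g D₁ D₂ U σ)
include hU hσ

theorem eventually_fibre (x : E₂) : ∀ᶠ y in 𝓝 q, e.field (fun _ ↦ ((0 : E₁), x)) y ∈ D₂ y := by
  filter_upwards [e.open_source.mem_nhds hq] with y hy
  exact (he.fibre y hy 0 x).2 rfl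

/-- Koszul reduces 2⟨∇_w ∂_x, w'⟩ to the derivative of ⟨w, w'⟩ along x, while the connection
identity makes it a multiple of ⟨x, w⟩ = 0. -/
theorem mvfderiv_coeff_leaf (w w' : E₁) (x : E₂) :
    mvfderiv 𝓘(ℝ, E) (e.coeff g (w, 0) (w', 0)) q (e.field (fun _ ↦ (0, x)) q) = 0 := by
  have h1 := hσ q hU _ (mdifferentiableAt_field hq (by fun_prop))
    (he.eventually_fibre horth hq hU hσ x) (e.field (fun _ ↦ (w, 0)) q)
    (e.field (fun _ ↦ (w', 0)) q) ((he.leaf q hq w' 0).2 rfl)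
  have h2 := two_mul_inner_leviCivita_field g ((w, 0) : E₁ × E₂) (0, x) (w', 0) hq
  have h3 := he.coeff_mixed' horth hq w x
  rw [coeff] at h3
  rw [h1, h3, he.mvfderiv_coeff_mixed' horth hq, he.mvfderiv_coeff_mixed horth hq] at h2
  linarith

/-- Koszul reduces 2⟨∇_x ∂_x', w⟩ to minus the derivative of ⟨x, x'⟩ along w; by the connection
identity it is also -2 w[σ] ⟨x, x'⟩. -/
theorem mvfderiv_coeff_fibre (w : E₁) (x x' : E₂) :
    mvfderiv 𝓘(ℝ, E) (e.coeff g (0, x) (0, x')) q (e.field (fun _ ↦ (w, 0)) q) =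
      2 * mvfderiv 𝓘(ℝ, E) σ q (e.field (fun _ ↦ (w, 0)) q) * e.coeff g (0, x) (0, x') q := by
  have h1 := hσ q hU _ (mdifferentiableAt_field hq (by fun_prop))
    (he.eventually_fibre horth hq hU hσ x') (e.field (fun _ ↦ (0, x)) q)
    (e.field (fun _ ↦ (w, 0)) q) ((he.leaf q hq w 0).2 rfl)
  have h2 := two_mul_inner_leviCivita_field g ((0, x) : E₁ × E₂) (0, x') (w, 0) hq
  have h3 := e.coeff_comm g ((0, x) : E₁ × E₂) (0, x') q
  rw [h1, he.mvfderiv_coeff_mixed' horth hq, he.mvfderiv_coeff_mixed' horth hq] at h2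
  rw [h3]
  rw [coeff]
  linarith

end

/-- Converse of the two preceding computations. Differentiating ⟨X, ∂_w⟩ = 0 gives ⟨∇_u X, ∂_w⟩ =
-⟨X, ∇_u ∂_w⟩, which involves only the value of X at q; X may thus be treated as a coordinate field
∂_x in the Koszul formula. -/
theorem inner_leviCivita
    (h₁ : ∀ (w w' : E₁) (x : E₂),
      mvfderiv 𝓘(ℝ, E) (e.coeff g (w, 0) (w', 0)) q (e.field (fun _ ↦ (0, x)) q) = 0)
    (h₂ : ∀ (w : E₁) (x x' : E₂),
      mvfderiv 𝓘(ℝ, E) (e.coeff g (0, x) (0, x')) q (e.field (fun _ ↦ (w, 0)) q) =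
        2 * mvfderiv 𝓘(ℝ, E) σ q (e.field (fun _ ↦ (w, 0)) q) * e.coeff g (0, x) (0, x') q)
    {X : Π q : M, TangentSpace 𝓘(ℝ, E) q} (hX : MDiffAt (T% X) q)
    (hX₂ : ∀ᶠ y in 𝓝 q, X y ∈ D₂ y) (u : TangentSpace 𝓘(ℝ, E) q) {v : TangentSpace 𝓘(ℝ, E) q}
    (hv : v ∈ D₁ q) :
    g.inner q (g.leviCivita X q u) v = -mvfderiv 𝓘(ℝ, E) σ q v * g.inner q (X q) u := by
  obtain ⟨w, rfl⟩ := he.exists_eq_leaf hq hv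
  obtain ⟨x, hx⟩ := he.exists_eq_fibre hq hX₂.self_of_nhds
  obtain ⟨⟨a, b⟩, hab⟩ : ∃ w : E₁ × E₂, w = mfderiv 𝓘(ℝ, E) 𝓘(ℝ, E₁ × E₂) e q u := ⟨_, rfl⟩
  have hu := field_mfderiv (e := e) hq u (ξ := fun _ ↦ (a, b)) hab
  rw [← hu]
  have hW : ∀ w : E₁ × E₂, MDiffAt (T% (e.field fun _ ↦ w)) q := fun w ↦
    mdifferentiableAt_field hq (by fun_prop)
  have h3 := g.leviCivita_metric (hW (a, b)) hX (hW (w, 0))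
  have h4 : (fun y ↦ g.inner y (X y) (e.field (fun _ ↦ ((w, 0) : E₁ × E₂)) y)) =ᶠ[𝓝 q]
      fun _ ↦ 0 := by
    filter_upwards [hX₂, e.open_source.mem_nhds hq] with y hy hyq
    rw [g.symm]
    exact horth y _ ((he.leaf y hyq w 0).2 rfl) _ hy
  rw [mvfderiv_congr_of_eventuallyEq h4, mvfderiv_const, zero_apply, g.symm q (X q), ← hx] at h3
  have h5 := two_mul_inner_leviCivita_field g ((a, b) : E₁ × E₂) (w, 0) (0, x) hq
  rw [he.mvfderiv_coeff_mixed horth hq, he.mvfderiv_coeff_prod_leaf horth hq,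
    he.mvfderiv_coeff_prod_fibre horth hq, h₁, h₂] at h5
  have h6 := he.coeff_mixed' horth hq a x
  have h7 := e.coeff_comm g ((0, x) : E₁ × E₂) (0, b) q
  simp only [coeff] at h5 h6 h7
  rw [← hx, e.field_prod a b, map_add (g.inner q (e.field (fun _ ↦ ((0, x) : E₁ × E₂)) q)), h6, h7]
  rw [e.field_prod a b] at h5 h3
  linarith

end IsAdapted

end PartialDiffeomorph

end Adapted

/-! ## The connection of a warped product -/

section WarpedConnection

set_option linter.unusedSectionVars false

variable {E : Type*} [NormedAddCommGroup E] [NormedSpace ℝ E] [FiniteDimensional ℝ E]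
  {M : Type*} [TopologicalSpace M] [ChartedSpace E M] [IsManifold 𝓘(ℝ, E) ∞ M]
  {E₁ : Type*} [NormedAddCommGroup E₁] [NormedSpace ℝ E₁] [FiniteDimensional ℝ E₁]
  {M₁ : Type*} [TopologicalSpace M₁] [ChartedSpace E₁ M₁] [IsManifold 𝓘(ℝ, E₁) ∞ M₁]
  {E₂ : Type*} [NormedAddCommGroup E₂] [NormedSpace ℝ E₂] [FiniteDimensional ℝ E₂]
  {M₂ : Type*} [TopologicalSpace M₂] [ChartedSpace E₂ M₂] [IsManifold 𝓘(ℝ, E₂) ∞ M₂]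

theorem mvfderiv_real_comp {f : M → ℝ} {k : ℝ → ℝ} {k' : ℝ} {p : M} (hk : HasDerivAt k k' (f p))
    (hf : MDiffAt f p) (v : TangentSpace 𝓘(ℝ, E) p) :
    mvfderiv 𝓘(ℝ, E) (fun q ↦ k (f q)) p v = k' * mvfderiv 𝓘(ℝ, E) f p v := by
  have h1 := mfderiv_comp_apply p hk.differentiableAt.mdifferentiableAt hf v
  rw [mfderiv_eq_fderiv, hk.hasFDerivAt.fderiv] at h1
  exact h1.trans (ContinuousLinearMap.toSpanSingleton_apply ℝ k' _ |>.trans (mul_comm (mvfderiv 𝓘(ℝ, E) f p v) k'))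

namespace PartialDiffeomorph

/-- The product of coordinates on two manifolds. -/
def prodSpace (c₁ : PartialDiffeomorph 𝓘(ℝ, E₁) 𝓘(ℝ, E₁) M₁ E₁ ∞)
    (c₂ : PartialDiffeomorph 𝓘(ℝ, E₂) 𝓘(ℝ, E₂) M₂ E₂ ∞) :
    PartialDiffeomorph (𝓘(ℝ, E₁).prod 𝓘(ℝ, E₂)) 𝓘(ℝ, E₁ × E₂) (M₁ × M₂) (E₁ × E₂) ∞ where
  toPartialEquiv := c₁.toPartialEquiv.prod c₂.toPartialEquiv
  open_source := c₁.open_source.prod c₂.open_source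
  open_target := c₁.open_target.prod c₂.open_target
  contMDiffOn_toFun := by
    refine ContMDiffOn.prodMk_space ?_ ?_
    · exact c₁.contMDiffOn_toFun.comp contMDiff_fst.contMDiffOn fun x hx ↦ hx.1
    · exact c₂.contMDiffOn_toFun.comp contMDiff_snd.contMDiffOn fun x hx ↦ hx.2
  contMDiffOn_invFun := by
    refine ContMDiffOn.prodMk ?_ ?_
    · exact c₁.contMDiffOn_invFun.comp contDiff_fst.contMDiff.contMDiffOn fun x hx ↦ hx.1
    · exact c₂.contMDiffOn_invFun.comp contDiff_snd.contMDiff.contMDiffOn fun x hx ↦ hx.2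

variable {c₁ : PartialDiffeomorph 𝓘(ℝ, E₁) 𝓘(ℝ, E₁) M₁ E₁ ∞}
  {c₂ : PartialDiffeomorph 𝓘(ℝ, E₂) 𝓘(ℝ, E₂) M₂ E₂ ∞}

theorem mfderiv_prodSpace {b : M₁ × M₂} (hb : b ∈ (c₁.prodSpace c₂).source)
    (u : TangentSpace 𝓘(ℝ, E₁) b.1) (v : TangentSpace 𝓘(ℝ, E₂) b.2) :
    mfderiv (𝓘(ℝ, E₁).prod 𝓘(ℝ, E₂)) 𝓘(ℝ, E₁ × E₂) (c₁.prodSpace c₂) b (u, v) =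
      ((mfderiv 𝓘(ℝ, E₁) 𝓘(ℝ, E₁) c₁ b.1 u : E₁), (mfderiv 𝓘(ℝ, E₂) 𝓘(ℝ, E₂) c₂ b.2 v : E₂)) := by
  have hd : MDifferentiableAt (𝓘(ℝ, E₁).prod 𝓘(ℝ, E₂)) 𝓘(ℝ, E₁ × E₂) (c₁.prodSpace c₂) b :=
    (c₁.prodSpace c₂).mdifferentiableAt (by simp) hb
  have h1 : mfderiv (𝓘(ℝ, E₁).prod 𝓘(ℝ, E₂)) 𝓘(ℝ, E₁) (fun y ↦ (c₁.prodSpace c₂ y).1) b (u, v) =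
      (mfderiv (𝓘(ℝ, E₁).prod 𝓘(ℝ, E₂)) 𝓘(ℝ, E₁ × E₂) (c₁.prodSpace c₂) b (u, v) : E₁ × E₂).1 := by
    have h := mfderiv_comp_apply b
      (ContinuousLinearMap.fst ℝ E₁ E₂).hasFDerivAt.differentiableAt.mdifferentiableAt hd (u, v)
    rw [mfderiv_eq_fderiv, ContinuousLinearMap.fderiv] at h
    exact h
  have h2 : mfderiv (𝓘(ℝ, E₁).prod 𝓘(ℝ, E₂)) 𝓘(ℝ, E₂) (fun y ↦ (c₁.prodSpace c₂ y).2) b (u, v) =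
      (mfderiv (𝓘(ℝ, E₁).prod 𝓘(ℝ, E₂)) 𝓘(ℝ, E₁ × E₂) (c₁.prodSpace c₂) b (u, v) : E₁ × E₂).2 := by
    have h := mfderiv_comp_apply b
      (ContinuousLinearMap.snd ℝ E₁ E₂).hasFDerivAt.differentiableAt.mdifferentiableAt hd (u, v)
    rw [mfderiv_eq_fderiv, ContinuousLinearMap.fderiv] at h
    exact h
  have h3 := mfderiv_comp_apply (I := 𝓘(ℝ, E₁).prod 𝓘(ℝ, E₂)) b
    (c₁.mdifferentiableAt (by simp) hb.1) mdifferentiableAt_fst (u, v)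
  have h4 := mfderiv_comp_apply (I := 𝓘(ℝ, E₁).prod 𝓘(ℝ, E₂)) b
    (c₂.mdifferentiableAt (by simp) hb.2) mdifferentiableAt_snd (u, v)
  rw [mfderiv_fst] at h3
  rw [mfderiv_snd] at h4
  exact Prod.ext (h1.symm.trans h3) (h2.symm.trans h4)

theorem field_eq_mfderiv_prod {e : PartialDiffeomorph 𝓘(ℝ, E) 𝓘(ℝ, E₁ × E₂) M (E₁ × E₂) ∞}
    {Φ : M₁ × M₂ → M} {b : M₁ × M₂}
    (hΦ : MDifferentiableAt (𝓘(ℝ, E₁).prod 𝓘(ℝ, E₂)) 𝓘(ℝ, E) Φ b) (hb : Φ b ∈ e.source)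
    (hbc : b ∈ (c₁.prodSpace c₂).source) (he : ∀ᶠ y in 𝓝 b, e (Φ y) = c₁.prodSpace c₂ y)
    (w : E₁) (x : E₂) :
    e.field (fun _ ↦ (w, x)) (Φ b) = mfderiv (𝓘(ℝ, E₁).prod 𝓘(ℝ, E₂)) 𝓘(ℝ, E) Φ b
      (c₁.field (fun _ ↦ w) b.1, c₂.field (fun _ ↦ x) b.2) := by
  refine field_mfderiv hb _ ?_
  have h1 := mfderiv_comp_apply b (e.mdifferentiableAt (by simp) hb) hΦ
    (c₁.field (fun _ ↦ w) b.1, c₂.field (fun _ ↦ x) b.2)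
  refine Eq.trans ?_ h1
  have h2 : (e ∘ Φ) =ᶠ[𝓝 b] c₁.prodSpace c₂ := he
  have h3 := mfderiv_prodSpace hbc (c₁.field (fun _ ↦ w) b.1) (c₂.field (fun _ ↦ x) b.2)
  rw [mfderiv_field _ hbc.1, mfderiv_field _ hbc.2] at h3
  exact (h3.symm.trans (congrArg (fun L : E₁ × E₂ →L[ℝ] E₁ × E₂ ↦ L _) h2.mfderiv_eq.symm))


variable {e : PartialDiffeomorph 𝓘(ℝ, E) 𝓘(ℝ, E₁ × E₂) M (E₁ × E₂) ∞} {q : M}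

theorem mvfderiv_comp_fst (hq : q ∈ e.source) {f : M → ℝ} {G : E₁ → ℝ}
    (hG : DifferentiableAt ℝ G (e q).1) (hf : ∀ᶠ y in 𝓝 q, f y = G (e y).1) (w : E₁) (x : E₂) :
    mvfderiv 𝓘(ℝ, E) f q (e.field (fun _ ↦ (w, x)) q) = fderiv ℝ G (e q).1 w := by
  have h : HasFDerivAt (fun z : E₁ × E₂ ↦ G z.1)
      (fderiv ℝ G (e q).1 ∘L ContinuousLinearMap.fst ℝ E₁ E₂) (e q) :=
    hG.hasFDerivAt.comp (e q) hasFDerivAt_fst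
  rw [mvfderiv_comp hq h.differentiableAt hf, mfderiv_field _ hq, h.fderiv]
  rfl

theorem mvfderiv_comp_snd (hq : q ∈ e.source) {f : M → ℝ} {G : E₂ → ℝ}
    (hG : DifferentiableAt ℝ G (e q).2) (hf : ∀ᶠ y in 𝓝 q, f y = G (e y).2) (w : E₁) (x : E₂) :
    mvfderiv 𝓘(ℝ, E) f q (e.field (fun _ ↦ (w, x)) q) = fderiv ℝ G (e q).2 x := by
  have h : HasFDerivAt (fun z : E₁ × E₂ ↦ G z.2)
      (fderiv ℝ G (e q).2 ∘L ContinuousLinearMap.snd ℝ E₁ E₂) (e q) :=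
    hG.hasFDerivAt.comp (e q) hasFDerivAt_snd
  rw [mvfderiv_comp hq h.differentiableAt hf, mfderiv_field _ hq, h.fderiv]
  rfl

end PartialDiffeomorph

namespace IsWarpedParametrization

variable {g : RiemMetric E M} {D₁ D₂ : Π p : M, Submodule ℝ (TangentSpace 𝓘(ℝ, E) p)}
  {g₁ : RiemMetric E₁ M₁} {g₂ : RiemMetric E₂ M₂} {f₁ : M₁ → ℝ} {Φ : M₁ × M₂ → M}
  (h : IsWarpedParametrization g D₁ D₂ g₁ g₂ f₁ Φ)
include h

/-- A local inverse of Φ followed by a product of charts. Coordinate fields on M are then images of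
pairs of coordinate fields on the factors, so the metric coefficients can be read from `metric`. -/
theorem exists_coordinates (c₁ : PartialDiffeomorph 𝓘(ℝ, E₁) 𝓘(ℝ, E₁) M₁ E₁ ∞)
    (c₂ : PartialDiffeomorph 𝓘(ℝ, E₂) 𝓘(ℝ, E₂) M₂ E₂ ∞) {a : M₁ × M₂}
    (hc : a ∈ (c₁.prodSpace c₂).source) :
    ∃ e : PartialDiffeomorph 𝓘(ℝ, E) 𝓘(ℝ, E₁ × E₂) M (E₁ × E₂) ∞, Φ a ∈ e.source ∧
      ∀ q ∈ e.source, ∃ b ∈ (c₁.prodSpace c₂).source, Φ b = q ∧ e q = c₁.prodSpace c₂ b ∧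
        ∀ w x, e.field (fun _ ↦ (w, x)) (Φ b) = mfderiv (𝓘(ℝ, E₁).prod 𝓘(ℝ, E₂)) 𝓘(ℝ, E) Φ b
          (c₁.field (fun _ ↦ w) b.1, c₂.field (fun _ ↦ x) b.2) := by
  obtain ⟨Ψ, ha, hΨ⟩ := h.localDiffeomorph a
  have hs : ∀ y ∈ Ψ.source, Ψ.symm (Φ y) = y := fun y hy ↦ by
    rw [hΨ hy]
    exact Ψ.left_inv hy
  refine ⟨Ψ.symm.trans (c₁.prodSpace c₂), ⟨?_, ?_⟩, ?_⟩
  · rw [hΨ ha]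
    exact Ψ.map_source ha
  · change Ψ.symm (Φ a) ∈ (c₁.prodSpace c₂).source
    rwa [hs a ha]
  · intro q hq
    have hq1 : q ∈ Ψ.target := hq.1
    have hb : Ψ.symm q ∈ Ψ.source := Ψ.map_target hq1
    have hbq : Φ (Ψ.symm q) = q := (hΨ hb).trans (Ψ.right_inv hq1)
    refine ⟨Ψ.symm q, hq.2, hbq, rfl, fun w x ↦ ?_⟩
    refine PartialDiffeomorph.field_eq_mfderiv_prod
      ((h.localDiffeomorph _).mdifferentiableAt (by simp)) (hbq.symm ▸ hq) hq.2 ?_ w x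
    filter_upwards [Ψ.open_source.mem_nhds hb] with y hy
    exact congrArg (c₁.prodSpace c₂) (hs y hy)

theorem connection {f : M → ℝ} (hf : ∀ a, f (Φ a) = f₁ a.1)
    (horth : ∀ p, ∀ u ∈ D₁ p, ∀ v ∈ D₂ p, g.inner p u v = 0) (a : M₁ × M₂) :
    CMDiffAt ∞ f (Φ a) ∧
    (∀ Y ∈ D₂ (Φ a), mvfderiv 𝓘(ℝ, E) (fun q ↦ Real.log (f q)) (Φ a) Y = 0) ∧
    ∀ X : Π q : M, TangentSpace 𝓘(ℝ, E) q, MDiffAt (T% X) (Φ a) →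
      (∀ᶠ q in 𝓝 (Φ a), X q ∈ D₂ q) → ∀ u, ∀ v ∈ D₁ (Φ a),
        g.inner (Φ a) (g.leviCivita X (Φ a) u) v =
          -mvfderiv 𝓘(ℝ, E) (fun q ↦ Real.log (f q)) (Φ a) v * g.inner (Φ a) (X (Φ a)) u := by
  obtain ⟨c₁, hc₁⟩ : ∃ c : PartialDiffeomorph 𝓘(ℝ, E₁) 𝓘(ℝ, E₁) M₁ E₁ ∞, a.1 ∈ c.source :=
    ⟨chartDiffeomorph a.1, mem_chartDiffeomorph_source a.1⟩
  obtain ⟨c₂, hc₂⟩ : ∃ c : PartialDiffeomorph 𝓘(ℝ, E₂) 𝓘(ℝ, E₂) M₂ E₂ ∞, a.2 ∈ c.source :=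
    ⟨chartDiffeomorph a.2, mem_chartDiffeomorph_source a.2⟩
  obtain ⟨e, hea, he⟩ := h.exists_coordinates c₁ c₂ (a := a) ⟨hc₁, hc₂⟩
  have hfield₁ : ∀ b : M₁, c₁.field (fun _ ↦ 0) b = 0 := fun b ↦
    map_zero (mfderiv 𝓘(ℝ, E₁) 𝓘(ℝ, E₁) c₁ b).inverse
  have hfield₂ : ∀ b : M₂, c₂.field (fun _ ↦ 0) b = 0 := fun b ↦
    map_zero (mfderiv 𝓘(ℝ, E₂) 𝓘(ℝ, E₂) c₂ b).inverse
  have had : e.IsAdapted D₁ D₂ := by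
    constructor <;> intro q hq w x <;> obtain ⟨b, hb, rfl, -, hfb⟩ := he q hq <;> rw [hfb]
    · rw [h.leaf]
      refine ⟨fun h0 ↦ ?_, fun h0 ↦ h0 ▸ hfield₂ _⟩
      have := PartialDiffeomorph.mfderiv_field (e := c₂) (fun _ ↦ x) hb.2
      rw [h0, map_zero] at this
      exact this.symm
    · rw [h.fibre]
      refine ⟨fun h0 ↦ ?_, fun h0 ↦ h0 ▸ hfield₁ _⟩
      have := PartialDiffeomorph.mfderiv_field (e := c₁) (fun _ ↦ w) hb.1
      rw [h0, map_zero] at this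
      exact this.symm
  have hl₁ : ∀ b ∈ (c₁.prodSpace c₂).source, c₁.symm (c₁ b.1) = b.1 := fun b hb ↦ c₁.left_inv hb.1
  have hl₂ : ∀ b ∈ (c₁.prodSpace c₂).source, c₂.symm (c₂ b.2) = b.2 := fun b hb ↦ c₂.left_inv hb.2
  -- In these coordinates f and the leaf coefficients are functions of the first coordinate alone,
  -- and the fibre coefficients are f² times a function of the second coordinate.
  have hfe : ∀ q ∈ e.source, f q = f₁ (c₁.symm (e q).1) := fun q hq ↦ by
    obtain ⟨b, hb, rfl, heb, -⟩ := he q hq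
    rw [hf, heb]
    exact congrArg f₁ (hl₁ b hb).symm
  have hg₁ : ∀ w w', ∀ q ∈ e.source, e.coeff g (w, 0) (w', 0) q =
      c₁.coeff g₁ w w' (c₁.symm (e q).1) := fun w w' q hq ↦ by
    obtain ⟨b, hb, rfl, heb, hfb⟩ := he q hq
    rw [PartialDiffeomorph.coeff, hfb, hfb, h.metric, hfield₂, map_zero, mul_zero, add_zero, heb]
    exact congrArg (c₁.coeff g₁ w w') (hl₁ b hb).symm
  have hg₂ : ∀ x x', ∀ q ∈ e.source, e.coeff g (0, x) (0, x') q =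
      f q ^ 2 * c₂.coeff g₂ x x' (c₂.symm (e q).2) := fun w w' q hq ↦ by
    obtain ⟨b, hb, rfl, heb, hfb⟩ := he q hq
    rw [PartialDiffeomorph.coeff, hfb, hfb, h.metric, hfield₁, map_zero, zero_add, heb, hf]
    exact congrArg (fun t ↦ f₁ b.1 ^ 2 * c₂.coeff g₂ w w' t) (hl₂ b hb).symm
  obtain ⟨b, hb, hba, heb, -⟩ := he (Φ a) hea
  obtain rfl : b = a := h.injective hba
  have hd : ∀ {k : M₁ → ℝ}, CMDiffAt ∞ k b.1 →
      ContDiffAt ℝ ∞ (fun z ↦ k (c₁.symm z)) (e (Φ b)).1 := fun hk ↦ by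
    rw [heb]
    exact PartialDiffeomorph.contDiffAt_comp_symm hb.1 hk
  have hd' : ∀ {k : M₂ → ℝ}, CMDiffAt ∞ k b.2 →
      ContDiffAt ℝ ∞ (fun z ↦ k (c₂.symm z)) (e (Φ b)).2 := fun hk ↦ by
    rw [heb]
    exact PartialDiffeomorph.contDiffAt_comp_symm hb.2 hk
  have hnhds := e.open_source.mem_nhds hea
  have hf₁ := hd (h.smooth b.1)
  have hfpos : 0 < f (Φ b) := by rw [hf]; exact h.pos _
  have hfs : CMDiffAt ∞ f (Φ b) := by
    have h1 : ContDiffAt ℝ ∞ (fun z : E₁ × E₂ ↦ f₁ (c₁.symm z.1)) (e (Φ b)) :=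
      hf₁.comp (e (Φ b)) contDiffAt_fst
    have h2 := h1.contMDiffAt.comp (Φ b) (e.contMDiffAt hea)
    refine h2.congr_of_eventuallyEq ?_
    filter_upwards [hnhds] with y hy
    exact hfe y hy
  have hlog : ∀ v, mvfderiv 𝓘(ℝ, E) (fun q ↦ Real.log (f q)) (Φ b) v =
      (f (Φ b))⁻¹ * mvfderiv 𝓘(ℝ, E) f (Φ b) v := fun v ↦
    mvfderiv_real_comp (Real.hasDerivAt_log hfpos.ne') (hfs.mdifferentiableAt (by simp)) v
  have hY : ∀ x, mvfderiv 𝓘(ℝ, E) f (Φ b) (e.field (fun _ ↦ (0, x)) (Φ b)) = 0 := fun x ↦ by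
    rw [PartialDiffeomorph.mvfderiv_comp_fst hea (hf₁.differentiableAt (by simp)), map_zero]
    filter_upwards [hnhds] with y hy
    exact hfe y hy
  refine ⟨hfs, fun Y hY' ↦ ?_, fun X hX hX₂ u v hv ↦
    had.inner_leviCivita horth hea (fun w w' x ↦ ?_) (fun w x x' ↦ ?_) hX hX₂ u hv⟩
  · obtain ⟨x, rfl⟩ := had.exists_eq_fibre hea hY'
    rw [hlog, hY, mul_zero]
  · have h1 := hd (PartialDiffeomorph.contMDiffAt_coeff g₁ w w' hb.1)
    rw [PartialDiffeomorph.mvfderiv_comp_fst hea (h1.differentiableAt (by simp)), map_zero]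
    filter_upwards [hnhds] with y hy
    exact hg₁ w w' y hy
  · have h1 := hd' (PartialDiffeomorph.contMDiffAt_coeff g₂ x x' hb.2)
    set k : M → ℝ := fun q ↦ c₂.coeff g₂ x x' (c₂.symm (e q).2) with hk
    have hkd : mvfderiv 𝓘(ℝ, E) k (Φ b) (e.field (fun _ ↦ (w, 0)) (Φ b)) = 0 := by
      rw [PartialDiffeomorph.mvfderiv_comp_snd hea (h1.differentiableAt (by simp))
        (Filter.Eventually.of_forall fun y ↦ rfl), map_zero]
    have hkm : MDiffAt k (Φ b) := by
      have h2 : ContDiffAt ℝ ∞ (fun z : E₁ × E₂ ↦ c₂.coeff g₂ x x' (c₂.symm z.2)) (e (Φ b)) :=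
        h1.comp (e (Φ b)) contDiffAt_snd
      exact (h2.contMDiffAt.comp (Φ b) (e.contMDiffAt hea)).mdifferentiableAt (by simp)
    have hfm : MDiffAt f (Φ b) := hfs.mdifferentiableAt (by simp)
    have hff : MDiffAt (fun q ↦ f q * f q) (Φ b) := hfm.mul hfm
    -- The factor k is constant along the leaves, so only f² is differentiated and the logarithmic
    -- derivative is twice that of f.
    have h3 : e.coeff g (0, x) (0, x') =ᶠ[𝓝 (Φ b)] fun q ↦ f q * f q * k q := by
      filter_upwards [hnhds] with y hy
      rw [hg₂ x x' y hy, sq]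
    rw [mvfderiv_congr_of_eventuallyEq h3, h3.self_of_nhds, mvfderiv_fun_mul hff hkm,
      mvfderiv_fun_mul hfm hfm, hlog]
    simp only [add_apply, smul_apply, smul_eq_mul, hkd]
    field_simp
    ring

end IsWarpedParametrization

end WarpedConnection

/-! ## Metrics on vector spaces and linear splittings -/

section VectorSpace

variable {V : Type*} [NormedAddCommGroup V] [NormedSpace ℝ V] [FiniteDimensional ℝ V]

/-- By compactness of the unit sphere G v v dominates a positive multiple of ‖v‖². -/
theorem ContinuousLinearMap.isVonNBounded_of_posDef (G : V →L[ℝ] V →L[ℝ] ℝ)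
    (hG : ∀ v, v ≠ 0 → 0 < G v v) : Bornology.IsVonNBounded ℝ {v : V | G v v < 1} := by
  have hc : Continuous fun v ↦ G v v := by fun_prop
  rcases (Metric.sphere (0 : V) 1).eq_empty_or_nonempty with h | h
  · have hs : Subsingleton V := by
      rw [← not_nontrivial_iff_subsingleton]
      intro _
      exact (NormedSpace.sphere_nonempty (E := V).2 zero_le_one).ne_empty h
    exact (NormedSpace.isVonNBounded_iff' ℝ).2 ⟨0, fun v _ ↦ by simp [Subsingleton.elim v 0]⟩
  · obtain ⟨v₀, hv₀, hmin⟩ := (isCompact_sphere (0 : V) 1).exists_isMinOn h hc.continuousOn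
    have hv₀' : ‖v₀‖ = 1 := by simpa using hv₀
    have hpos : 0 < G v₀ v₀ := hG v₀ (by rintro rfl; simp at hv₀')
    -- The minimum G v₀ v₀ gives ‖v‖² ≤ (G v₀ v₀)⁻¹, and 2‖v‖ ≤ 1 + ‖v‖² turns this into a bound on
    -- ‖v‖ without a square root.
    refine (NormedSpace.isVonNBounded_iff' ℝ).2 ⟨(G v₀ v₀)⁻¹ + 1, fun v hv ↦ ?_⟩
    have hv1 : G v v < 1 := hv
    rcases eq_or_ne v 0 with rfl | hne
    · simp; positivity
    have hn : 0 < ‖v‖ := norm_pos_iff.2 hne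
    have h1 : G v₀ v₀ ≤ G (‖v‖⁻¹ • v) (‖v‖⁻¹ • v) := hmin (by
      rw [mem_sphere_zero_iff_norm, norm_smul, norm_inv, norm_norm, inv_mul_cancel₀ hn.ne'])
    simp only [map_smul, smul_apply, smul_eq_mul] at h1
    have h2 : G v₀ v₀ * ‖v‖ ^ 2 ≤ G v v := by
      have h3 := mul_le_mul_of_nonneg_right h1 (sq_nonneg ‖v‖)
      refine h3.trans_eq ?_
      field_simp
    have h4 : ‖v‖ ^ 2 ≤ (G v₀ v₀)⁻¹ := by
      rw [← one_div, le_div_iff₀ hpos]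
      linarith
    nlinarith [sq_nonneg (‖v‖ - 1), inv_pos.2 hpos]

/-- The tangent bundle of a vector space is trivialized by the identity, so smoothness in the bundle
sense is smoothness of `Gh`. -/
theorem contMDiff_bilinear (G : Π x : V, TangentSpace 𝓘(ℝ, V) x →L[ℝ] TangentSpace 𝓘(ℝ, V) x →L[ℝ] ℝ)
    {Gh : V → V →L[ℝ] V →L[ℝ] ℝ} (hG : ContDiff ℝ ∞ Gh) (h : ∀ x v w, G x v w = Gh x v w) :
    ContMDiff 𝓘(ℝ, V) (𝓘(ℝ, V).prod 𝓘(ℝ, V →L[ℝ] V →L[ℝ] ℝ)) ∞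
      (fun x ↦ TotalSpace.mk' (V →L[ℝ] V →L[ℝ] ℝ)
        (E := fun x : V ↦ TangentSpace 𝓘(ℝ, V) x →L[ℝ] TangentSpace 𝓘(ℝ, V) x →L[ℝ] ℝ) x (G x)) := by
  intro x
  rw [contMDiffAt_hom_bundle]
  refine ⟨contMDiffAt_id, (hG.contDiffAt.contMDiffAt (x := x)).congr_of_eventuallyEq
    (Filter.Eventually.of_forall fun y ↦ ?_)⟩
  have hb : y ∈ (trivializationAt V (TangentSpace 𝓘(ℝ, V) : V → Type _) x).baseSet := mem_univ y
  have hs : ∀ v : V, (trivializationAt V (TangentSpace 𝓘(ℝ, V) : V → Type _) x).symm y v = v :=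
    fun v ↦ (Trivialization.symmL_apply _ hb v).symm.trans
      (congrArg (fun L : V →L[ℝ] V ↦ L v) (TangentBundle.symmL_model_space x y))
  ext v w
  refine (inCoordinates_apply_eq₂ (x := y) hb hb (by simp)).trans ?_
  refine Eq.trans ?_ (h y v w)
  rw [hs, hs]
  simp

/-- The Riemannian metric on a vector space given by a smooth field of inner products. -/
def RiemMetric.ofContDiff (G : V → V →L[ℝ] V →L[ℝ] ℝ) (hG : ContDiff ℝ ∞ G)
    (hsymm : ∀ x v w, G x v w = G x w v) (hpos : ∀ x v, v ≠ 0 → 0 < G x v v) : RiemMetric V V where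
  inner x := G x
  symm x v w := hsymm x v w
  pos x v hv := hpos x v hv
  isVonNBounded x := (G x).isVonNBounded_of_posDef (hpos x)
  contMDiff := contMDiff_bilinear G hG fun _ _ _ ↦ rfl

/-- The space is the sum of the kernel and the range of P, in this order; each is given Euclidean
coordinates because the factors of a warped product are modelled on Euclidean spaces. -/
theorem ContinuousLinearMap.exists_splitting (P : V →L[ℝ] V) (hP : ∀ v, P (P v) = P v) :
    ∃ (m₁ m₂ : ℕ) (L : V ≃L[ℝ] EuclideanSpace ℝ (Fin m₁) × EuclideanSpace ℝ (Fin m₂)),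
      ∀ v, (P v = v ↔ (L v).1 = 0) ∧ (P v = 0 ↔ (L v).2 = 0) := by
  let K : Submodule ℝ V := LinearMap.ker P.toLinearMap
  let R : Submodule ℝ V := LinearMap.ker (LinearMap.id - P.toLinearMap)
  have hK : ∀ v, v ∈ K ↔ P v = 0 := fun v ↦ Iff.rfl
  have hR : ∀ v, v ∈ R ↔ P v = v := fun v ↦ by
    simp only [R, LinearMap.mem_ker, LinearMap.sub_apply, LinearMap.id_apply, sub_eq_zero]
    exact eq_comm
  have hKR : IsCompl K R := by
    constructor
    · rw [Submodule.disjoint_def]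
      intro v h1 h2
      rw [← (hR v).1 h2, (hK v).1 h1]
    · rw [codisjoint_iff, eq_top_iff]
      intro v _
      rw [show v = (v - P v) + P v by abel]
      exact Submodule.add_mem_sup ((hK _).2 (by rw [map_sub, hP, sub_self])) ((hR _).2 (hP v))
  let S := Submodule.prodEquivOfIsCompl K R hKR
  let L := S.symm.toContinuousLinearEquiv.trans
    ((toEuclidean (E := K)).prodCongr (toEuclidean (E := R)))
  refine ⟨_, _, L, fun v ↦ ?_⟩
  obtain ⟨⟨k, r⟩, rfl⟩ := S.surjective v
  have h1 : L (S (k, r)) = (toEuclidean k, toEuclidean r) := by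
    have : S.symm (S (k, r)) = (k, r) := S.symm_apply_apply _
    simp [L, this]
  have h2 : S (k, r) = k + r := Submodule.coe_prodEquivOfIsCompl' K R hKR (k, r)
  have h3 : P k = 0 := k.2
  have h4 : P r = r := (hR r).1 r.2
  rw [h1, h2, map_add, h3, h4]
  simp

theorem eq_of_fderiv_inr_eq_zero {E₁ E₂ : Type*} [NormedAddCommGroup E₁] [NormedSpace ℝ E₁]
    [NormedAddCommGroup E₂] [NormedSpace ℝ E₂] {f : E₁ × E₂ → ℝ} (hf : Differentiable ℝ f)
    (h : ∀ z x, fderiv ℝ f z (0, x) = 0) (a : E₁) (b b' : E₂) : f (a, b) = f (a, b') := by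
  have h1 : ∀ y, HasFDerivAt (fun y ↦ f (a, y))
      (fderiv ℝ f (a, y) ∘L ContinuousLinearMap.inr ℝ E₁ E₂) y := fun y ↦
    (hf (a, y)).hasFDerivAt.comp y (hasFDerivAt_prodMk_right a y)
  refine is_const_of_fderiv_eq_zero (fun y ↦ (h1 y).differentiableAt) (fun y ↦ ?_) b b'
  rw [(h1 y).fderiv]
  ext x
  exact h _ x

theorem eq_of_fderiv_inl_eq_zero {E₁ E₂ : Type*} [NormedAddCommGroup E₁] [NormedSpace ℝ E₁]
    [NormedAddCommGroup E₂] [NormedSpace ℝ E₂] {f : E₁ × E₂ → ℝ} (hf : Differentiable ℝ f)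
    (h : ∀ z w, fderiv ℝ f z (w, 0) = 0) (a a' : E₁) (b : E₂) : f (a, b) = f (a', b) := by
  have h1 : ∀ y, HasFDerivAt (fun y ↦ f (y, b))
      (fderiv ℝ f (y, b) ∘L ContinuousLinearMap.inl ℝ E₁ E₂) y := fun y ↦
    (hf (y, b)).hasFDerivAt.comp y (hasFDerivAt_prodMk_left y b)
  refine is_const_of_fderiv_eq_zero (fun y ↦ (h1 y).differentiableAt) (fun y ↦ ?_) a a'
  rw [(h1 y).fderiv]
  ext x
  exact h _ x

end VectorSpace

/-! ## Existence of adapted coordinates -/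

section Existence

set_option linter.unusedSectionVars false

variable {E : Type*} [NormedAddCommGroup E] [NormedSpace ℝ E] [FiniteDimensional ℝ E]
  {M : Type*} [TopologicalSpace M] [ChartedSpace E M] [IsManifold 𝓘(ℝ, E) ∞ M]

theorem OpenPartialHomeomorph.fderiv_univBall_symm_eq_zero_iff {V : Type*} [NormedAddCommGroup V]
    [InnerProductSpace ℝ V] {a y : V} {r : ℝ} (hy : y ∈ Metric.ball a r) :
    DifferentiableAt ℝ (OpenPartialHomeomorph.univBall a r).symm y ∧ ∀ w,
      fderiv ℝ (OpenPartialHomeomorph.univBall a r).symm y w = 0 ↔ w = 0 := by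
  have hr : 0 < r := Metric.pos_of_mem_ball hy
  have hs : DifferentiableAt ℝ (OpenPartialHomeomorph.univBall a r).symm y :=
    ((OpenPartialHomeomorph.contDiffOn_univBall_symm (n := 1) y hy).contDiffAt
      (Metric.isOpen_ball.mem_nhds hy)).differentiableAt (by simp)
  refine ⟨hs, fun w ↦ ⟨fun h ↦ ?_, fun h ↦ by rw [h, map_zero]⟩⟩
  have hβ : DifferentiableAt ℝ (OpenPartialHomeomorph.univBall a r)
      ((OpenPartialHomeomorph.univBall a r).symm y) :=
    (OpenPartialHomeomorph.contDiff_univBall (n := 1)).contDiffAt.differentiableAt (by simp)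
  have h1 := hβ.hasFDerivAt.comp y hs.hasFDerivAt
  have h2 : HasFDerivAt (fun z : V ↦ z) ((fderiv ℝ (OpenPartialHomeomorph.univBall a r)
      ((OpenPartialHomeomorph.univBall a r).symm y)).comp
      (fderiv ℝ (OpenPartialHomeomorph.univBall a r).symm y)) y := by
    refine h1.congr_of_eventuallyEq ?_
    filter_upwards [Metric.isOpen_ball.mem_nhds hy] with z hz
    exact ((OpenPartialHomeomorph.univBall a r).right_inv
      (OpenPartialHomeomorph.ball_subset_univBall_target a r hz)).symm
  have h3 := congrArg (fun L : V →L[ℝ] V ↦ L w) (h2.unique (hasFDerivAt_id y))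
  simp only [ContinuousLinearMap.comp_apply, h, map_zero] at h3
  exact h3.symm

/-- The product of the diffeomorphisms of two balls onto the ambient spaces. -/
def ballProdDiffeomorph {E₁ E₂ : Type*} [NormedAddCommGroup E₁] [InnerProductSpace ℝ E₁]
    [NormedAddCommGroup E₂] [InnerProductSpace ℝ E₂] (a : E₁ × E₂) {r : ℝ} (hr : 0 < r) :
    PartialDiffeomorph 𝓘(ℝ, E₁ × E₂) 𝓘(ℝ, E₁ × E₂) (E₁ × E₂) (E₁ × E₂) ∞ where
  toPartialEquiv := ((OpenPartialHomeomorph.univBall a.1 r).prod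
    (OpenPartialHomeomorph.univBall a.2 r)).symm.toPartialEquiv
  open_source := OpenPartialHomeomorph.open_source _
  open_target := OpenPartialHomeomorph.open_target _
  contMDiffOn_toFun := by
    refine ContDiffOn.contMDiffOn ?_
    have h := (OpenPartialHomeomorph.contDiffOn_univBall_symm (n := ⊤) (c := a.1) (r := r)).prodMap
      (OpenPartialHomeomorph.contDiffOn_univBall_symm (n := ⊤) (c := a.2) (r := r))
    refine h.mono ?_
    rintro ⟨x, y⟩ ⟨hx, hy⟩
    rw [OpenPartialHomeomorph.univBall_target _ hr] at hx hy
    exact ⟨hx, hy⟩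
  contMDiffOn_invFun := by
    refine ContDiffOn.contMDiffOn ?_
    exact ((OpenPartialHomeomorph.contDiff_univBall (n := ⊤)).prodMap
      (OpenPartialHomeomorph.contDiff_univBall (n := ⊤))).contDiffOn

theorem PartialDiffeomorph.IsAdapted.of_mfderiv {E₁ E₂ : Type*} [NormedAddCommGroup E₁]
    [NormedSpace ℝ E₁] [NormedAddCommGroup E₂] [NormedSpace ℝ E₂]
    {D₁ D₂ : Π p : M, Submodule ℝ (TangentSpace 𝓘(ℝ, E) p)}
    {e : PartialDiffeomorph 𝓘(ℝ, E) 𝓘(ℝ, E₁ × E₂) M (E₁ × E₂) ∞}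
    (he : ∀ q ∈ e.source, ∀ v (w : E₁ × E₂), w = mfderiv 𝓘(ℝ, E) 𝓘(ℝ, E₁ × E₂) e q v →
      (w.1 = 0 ↔ v ∈ D₂ q) ∧ (w.2 = 0 ↔ v ∈ D₁ q)) : e.IsAdapted D₁ D₂ where
  leaf q hq _ _ := (he q hq _ _ (mfderiv_field _ hq).symm).2.symm
  fibre q hq _ _ := (he q hq _ _ (mfderiv_field _ hq).symm).1.symm

theorem PartialDiffeomorph.mfderiv_trans {V V' : Type*} [NormedAddCommGroup V] [NormedSpace ℝ V]
    [NormedAddCommGroup V'] [NormedSpace ℝ V']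
    {e : PartialDiffeomorph 𝓘(ℝ, E) 𝓘(ℝ, V) M V ∞}
    {k : PartialDiffeomorph 𝓘(ℝ, V) 𝓘(ℝ, V') V V' ∞} {q : M} (hq : q ∈ (e.trans k).source)
    (v : TangentSpace 𝓘(ℝ, E) q) :
    mfderiv 𝓘(ℝ, E) 𝓘(ℝ, V') (e.trans k) q v =
      fderiv ℝ k (e q) (mfderiv 𝓘(ℝ, E) 𝓘(ℝ, V) e q v) := by
  have h := mfderiv_comp_apply q (k.mdifferentiableAt (by simp) hq.2)
    (e.mdifferentiableAt (by simp) hq.1) v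
  rw [mfderiv_eq_fderiv] at h
  exact h

/-- Coordinates adapted to a splitting can be shrunk so that their image is the whole space. -/
theorem exists_isAdapted_target_eq_univ {E₁ E₂ : Type*} [NormedAddCommGroup E₁]
    [InnerProductSpace ℝ E₁] [NormedAddCommGroup E₂] [InnerProductSpace ℝ E₂]
    {D₁ D₂ : Π p : M, Submodule ℝ (TangentSpace 𝓘(ℝ, E) p)}
    (e : PartialDiffeomorph 𝓘(ℝ, E) 𝓘(ℝ, E₁ × E₂) M (E₁ × E₂) ∞)
    (he : ∀ q ∈ e.source, ∀ v (w : E₁ × E₂), w = mfderiv 𝓘(ℝ, E) 𝓘(ℝ, E₁ × E₂) e q v →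
      (w.1 = 0 ↔ v ∈ D₂ q) ∧ (w.2 = 0 ↔ v ∈ D₁ q)) {p : M} (hp : p ∈ e.source) :
    ∃ e' : PartialDiffeomorph 𝓘(ℝ, E) 𝓘(ℝ, E₁ × E₂) M (E₁ × E₂) ∞, p ∈ e'.source ∧
      e'.source ⊆ e.source ∧ e'.target = univ ∧ e'.IsAdapted D₁ D₂ := by
  -- A ball for the sup norm is a product of two balls. Mapping each of them separately onto its
  -- whole factor preserves the directions of both families of slices.
  obtain ⟨r, hr, hrt⟩ := Metric.isOpen_iff.1 e.open_target (e p) (e.map_source hp)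
  have hball : Metric.ball (e p).1 r ×ˢ Metric.ball (e p).2 r ⊆ e.target := by
    rwa [ball_prod_same]
  have hsource : ∀ z, z ∈ (ballProdDiffeomorph (e p) hr).source ↔
      z.1 ∈ Metric.ball (e p).1 r ∧ z.2 ∈ Metric.ball (e p).2 r := fun z ↦ by
    rw [← OpenPartialHomeomorph.univBall_target (e p).1 hr,
      ← OpenPartialHomeomorph.univBall_target (e p).2 hr]
    rfl
  have htarget : ∀ z, z ∈ (ballProdDiffeomorph (e p) hr).target := fun z ↦ by
    have h1 : z ∈ (OpenPartialHomeomorph.univBall (e p).1 r).source ×ˢ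
      (OpenPartialHomeomorph.univBall (e p).2 r).source := by simp
    exact h1
  refine ⟨e.trans (ballProdDiffeomorph (e p) hr), ⟨hp, ?_⟩, fun q hq ↦ hq.1, ?_,
    PartialDiffeomorph.IsAdapted.of_mfderiv fun q hq v w hw ↦ ?_⟩
  · exact (hsource _).2 ⟨Metric.mem_ball_self hr, Metric.mem_ball_self hr⟩
  · refine eq_univ_of_forall fun z ↦ ⟨htarget z, ?_⟩
    have h1 := (ballProdDiffeomorph (e p) hr).map_target (htarget z)
    exact hball ((hsource _).1 h1)
  · have hq2 := (hsource _).1 hq.2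
    have h1 := OpenPartialHomeomorph.fderiv_univBall_symm_eq_zero_iff hq2.1
    have h2 := OpenPartialHomeomorph.fderiv_univBall_symm_eq_zero_iff hq2.2
    have h3 := h1.1.hasFDerivAt.prodMap (e q) h2.1.hasFDerivAt
    rw [PartialDiffeomorph.mfderiv_trans hq] at hw
    have h4 : fderiv ℝ (ballProdDiffeomorph (e p) hr) (e q) = _ := h3.fderiv
    rw [h4] at hw
    obtain ⟨w', hw'⟩ : ∃ w' : E₁ × E₂, w' = mfderiv 𝓘(ℝ, E) 𝓘(ℝ, E₁ × E₂) e q v := ⟨_, rfl⟩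
    rw [← hw'] at hw
    rw [← (he q hq.1 v w' hw').1, ← (he q hq.1 v w' hw').2, hw]
    exact ⟨h1.2 _, h2.2 _⟩

namespace IsOrthogonalSplitting

variable {g : RiemMetric E M} {D₁ D₂ : Π p : M, Submodule ℝ (TangentSpace 𝓘(ℝ, E) p)}
  {P : Π p : M, TangentSpace 𝓘(ℝ, E) p →ₗ[ℝ] TangentSpace 𝓘(ℝ, E) p}
  (h : IsOrthogonalSplitting g D₁ D₂ P) {U : Set M} {σ : M → ℝ}
include h

/-- The orthogonal complement of the fibres is involutive. -/
theorem mlieBracket_mem (hσ : HasWarpedConnection g D₁ D₂ U σ) {p : M} (hp : p ∈ U)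
    {X Y : Π q : M, TangentSpace 𝓘(ℝ, E) q} (hX : MDiffAt (T% X) p) (hY : MDiffAt (T% Y) p)
    (hX₁ : ∀ᶠ q in 𝓝 p, X q ∈ D₁ q) (hY₁ : ∀ᶠ q in 𝓝 p, Y q ∈ D₁ q) :
    mlieBracket 𝓘(ℝ, E) X Y p ∈ D₁ p := by
  set w := mlieBracket 𝓘(ℝ, E) X Y p with hw
  rw [← h.eq_zero_iff]
  obtain ⟨Z, hZ, hZ₂, hZw⟩ := h.exists_section ((h.eq_self_iff p (P p w)).1 (h.idem p w))
  -- ⟨∇_X Y, Z⟩ = -⟨Y, ∇_X Z⟩ = Y[σ] ⟨Z, X⟩ = 0 for a section Z of D₂. The bracket is the difference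
  -- of two such derivatives and is thus orthogonal to its own D₂-component, taken as the value of Z
  -- at p.
  have key : ∀ {X Y : Π q : M, TangentSpace 𝓘(ℝ, E) q}, MDiffAt (T% X) p → MDiffAt (T% Y) p →
      X p ∈ D₁ p → (∀ᶠ q in 𝓝 p, Y q ∈ D₁ q) →
      g.inner p (g.leviCivita Y p (X p)) (Z p) = 0 := by
    intro X Y hX hY hX₁ hY₁
    have h1 := g.leviCivita_metric hX hY hZ
    have h2 : (fun y ↦ g.inner y (Y y) (Z y)) =ᶠ[𝓝 p] fun _ ↦ 0 := by
      filter_upwards [hY₁, hZ₂] with y hy hy'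
      exact h.inner_eq_zero y _ hy _ hy'
    rw [mvfderiv_congr_of_eventuallyEq h2, mvfderiv_const, zero_apply, g.symm p (Y p),
      hσ p hp Z hZ hZ₂ (X p) (Y p) hY₁.self_of_nhds, g.symm p (Z p),
      h.inner_eq_zero p _ hX₁ _ hZ₂.self_of_nhds, mul_zero, add_zero] at h1
    exact h1.symm
  have h1 : g.inner p w (Z p) = 0 := by
    have h2 := g.leviCivita.torsion_eq_zero_iff.1 g.leviCivita_torsion hX hY
    rw [hw, ← h2, map_sub, sub_apply, key hX hY hX₁.self_of_nhds hY₁,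
      key hY hX hY₁.self_of_nhds hX₁, sub_zero]
  have h2 : w - P p w ∈ D₁ p := by
    rw [← h.eq_zero_iff, map_sub, h.idem, sub_self]
  have h3 := h.inner_eq_zero p _ h2 _ hZ₂.self_of_nhds
  rw [map_sub, sub_apply, h1, hZw, zero_sub, neg_eq_zero] at h3
  exact g.eq_zero_of_inner_self h3

/-- D₂ is involutive by hypothesis and D₁ by the connection identity, so Frobenius in a chart
straightens both at once; a linear isomorphism splits the model space, and shrinking makes the image
a full product of vector spaces. -/
theorem exists_adapted_coordinates (hint : IsIntegrable D₂) (hU : IsOpen U)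
    (hσ : HasWarpedConnection g D₁ D₂ U σ) {p : M} (hp : p ∈ U) :
    ∃ (m₁ m₂ : ℕ) (e : PartialDiffeomorph 𝓘(ℝ, E)
      𝓘(ℝ, EuclideanSpace ℝ (Fin m₁) × EuclideanSpace ℝ (Fin m₂)) M
      (EuclideanSpace ℝ (Fin m₁) × EuclideanSpace ℝ (Fin m₂)) ∞),
      p ∈ e.source ∧ e.source ⊆ U ∧ e.target = univ ∧ e.IsAdapted D₁ D₂ := by
  obtain ⟨Ph, hPh, hP⟩ := h.smooth p
  have hpc := mem_chartDiffeomorph_source (E := E) p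
  generalize chartDiffeomorph (E := E) p = c at *
  have hinj : ∀ q ∈ c.source, ∀ v v' : TangentSpace 𝓘(ℝ, E) q,
      mfderiv 𝓘(ℝ, E) 𝓘(ℝ, E) c q v = mfderiv 𝓘(ℝ, E) 𝓘(ℝ, E) c q v' ↔ v = v' :=
    fun q hq v v' ↦ by
      obtain ⟨A, hA⟩ := c.isInvertible_mfderiv hq
      rw [← hA]
      exact A.injective.eq_iff
  have hiff₂ : ∀ q ∈ c.source, ∀ v : TangentSpace 𝓘(ℝ, E) q, Ph (c q)
      (mfderiv 𝓘(ℝ, E) 𝓘(ℝ, E) c q v) = mfderiv 𝓘(ℝ, E) 𝓘(ℝ, E) c q v ↔ v ∈ D₂ q :=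
    fun q hq v ↦ by
      rw [hP q hq]
      exact (hinj q hq _ _).trans (h.eq_self_iff q v)
  have hiff₁ : ∀ q ∈ c.source, ∀ v : TangentSpace 𝓘(ℝ, E) q, Ph (c q)
      (mfderiv 𝓘(ℝ, E) 𝓘(ℝ, E) c q v) = 0 ↔ v ∈ D₁ q := fun q hq v ↦ by
    have h0 : mfderiv 𝓘(ℝ, E) 𝓘(ℝ, E) c q 0 = 0 := map_zero _
    rw [hP q hq, ← h.eq_zero_iff, ← hinj q hq, h0]
    rfl
  have hfield₂ : ∀ q ∈ c.source, ∀ ξ : E → E, Ph (c q) (ξ (c q)) = ξ (c q) ↔ c.field ξ q ∈ D₂ q :=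
    fun q hq ξ ↦ by
      rw [← hiff₂ q hq, PartialDiffeomorph.mfderiv_field _ hq]
  have hfield₁ : ∀ q ∈ c.source, ∀ ξ : E → E, Ph (c q) (ξ (c q)) = 0 ↔ c.field ξ q ∈ D₁ q :=
    fun q hq ξ ↦ by
      rw [← hiff₁ q hq, PartialDiffeomorph.mfderiv_field _ hq]
  set O : Set E := c.target ∩ c.symm ⁻¹' U
  have hO : IsOpen O := c.symm.toOpenPartialHomeomorph.continuousOn.isOpen_inter_preimage
    c.open_target hU
  have hOc : ∀ x ∈ O, ∃ q ∈ c.source, q ∈ U ∧ c q = x := fun x hx ↦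
    ⟨c.symm x, c.map_target hx.1, hx.2, c.right_inv hx.1⟩
  have hPP : ∀ x ∈ O, ∀ v, Ph x (Ph x v) = Ph x v := fun x hx v ↦ by
    obtain ⟨q, hq, -, rfl⟩ := hOc x hx
    obtain ⟨A, hA⟩ := c.isInvertible_mfderiv hq
    obtain ⟨v, rfl⟩ := A.surjective v
    have h1 := hP q hq v
    have h2 := hP q hq (P q v)
    rw [h.idem, ← h1, ← hA] at h2
    exact h2
  have hpre : ∀ W ⊆ O, IsOpen W → IsOpen (c.source ∩ c ⁻¹' W) := fun W _ hW ↦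
    c.toOpenPartialHomeomorph.continuousOn.isOpen_inter_preimage c.open_source hW
  have hinv₂ : IsInvolutiveOn Ph O := by
    intro W ξ η hW hWO hξ hη hPξ hPη x hx
    obtain ⟨q, hq, -, rfl⟩ := hOc x (hWO hx)
    have hd : ∀ {ξ : E → E}, ContDiffOn ℝ ∞ ξ W → ∀ y ∈ c ⁻¹' W, ContDiffAt ℝ ∞ ξ (c y) :=
      fun hξ y hy ↦ (hξ _ hy).contDiffAt (hW.mem_nhds hy)
    refine (hfield₂ q hq fun x ↦ fderiv ℝ η x (ξ x) - fderiv ℝ ξ x (η x)).2 ?_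
    rw [← PartialDiffeomorph.mlieBracket_field hq ((hd hξ q hx).differentiableAt (by simp))
      ((hd hη q hx).differentiableAt (by simp))]
    exact hint _ _ _ (hpre W hWO hW)
      (fun y hy ↦ (PartialDiffeomorph.contMDiffAt_field hy.1 (hd hξ y hy.2)).contMDiffWithinAt)
      (fun y hy ↦ (PartialDiffeomorph.contMDiffAt_field hy.1 (hd hη y hy.2)).contMDiffWithinAt)
      (fun y hy ↦ (hfield₂ y hy.1 ξ).1 (hPξ _ hy.2))
      (fun y hy ↦ (hfield₂ y hy.1 η).1 (hPη _ hy.2)) q ⟨hq, hx⟩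
  have hinv₁ : IsInvolutiveOn (fun x ↦ ContinuousLinearMap.id ℝ E - Ph x) O := by
    intro W ξ η hW hWO hξ hη hPξ hPη x hx
    obtain ⟨q, hq, hqU, rfl⟩ := hOc x (hWO hx)
    have hd : ∀ {ξ : E → E}, ContDiffOn ℝ ∞ ξ W → ∀ y ∈ c ⁻¹' W, DifferentiableAt ℝ ξ (c y) :=
      fun hξ y hy ↦ ((hξ _ hy).contDiffAt (hW.mem_nhds hy)).differentiableAt (by simp)
    have hn : ∀ᶠ y in 𝓝 q, y ∈ c.source ∩ c ⁻¹' W := (hpre W hWO hW).mem_nhds ⟨hq, hx⟩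
    have hsub : ∀ x v, (ContinuousLinearMap.id ℝ E - Ph x) v = v ↔ Ph x v = 0 := fun x v ↦ by
      rw [sub_apply, ContinuousLinearMap.id_apply, sub_eq_self]
    refine (hsub _ _).2 ((hfield₁ q hq fun x ↦ fderiv ℝ η x (ξ x) - fderiv ℝ ξ x (η x)).2 ?_)
    rw [← PartialDiffeomorph.mlieBracket_field hq (hd hξ q hx) (hd hη q hx)]
    refine h.mlieBracket_mem hσ hqU (PartialDiffeomorph.mdifferentiableAt_field hq (hd hξ q hx))
      (PartialDiffeomorph.mdifferentiableAt_field hq (hd hη q hx)) ?_ ?_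
    · filter_upwards [hn] with y hy
      exact (hfield₁ y hy.1 ξ).1 ((hsub _ _).1 (hPξ _ hy.2))
    · filter_upwards [hn] with y hy
      exact (hfield₁ y hy.1 η).1 ((hsub _ _).1 (hPη _ hy.2))
  have hx₀ : c p ∈ O := ⟨c.map_source hpc, by
    have h1 : c.symm (c p) = p := c.left_inv hpc
    change c.symm (c p) ∈ U
    rwa [h1]⟩
  obtain ⟨H, hHp, hHO, hH, hHs, hHP⟩ :=
    hinv₂.exists_product_chart hO (hPh.mono inter_subset_left) hPP hinv₁ hx₀
  obtain ⟨m₁, m₂, L, hL⟩ := (Ph (c p)).exists_splitting (hPP _ hx₀)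
  let Hd : PartialDiffeomorph 𝓘(ℝ, E) 𝓘(ℝ, E) E E ∞ :=
    { toPartialEquiv := H.toPartialEquiv
      open_source := H.open_source
      open_target := H.open_target
      contMDiffOn_toFun := hH.contMDiffOn
      contMDiffOn_invFun := hHs.contMDiffOn }
  let Ld := L.toDiffeomorph.toPartialDiffeomorph (n := ∞)
  have hs : ∀ q, q ∈ ((c.trans Hd).trans Ld).source ↔ q ∈ c.source ∧ c q ∈ H.source := fun q ↦
    ⟨fun hq ↦ hq.1, fun hq ↦ ⟨hq, mem_univ _⟩⟩
  have key : ∀ q ∈ ((c.trans Hd).trans Ld).source, ∀ (v : TangentSpace 𝓘(ℝ, E) q)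
      (w : EuclideanSpace ℝ (Fin m₁) × EuclideanSpace ℝ (Fin m₂)),
      w = mfderiv 𝓘(ℝ, E) 𝓘(ℝ, EuclideanSpace ℝ (Fin m₁) × EuclideanSpace ℝ (Fin m₂))
        ((c.trans Hd).trans Ld) q v → (w.1 = 0 ↔ v ∈ D₂ q) ∧ (w.2 = 0 ↔ v ∈ D₁ q) := by
    intro q hq v w hw
    have hq' := (hs q).1 hq
    rw [PartialDiffeomorph.mfderiv_trans hq, PartialDiffeomorph.mfderiv_trans hq.1] at hw
    have h4 : fderiv ℝ Ld ((c.trans Hd) q) = L := L.fderiv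
    rw [h4] at hw
    have h5 := hHP (c q) hq'.2 (mfderiv 𝓘(ℝ, E) 𝓘(ℝ, E) c q v)
    have h6 := hL (fderiv ℝ H (c q) (mfderiv 𝓘(ℝ, E) 𝓘(ℝ, E) c q v))
    rw [h5.1, h5.2, hiff₂ q hq'.1, hiff₁ q hq'.1] at h6
    rw [hw]
    exact ⟨h6.1.symm, h6.2.symm⟩
  obtain ⟨e, hpe, hes, het, hea⟩ := exists_isAdapted_target_eq_univ (D₁ := D₁) (D₂ := D₂)
    ((c.trans Hd).trans Ld) key (p := p) ((hs p).2 ⟨hpc, hHp⟩)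
  refine ⟨m₁, m₂, e, hpe, fun q hq ↦ ?_, het, hea⟩
  have h1 := (hs q).1 (hes hq)
  have h2 := (hHO h1.2).2
  have h3 : c.symm (c q) = q := c.left_inv h1.1
  change c.symm (c q) ∈ U at h2
  rwa [h3] at h2

end IsOrthogonalSplitting

end Existence

/-! ## The warped product in adapted coordinates -/

section WarpedProduct

set_option linter.unusedSectionVars false

variable {E : Type*} [NormedAddCommGroup E] [NormedSpace ℝ E] [FiniteDimensional ℝ E]
  {M : Type*} [TopologicalSpace M] [ChartedSpace E M] [IsManifold 𝓘(ℝ, E) ∞ M]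
  {V : Type*} [NormedAddCommGroup V] [NormedSpace ℝ V] [FiniteDimensional ℝ V]
  {E₁ : Type*} [NormedAddCommGroup E₁] [NormedSpace ℝ E₁] [FiniteDimensional ℝ E₁]
  {E₂ : Type*} [NormedAddCommGroup E₂] [NormedSpace ℝ E₂] [FiniteDimensional ℝ E₂]

namespace PartialDiffeomorph

theorem contDiff_form (g : RiemMetric E M) {e : PartialDiffeomorph 𝓘(ℝ, E) 𝓘(ℝ, V) M V ∞}
    (ht : e.target = univ) : ContDiff ℝ ∞ (e.form g.bilin) := by
  rw [← contDiffOn_univ, ← ht]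
  exact contDiffOn_form fun w w' q hq ↦ contMDiffAt_coeff g w w' hq

theorem form_pos (g : RiemMetric E M) {e : PartialDiffeomorph 𝓘(ℝ, E) 𝓘(ℝ, V) M V ∞}
    (ht : e.target = univ) (z : V) {w : V} (hw : w ≠ 0) : 0 < e.form g.bilin z w w := by
  have hq : e.symm z ∈ e.source := e.map_target (by rw [ht]; trivial)
  refine g.pos (e.symm z) (e.field (fun _ ↦ w) (e.symm z)) fun h0 ↦ hw ?_
  have h1 := mfderiv_field (e := e) (fun _ ↦ w) hq
  exact h1.symm.trans ((congrArg _ h0).trans (map_zero _))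

theorem form_symm (g : RiemMetric E M) (e : PartialDiffeomorph 𝓘(ℝ, E) 𝓘(ℝ, V) M V ∞)
    (z w w' : V) : e.form g.bilin z w w' = e.form g.bilin z w' w := g.symm _ _ _

/-- The metric, in coordinates that are onto, along a linear subspace moved by `i`. -/
def inducedMetric {V' : Type*} [NormedAddCommGroup V'] [NormedSpace ℝ V'] [FiniteDimensional ℝ V']
    (g : RiemMetric E M) (e : PartialDiffeomorph 𝓘(ℝ, E) 𝓘(ℝ, V) M V ∞) (ht : e.target = univ)
    (i : V' →L[ℝ] V) (hi : Function.Injective i) (c : ℝ) (hc : 0 < c) : RiemMetric V' V' :=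
  RiemMetric.ofContDiff (fun a ↦ (c • e.form g.bilin (i a)).bilinearComp i i)
    (by
      have h := (contDiff_form g ht).comp i.contDiff
      rw [contDiff_clm_apply_iff]
      intro w
      rw [contDiff_clm_apply_iff]
      intro w'
      exact contDiff_const.mul ((h.clm_apply contDiff_const).clm_apply contDiff_const))
    (fun a v w ↦ congrArg (c * ·) (form_symm g e _ _ _))
    (fun a v hv ↦ mul_pos hc (form_pos g ht _ ((map_ne_zero_iff i hi).2 hv)))

theorem fderiv_comp_symm {e : PartialDiffeomorph 𝓘(ℝ, E) 𝓘(ℝ, V) M V ∞} (ht : e.target = univ)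
    {f : M → ℝ} (hf : ∀ q ∈ e.source, CMDiffAt ∞ f q) :
    Differentiable ℝ (fun z ↦ f (e.symm z)) ∧ ∀ z w, fderiv ℝ (fun z ↦ f (e.symm z)) z w =
      mvfderiv 𝓘(ℝ, E) f (e.symm z) (e.field (fun _ ↦ w) (e.symm z)) := by
  have hz : ∀ z, e.symm z ∈ e.source := fun z ↦ e.map_target (by rw [ht]; trivial)
  have hez : ∀ z, e (e.symm z) = z := fun z ↦ e.right_inv (by rw [ht]; trivial)
  refine ⟨fun z ↦ ?_, fun z w ↦ ?_⟩
  · have h := contDiffAt_comp_symm (hz z) (hf _ (hz z))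
    rw [hez] at h
    exact h.differentiableAt (by simp)
  · rw [mvfderiv_eq_fderiv (hz z) (hf _ (hz z)), mfderiv_field _ (hz z), hez]

namespace IsAdapted

variable {g : RiemMetric E M} {D₁ D₂ : Π p : M, Submodule ℝ (TangentSpace 𝓘(ℝ, E) p)}
  {e : PartialDiffeomorph 𝓘(ℝ, E) 𝓘(ℝ, E₁ × E₂) M (E₁ × E₂) ∞}

/-- The factors are the vector spaces themselves: g₁ is the metric of the slice {b = 0} and g₂ that
of the slice {a = 0}, the latter divided by e^{2σ(0,0)} so that f² g₂ has the right size there. It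
remains to see that the coefficients elsewhere are forced by those on these slices. -/
theorem isWarpedParametrization (he : e.IsAdapted D₁ D₂) (ht : e.target = univ)
    (horth : ∀ p, ∀ u ∈ D₁ p, ∀ v ∈ D₂ p, g.inner p u v = 0) {U : Set M} (hU : e.source ⊆ U)
    {σ : M → ℝ} (hσ : HasWarpedConnection g D₁ D₂ U σ) (hs : ∀ q ∈ e.source, CMDiffAt ∞ σ q)
    (hσ₂ : ∀ q ∈ e.source, ∀ Y ∈ D₂ q, mvfderiv 𝓘(ℝ, E) σ q Y = 0) :
    IsWarpedParametrization g D₁ D₂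
      (inducedMetric g e ht (ContinuousLinearMap.inl ℝ E₁ E₂) LinearMap.inl_injective 1 one_pos)
      (inducedMetric g e ht (ContinuousLinearMap.inr ℝ E₁ E₂) LinearMap.inr_injective
        (Real.exp (-2 * σ (e.symm (0, 0)))) (Real.exp_pos _))
      (fun a ↦ Real.exp (σ (e.symm (a, 0)))) e.symm := by
  have hz : ∀ z, e.symm z ∈ e.source := fun z ↦ e.map_target (by rw [ht]; trivial)
  have hez : ∀ z, e (e.symm z) = z := fun z ↦ e.right_inv (by rw [ht]; trivial)
  have hσd := fderiv_comp_symm ht hs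
  have hσsnd : ∀ a b b', σ (e.symm (a, b)) = σ (e.symm (a, b')) :=
    eq_of_fderiv_inr_eq_zero hσd.1 fun z x ↦ by
      rw [hσd.2]
      exact hσ₂ _ (hz z) _ ((he.fibre _ (hz z) 0 x).2 rfl)
  have hleaf : ∀ (w w' : E₁) a b b', e.coeff g (w, 0) (w', 0) (e.symm (a, b)) =
      e.coeff g (w, 0) (w', 0) (e.symm (a, b')) := fun w w' ↦ by
    have h1 := fderiv_comp_symm ht fun q hq ↦ contMDiffAt_coeff g ((w, 0) : E₁ × E₂) (w', 0) hq
    refine eq_of_fderiv_inr_eq_zero h1.1 fun z x ↦ ?_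
    rw [h1.2]
    exact he.mvfderiv_coeff_leaf horth (hz z) (hU (hz z)) hσ w w' x
  -- Along the leaves the logarithmic derivative -2 w[σ] of the exponential cancels the growth rate
  -- 2 w[σ] of the coefficient.
  have hfibre : ∀ (x x' : E₂) a a' b,
      Real.exp (-2 * σ (e.symm (a, b))) * e.coeff g (0, x) (0, x') (e.symm (a, b)) =
      Real.exp (-2 * σ (e.symm (a', b))) * e.coeff g (0, x) (0, x') (e.symm (a', b)) :=
    fun x x' ↦ by
      have hexp : ContDiff ℝ ∞ fun t : ℝ ↦ Real.exp (-2 * t) := by fun_prop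
      have h0 : ∀ q ∈ e.source, CMDiffAt ∞ (fun q ↦ Real.exp (-2 * σ q)) q := fun q hq ↦
        hexp.contMDiff.contMDiffAt.comp q (hs q hq)
      have h1 := fderiv_comp_symm ht (f := fun q ↦ Real.exp (-2 * σ q) *
        e.coeff g (0, x) (0, x') q) fun q hq ↦
          (h0 q hq).mul (contMDiffAt_coeff g ((0, x) : E₁ × E₂) (0, x') hq)
      refine eq_of_fderiv_inl_eq_zero h1.1 fun z w ↦ ?_
      have hk : HasDerivAt (fun t : ℝ ↦ Real.exp (-2 * t))
          (Real.exp (-2 * σ (e.symm z)) * (-2 * 1)) (σ (e.symm z)) :=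
        ((hasDerivAt_id _).const_mul (-2)).exp
      rw [h1.2, mvfderiv_fun_mul ((h0 _ (hz z)).mdifferentiableAt (by simp))
        ((contMDiffAt_coeff g _ _ (hz z)).mdifferentiableAt (by simp))]
      simp only [add_apply, smul_apply, smul_eq_mul]
      rw [he.mvfderiv_coeff_fibre horth (hz z) (hU (hz z)) hσ w x x',
        mvfderiv_real_comp hk ((hs _ (hz z)).mdifferentiableAt (by simp))]
      ring
  let c₁ : PartialDiffeomorph 𝓘(ℝ, E₁) 𝓘(ℝ, E₁) E₁ E₁ ∞ :=
    (Diffeomorph.refl 𝓘(ℝ, E₁) E₁ ∞).toPartialDiffeomorph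
  let c₂ : PartialDiffeomorph 𝓘(ℝ, E₂) 𝓘(ℝ, E₂) E₂ E₂ ∞ :=
    (Diffeomorph.refl 𝓘(ℝ, E₂) E₂ ∞).toPartialDiffeomorph
  have hloc : IsLocalDiffeomorph (𝓘(ℝ, E₁).prod 𝓘(ℝ, E₂)) 𝓘(ℝ, E) ∞ e.symm := fun z ↦
    ⟨(c₁.prodSpace c₂).trans e.symm, ⟨⟨mem_univ _, mem_univ _⟩, by
      change _ ∈ e.target
      rw [ht]; trivial⟩, fun _ _ ↦ rfl⟩
  have hc₁ : ∀ (w a : E₁), c₁.field (fun _ ↦ w) a = w := fun w a ↦ by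
    refine field_mfderiv (e := c₁) (mem_univ a) w ?_
    change w = mfderiv 𝓘(ℝ, E₁) 𝓘(ℝ, E₁) id a w
    rw [mfderiv_id]; rfl
  have hc₂ : ∀ (x b : E₂), c₂.field (fun _ ↦ x) b = x := fun x b ↦ by
    refine field_mfderiv (e := c₂) (mem_univ b) x ?_
    change x = mfderiv 𝓘(ℝ, E₂) 𝓘(ℝ, E₂) id b x
    rw [mfderiv_id]; rfl
  have hfield : ∀ (z : E₁ × E₂) (u : E₁) (v : E₂),
      mfderiv (𝓘(ℝ, E₁).prod 𝓘(ℝ, E₂)) 𝓘(ℝ, E) e.symm z (u, v) =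
        e.field (fun _ ↦ (u, v)) (e.symm z) := fun z u v ↦ by
    have h1 := field_eq_mfderiv_prod (c₁ := c₁) (c₂ := c₂) (e := e) (Φ := e.symm) (b := z)
      ((hloc z).mdifferentiableAt (by simp)) (hz z) ⟨mem_univ _, mem_univ _⟩
      (Filter.Eventually.of_forall hez) u v
    rw [hc₁, hc₂] at h1
    exact h1.symm
  refine ⟨?_, fun a ↦ Real.exp_pos _, fun z z' h ↦ ?_, hloc, fun z u u' v v' ↦ ?_,
    fun z u v ↦ ?_, fun z u v ↦ ?_⟩
  · refine ContDiff.contMDiff (contDiff_iff_contDiffAt.2 fun a ↦ ?_)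
    have h1 := contDiffAt_comp_symm (hz (a, 0)) (hs _ (hz (a, 0)))
    rw [hez] at h1
    have h2 : ContDiffAt ℝ ∞ (fun a : E₁ ↦ (a, (0 : E₂))) a := by fun_prop
    have h3 : ContDiffAt ℝ ∞ (fun a : E₁ ↦ σ (e.symm (a, 0))) a :=
      ContDiffAt.comp (g := fun z ↦ σ (e.symm z)) a h1 h2
    exact Real.contDiff_exp.contDiffAt.comp a h3
  · rw [← hez z, ← hez z', h]
  · have key : ∀ (a : E₁) (b : E₂) (u u' : E₁) (v v' : E₂), e.coeff g (u, v) (u', v') (e.symm (a, b)) =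
        1 * e.coeff g (u, 0) (u', 0) (e.symm (a, 0)) + Real.exp (σ (e.symm (a, 0))) ^ 2 *
          (Real.exp (-2 * σ (e.symm (0, 0))) * e.coeff g (0, v) (0, v') (e.symm (0, b))) := by
      intro a b u u' v v'
      have h1 := he.coeff_mixed horth (hz (a, b)) u v'
      have h2 := he.coeff_mixed' horth (hz (a, b)) u' v
      have h3 := hleaf u u' a b 0
      -- σ(0,0) becomes σ(0,b), so that the rescaled fibre coefficient can be moved from (0,b) to
      -- (a,b), where the factors e^{2σ} and e^{-2σ} cancel.
      rw [hσsnd 0 0 b, hfibre v v' 0 a b, hσsnd a b 0, ← h3, ← mul_assoc, sq, ← Real.exp_add,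
        ← Real.exp_add, show σ (e.symm (a, 0)) + σ (e.symm (a, 0)) + -2 * σ (e.symm (a, 0)) = 0 by
          ring, Real.exp_zero]
      simp only [coeff] at h1 h2 ⊢
      rw [e.field_prod u v, e.field_prod u' v']
      simp only [map_add, add_apply]
      rw [h1, h2]
      ring
    exact (congrArg₂ (fun s t ↦ g.inner _ s t) (hfield z u v) (hfield z u' v')).trans
      (key z.1 z.2 u u' v v')
  · exact (iff_of_eq (congrArg (· ∈ D₁ _) (hfield z u v))).trans (he.leaf _ (hz z) u v)
  · exact (iff_of_eq (congrArg (· ∈ D₂ _) (hfield z u v))).trans (he.fibre _ (hz z) u v)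

end IsAdapted

end PartialDiffeomorph

end WarpedProduct

/-! ### Local warped products and uniqueness of σ -/

section Main

variable {E : Type*} [NormedAddCommGroup E] [NormedSpace ℝ E] [FiniteDimensional ℝ E]
  {M : Type*} [TopologicalSpace M] [ChartedSpace E M] [IsManifold 𝓘(ℝ, E) ∞ M]

theorem exists_eq_const_of_mvfderiv_eq_zero {W : Set M} (hW : IsOpen W) (hWc : IsPreconnected W)
    {k : M → ℝ} (hk : ContMDiffOn 𝓘(ℝ, E) 𝓘(ℝ) ∞ k W)
    (h0 : ∀ p ∈ W, ∀ v, mvfderiv 𝓘(ℝ, E) k p v = 0) : ∃ c, ∀ q ∈ W, k q = c := by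
  have hk' : ∀ q ∈ W, CMDiffAt ∞ k q := fun q hq ↦ (hk q hq).contMDiffAt (hW.mem_nhds hq)
  have hloc : ∀ p ∈ W, ∀ᶠ q in 𝓝 p, k q = k p := by
    intro p hp
    obtain ⟨c, hc⟩ : ∃ c : PartialDiffeomorph 𝓘(ℝ, E) 𝓘(ℝ, E) M E ∞, p ∈ c.source :=
      ⟨chartDiffeomorph p, mem_chartDiffeomorph_source p⟩
    have hO : IsOpen (c.target ∩ c.symm ⁻¹' W) :=
      c.symm.toOpenPartialHomeomorph.continuousOn.isOpen_inter_preimage c.open_target hW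
    have hcp : c.symm (c p) = p := c.left_inv hc
    have hpO : c p ∈ c.target ∩ c.symm ⁻¹' W := ⟨c.map_source hc, by
      change c.symm (c p) ∈ W
      rwa [hcp]⟩
    obtain ⟨r, hr, hrO⟩ := Metric.isOpen_iff.1 hO (c p) hpO
    have hd : ∀ x ∈ Metric.ball (c p) r, HasFDerivAt (fun x ↦ k (c.symm x)) (0 : E →L[ℝ] ℝ) x := by
      intro x hx
      have hs : c.symm x ∈ c.source := c.map_target (hrO hx).1
      have hx' : c (c.symm x) = x := c.right_inv (hrO hx).1
      have h1 := PartialDiffeomorph.contDiffAt_comp_symm hs (hk' _ (hrO hx).2)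
      have h2 : ∀ w, mvfderiv 𝓘(ℝ, E) k (c.symm x) (c.field (fun _ ↦ w) (c.symm x))
          = fderiv ℝ (fun x ↦ k (c.symm x)) x w := fun w ↦ by
        have h := PartialDiffeomorph.mvfderiv_eq_fderiv hs (hk' _ (hrO hx).2)
          (c.field (fun _ ↦ w) (c.symm x))
        rw [PartialDiffeomorph.mfderiv_field _ hs, hx'] at h
        exact h
      rw [hx'] at h1
      have h3 : fderiv ℝ (fun x ↦ k (c.symm x)) x = 0 := by
        ext w
        exact (h2 w).symm.trans (h0 _ (hrO hx).2 _)
      rw [← h3]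
      exact (h1.differentiableAt (by simp)).hasFDerivAt
    filter_upwards [c.open_source.mem_nhds hc,
      (c.contMDiffAt hc).continuousAt.eventually (Metric.ball_mem_nhds (c p) hr)] with q hq hqr
    have h4 := (convex_ball (c p) r).is_const_of_fderivWithin_eq_zero (𝕜 := ℝ)
      (fun x hx ↦ (hd x hx).differentiableAt.differentiableWithinAt)
      (fun x hx ↦ (hd x hx).hasFDerivWithinAt.fderivWithin
        (Metric.isOpen_ball.uniqueDiffWithinAt hx)) hqr (Metric.mem_ball_self hr)
    have hcq : c.symm (c q) = q := c.left_inv hq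
    have h5 : k (c.symm (c q)) = k (c.symm (c p)) := h4
    rwa [hcq, hcp] at h5
  rcases W.eq_empty_or_nonempty with rfl | ⟨p, hp⟩
  · exact ⟨0, fun q hq ↦ hq.elim⟩
  · have : PreconnectedSpace W := isPreconnected_iff_preconnectedSpace.1 hWc
    have hlc : IsLocallyConstant fun q : W ↦ k q := by
      rw [IsLocallyConstant.iff_eventually_eq]
      exact fun q ↦ continuous_subtype_val.continuousAt.eventually (hloc q q.2)
    exact ⟨k p, fun q hq ↦ hlc.apply_eq_of_preconnectedSpace ⟨q, hq⟩ ⟨p, hp⟩⟩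

variable {g : RiemMetric E M} {D₁ D₂ : Π p : M, Submodule ℝ (TangentSpace 𝓘(ℝ, E) p)}
  {P : Π p : M, TangentSpace 𝓘(ℝ, E) p →ₗ[ℝ] TangentSpace 𝓘(ℝ, E) p}

namespace IsOrthogonalSplitting

theorem exists_isWarpedProductOn (h : IsOrthogonalSplitting g D₁ D₂ P) (hint : IsIntegrable D₂)
    {U : Set M} (hU : IsOpen U) {σ : M → ℝ} (hs : ContMDiffOn 𝓘(ℝ, E) 𝓘(ℝ) ∞ σ U)
    (hσ₂ : ∀ p ∈ U, ∀ Y ∈ D₂ p, mvfderiv 𝓘(ℝ, E) σ p Y = 0)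
    (hσ : HasWarpedConnection g D₁ D₂ U σ) {p : M} (hp : p ∈ U) :
    ∃ W : Set M, IsOpen W ∧ p ∈ W ∧ W ⊆ U ∧
      IsWarpedProductOn g D₁ D₂ W fun q ↦ Real.exp (σ q) := by
  obtain ⟨m₁, m₂, e, hpe, heU, het, hea⟩ := h.exists_adapted_coordinates hint hU hσ hp
  have hz : ∀ z, e.symm z ∈ e.source := fun z ↦ e.map_target (by rw [het]; trivial)
  have hez : ∀ z, e (e.symm z) = z := fun z ↦ e.right_inv (by rw [het]; trivial)
  have hw := hea.isWarpedParametrization het h.inner_eq_zero heU hσ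
    (fun q hq ↦ (hs q (heU hq)).contMDiffAt (hU.mem_nhds (heU hq))) fun q hq ↦ hσ₂ q (heU hq)
  have hσsnd : ∀ a b b', σ (e.symm (a, b)) = σ (e.symm (a, b')) := by
    have h1 := PartialDiffeomorph.fderiv_comp_symm het
      fun q hq ↦ (hs q (heU hq)).contMDiffAt (hU.mem_nhds (heU hq))
    refine eq_of_fderiv_inr_eq_zero h1.1 fun z x ↦ ?_
    rw [h1.2]
    exact hσ₂ _ (heU (hz z)) _ ((hea.fibre _ (hz z) 0 x).2 rfl)
  refine ⟨e.source, e.open_source, hpe, heU, m₁, m₂, EuclideanSpace ℝ (Fin m₁), inferInstance,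
    inferInstance, inferInstance, EuclideanSpace ℝ (Fin m₂), inferInstance, inferInstance,
    inferInstance, _, _, _, _, hw, ?_, fun a ↦ ?_⟩
  · ext q
    exact ⟨by rintro ⟨z, rfl⟩; exact hz z, fun hq ↦ ⟨e q, e.left_inv hq⟩⟩
  -- The warping function was read on the slice {b = 0}; it equals exp σ on all of W because σ is
  -- constant along the fibres.
  · exact congrArg Real.exp (hσsnd a.1 a.2 0)

theorem hasWarpedConnection_log (h : IsOrthogonalSplitting g D₁ D₂ P) {W : Set M} {f : M → ℝ}
    (hW : IsWarpedProductOn g D₁ D₂ W f) :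
    ContMDiffOn 𝓘(ℝ, E) 𝓘(ℝ) ∞ (fun q ↦ Real.log (f q)) W ∧
      (∀ p ∈ W, ∀ Y ∈ D₂ p, mvfderiv 𝓘(ℝ, E) (fun q ↦ Real.log (f q)) p Y = 0) ∧
      HasWarpedConnection g D₁ D₂ W fun q ↦ Real.log (f q) := by
  obtain ⟨m₁, m₂, M₁, _, _, _, M₂, _, _, _, g₁, g₂, f₁, Φ, hΦ, rfl, hf⟩ := hW
  have hc := hΦ.connection hf h.inner_eq_zero
  refine ⟨?_, ?_, ?_⟩
  · rintro _ ⟨a, rfl⟩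
    have hpos : f (Φ a) ≠ 0 := by
      rw [hf]
      exact (hΦ.pos _).ne'
    exact ((Real.contDiffAt_log.2 hpos).contMDiffAt.comp (Φ a) (hc a).1).contMDiffWithinAt
  · rintro _ ⟨a, rfl⟩
    exact (hc a).2.1
  · rintro _ ⟨a, rfl⟩
    exact (hc a).2.2

theorem exists_eq_add_const (h : IsOrthogonalSplitting g D₁ D₂ P) (hD₂ : ∀ p, D₂ p ≠ ⊥) {W : Set M}
    (hW : IsOpen W) (hWc : IsPreconnected W) {σ τ : M → ℝ}
    (hs : ContMDiffOn 𝓘(ℝ, E) 𝓘(ℝ) ∞ σ W) (hs' : ContMDiffOn 𝓘(ℝ, E) 𝓘(ℝ) ∞ τ W)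
    (hσ₂ : ∀ p ∈ W, ∀ Y ∈ D₂ p, mvfderiv 𝓘(ℝ, E) σ p Y = 0)
    (hτ₂ : ∀ p ∈ W, ∀ Y ∈ D₂ p, mvfderiv 𝓘(ℝ, E) τ p Y = 0)
    (hσ : HasWarpedConnection g D₁ D₂ W σ) (hτ : HasWarpedConnection g D₁ D₂ W τ) :
    ∃ c, ∀ q ∈ W, σ q = τ q + c := by
  obtain ⟨c, hc⟩ := exists_eq_const_of_mvfderiv_eq_zero hW hWc (k := fun q ↦ σ q - τ q)
    (hs.sub hs') fun p hp v ↦ by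
      have hd : MDiffAt σ p := ((hs p hp).contMDiffAt (hW.mem_nhds hp)).mdifferentiableAt (by simp)
      have hd' : MDiffAt τ p :=
        ((hs' p hp).contMDiffAt (hW.mem_nhds hp)).mdifferentiableAt (by simp)
      rw [mvfderiv_fun_sub hd hd', sub_apply, sub_eq_zero]
      have h1 : P p v ∈ D₂ p := (h.eq_self_iff p _).1 (h.idem p v)
      have h2 : v - P p v ∈ D₁ p := by rw [← h.eq_zero_iff, map_sub, h.idem, sub_self]
      have h3 : mvfderiv 𝓘(ℝ, E) σ p (v - P p v) = mvfderiv 𝓘(ℝ, E) τ p (v - P p v) := by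
        obtain ⟨x, hx, hx0⟩ := Submodule.exists_mem_ne_zero_of_ne_bot (hD₂ p)
        obtain ⟨X, hX, hX₂, rfl⟩ := h.exists_section hx
        -- With u = X p ≠ 0 the factor ⟨X, u⟩ is positive, so both derivatives along D₁ are
        -- determined by ∇_X X; this is where D₂ ≠ 0 enters.
        have h4 := (hσ p hp X hX hX₂ (X p) _ h2).symm.trans (hτ p hp X hX hX₂ (X p) _ h2)
        exact neg_injective (mul_right_cancel₀ (g.pos p _ hx0).ne' h4)
      rw [map_sub, map_sub, hσ₂ p hp _ h1, hτ₂ p hp _ h1, sub_zero, sub_zero] at h3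
      exact h3
  exact ⟨c, fun q hq ↦ by linarith [hc q hq]⟩

end IsOrthogonalSplitting

end Main

/-! ### The theorem -/

theorem theorem4p3
    {E : Type*} [NormedAddCommGroup E] [NormedSpace ℝ E] [FiniteDimensional ℝ E]
    {M : Type*} [TopologicalSpace M] [T2Space M] [ChartedSpace E M] [IsManifold 𝓘(ℝ, E) ∞ M]
    {E' : Type*} [NormedAddCommGroup E'] [NormedSpace ℝ E'] [FiniteDimensional ℝ E']
    {N : Type*} [TopologicalSpace N] [T2Space N] [ChartedSpace E' N] [IsManifold 𝓘(ℝ, E') ∞ N]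
    (gM : RiemMetric E M) (gN : RiemMetric E' N)
    (F : Π x : N, TangentSpace 𝓘(ℝ, E') x →L[ℝ] TangentSpace 𝓘(ℝ, E') x)
    (hF : IsLocallyProduct gN F)
    (φ : IsometricImmersion gM gN) (θ : ℝ)
    (hM : φ.IsProperSkewSemiInvariantOrderOne F θ)
    (hmixed : φ.IsMixedTotallyGeodesic F θ)
    (hint : IsIntegrable (φ.distT F)) :
    -- the characterization
    (IsLocallyWarpedProduct gM (fun p ↦ φ.distPerp F p ⊔ φ.distSlant F θ p) (φ.distT F) ↔
      ∀ p : M, ∃ (U : Set M) (σ : M → ℝ),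
        IsOpen U ∧ p ∈ U ∧ φ.SatisfiesShapeEquations F θ U σ) ∧
    -- a solution `σ` is locally the logarithm of a warping function
    (∀ (U : Set M) (σ : M → ℝ), IsOpen U → φ.SatisfiesShapeEquations F θ U σ →
      ∀ p ∈ U, ∃ (W : Set M) (f : M → ℝ), IsOpen W ∧ p ∈ W ∧ W ⊆ U ∧
        IsWarpedProductOn gM (fun p ↦ φ.distPerp F p ⊔ φ.distSlant F θ p) (φ.distT F) W f ∧
        ∀ q ∈ W, σ q = Real.log (f q)) ∧
    -- the logarithm of a warping function is a solution, the only one up to a constant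
    (∀ (W : Set M) (f : M → ℝ), IsOpen W →
      IsWarpedProductOn gM (fun p ↦ φ.distPerp F p ⊔ φ.distSlant F θ p) (φ.distT F) W f →
      φ.SatisfiesShapeEquations F θ W (fun q ↦ Real.log (f q)) ∧
      ∀ σ : M → ℝ, IsPreconnected W → φ.SatisfiesShapeEquations F θ W σ →
        ∃ c : ℝ, ∀ q ∈ W, σ q = Real.log (f q) + c) := by
  have hsplit := hM.isOrthogonalSplitting hF
  have key : ∀ (U : Set M) (σ : M → ℝ), IsOpen U → φ.SatisfiesShapeEquations F θ U σ →
      ∀ p ∈ U, ∃ (W : Set M) (f : M → ℝ), IsOpen W ∧ p ∈ W ∧ W ⊆ U ∧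
        IsWarpedProductOn gM (fun p ↦ φ.distPerp F p ⊔ φ.distSlant F θ p) (φ.distT F) W f ∧
        ∀ q ∈ W, σ q = Real.log (f q) := by
    intro U σ hU hσ p hp
    obtain ⟨hs, hσ₂, hc⟩ := (IsometricImmersion.satisfiesShapeEquations_iff hM hF).1 hσ
    obtain ⟨W, hW, hpW, hWU, hw⟩ := hsplit.exists_isWarpedProductOn hint hU hs hσ₂ hc hp
    exact ⟨W, _, hW, hpW, hWU, hw, fun q _ ↦ (Real.log_exp _).symm⟩
  have key' : ∀ (W : Set M) (f : M → ℝ),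
      IsWarpedProductOn gM (fun p ↦ φ.distPerp F p ⊔ φ.distSlant F θ p) (φ.distT F) W f →
      φ.SatisfiesShapeEquations F θ W (fun q ↦ Real.log (f q)) := fun W f hw ↦
    (IsometricImmersion.satisfiesShapeEquations_iff hM hF).2 (hsplit.hasWarpedConnection_log hw)
  refine ⟨⟨fun h p ↦ ?_, fun h p ↦ ?_⟩, key, fun W f hW hw ↦ ⟨key' W f hw, fun σ hWc hσ ↦ ?_⟩⟩
  · obtain ⟨W, f, hW, hpW, hw⟩ := h p
    exact ⟨W, _, hW, hpW, key' W f hw⟩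
  · obtain ⟨U, σ, hU, hpU, hσ⟩ := h p
    obtain ⟨W, f, hW, hpW, -, hw, -⟩ := key U σ hU hσ p hpU
    exact ⟨W, f, hW, hpW, hw⟩
  · obtain ⟨hs, hσ₂, hc⟩ := (IsometricImmersion.satisfiesShapeEquations_iff hM hF).1 hσ
    obtain ⟨hs', hσ₂', hc'⟩ := hsplit.hasWarpedConnection_log hw
    exact hsplit.exists_eq_add_const hM.T_ne_bot hW hWc hs hs' hσ₂ hσ₂' hc hc'

end
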